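/- **Setting.** Let $\mathcal X,\mathcal Y$ be countable sets, $\lambda>0$, $c:\mathcal X\times\mathcal Y\to\mathbb R$, and let $c_X^-\le c_X^+$ on $\mathcal X$ and $c_Y^-\le c_Y^+$ on $\mathcal Y$ be real functions with $c_X^-(x)+c_Y^-(y)\le c(x,y)\le c_X^+(x)+c_Y^+(y)$ for all $x,y$. Put $C_X=1+|c_X^+|+|c_X^-|$, $C_Y=1+|c_Y^+|+|c_Y^-|$, $E_Y=\exp((c_Y^+-c_Y^-)/\lambda)$, $K_Y^4=C_YE_Y^4$, and $(C_X\oplus C_Y)(x,y)=C_X(x)+C_Y(y)$. For a positive weight $f$, let $\ell^1_f$ and $\ell^\infty_f$ be the spaces with norms $\sum f|a|$ and $\sup f^{-1}|b|$; $\mathcal P$ denotes probability vectors. For probability vectors $r,s$ let $\Pi(r,s)$ be the set of nonnegative $\pi\in\ell^1(\mathcal X\times\mathcal Y)$ with marginals $r,s$. The EROT plan $\pi^\lambda(r,s)$ is the minimizer over $\Pi(r,s)$ of $\sum c\,\pi+\lambda\sum_{x,y}\pi_{xy}\log\frac{\pi_{xy}}{r_xs_y}$. EROT potentials are pairs $(\alpha,\beta)$,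 $\alpha$ $r$-integrable and $\beta$ $s$-integrable, that maximize $\sum\alpha r+\sum\beta s-\lambda\sum_{x,y}\big(e^{(\alpha_x+\beta_y-c(x,y))/\lambda}-1\big)r_xs_y$ among all such pairs. A map $\Psi:U\to V$ is Hadamard differentiable at $u$ tangentially to $U_0\subseteq U$ with derivative $D$ if $t_n^{-1}(\Psi(k_n)-\Psi(u))\to D(h)$ whenever $k_n\in U_0$, $t_n>0$, $t_n\to0$ and $t_n^{-1}(k_n-u)\to h$ in $U$. The set of all such limits $h$ is the contingent cone $T_u(U_0)$. **Theorem.** Let $r\in\mathcal P(\mathcal X)$ and $s\in\mathcal P(\mathcal Y)$ have full support, and assume $\|c_X^+-c_X^-\|_\infty<\infty$, $\sum_x C_X(x)r_x<\infty$, $\sum_yK_Y^4(y)s_y<\infty$. Let $U=\ell^1_{C_X}(\mathcal X)\times\ell^1_{K_Y^4}(\mathcal Y)$, $U_0=(\mathcal P(\mathcal X)\cap\ell^1_{C_X}(\mathcal X))\times(\mathcal P(\mathcal Y)\cap\ell^1_{K_Y^4}(\mathcal Y))$, $V=\ell^1_{C_X\oplus C_Y}(\mathcal X\times\mathcal Y)$,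 and fix $y_1\in\mathcal Y$, $\mathcal Y_*=\mathcal Y\setminus\{y_1\}$. 1. For every pair of marginals in $U_0$ there is exactly one EROT plan, and it lies in $V$. Hence $\pi^\lambda:U_0\to V$ is well defined. Write $\pi=\pi^\lambda(r,s)$. 2. The contingent cone is $$T_{(r,s)}(U_0)=\Big\{(h^X,h^Y)\in U:\ \sum_xh^X_x=0,\ \sum_yh^Y_y=0\Big\}.$$ The same holds with $\ell^1_{C_Y}(\mathcal Y)$ in place of $\ell^1_{K_Y^4}(\mathcal Y)$ throughout. 3. The formulas $$(A^Xb)_x=\sum_{y\in\mathcal Y_*}\frac{\pi_{xy}}{r_x}b_y,\quad (A^Ya)_y=\sum_{x}\frac{\pi_{xy}}{s_y}a_x,\quad (B^Xh^Y)_x=\sum_{y\in\mathcal Y}\frac{\pi_{xy}}{r_xs_y}h^Y_y,\quad (B^Yh^X)_y=\sum_x\frac{\pi_{xy}}{r_xs_y}h^X_x$$ define bounded operators $A^X:\ell^\infty_{E_Y}(\mathcal Y_*)\to\ell^\infty(\mathcal X)$, $A^Y:\ell^\infty(\mathcal X)\to\ell^\infty_{E_Y}(\mathcal Y_*)$, $B^X:\ell^1_{K_Y^4}(\mathcal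 Y)\to\ell^\infty(\mathcal X)$, $B^Y:\ell^1_{C_X}(\mathcal X)\to\ell^\infty_{E_Y}(\mathcal Y_*)$. The operators $\mathrm{Id}-A^XA^Y$ and $\mathrm{Id}-A^YA^X$ are invertible, with inverses given by the norm-convergent Neumann series $\sum_m(A^XA^Y)^m$ and $\sum_m(A^YA^X)^m$. 4. $\pi^\lambda$ is Hadamard differentiable at $(r,s)$ tangentially to $U_0$. With $A_*^T(a,b)_{xy}=a_x+b_y$ for $y\ne y_1$ and $A_*^T(a,b)_{xy_1}=a_x$, the derivative is the restriction to $T_{(r,s)}(U_0)$ of the bounded linear operator $D:U\to V$, $$D(h^X,h^Y)=\frac{\pi}{r\otimes s}\odot\big[r\otimes h^Y+h^X\otimes s\big]-\pi\odot A_*^T\begin{pmatrix}(\mathrm{Id}-A^XA^Y)^{-1}&-(\mathrm{Id}-A^XA^Y)^{-1}A^X\\-A^Y(\mathrm{Id}-A^XA^Y)^{-1}&(\mathrm{Id}-A^YA^X)^{-1}\end{pmatrix}\begin{pmatrix}B^Xh^Y\\B^Yh^X\end{pmatrix}.$$ 5. There is exactly one pair of EROT potentials $(\alpha,\beta)$ for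 $(r,s)$ with $\beta_{y_1}=0$. For it and every $(h^X,h^Y)\in T_{(r,s)}(U_0)$, the system $$z-\tfrac1\lambda e^{(\alpha\oplus\beta-c)/\lambda}\odot(r\otimes s)\odot A_*^T(a,b)=e^{(\alpha\oplus\beta-c)/\lambda}\odot\big(r\otimes h^Y+h^X\otimes s\big),$$ $$\sum_{y\in\mathcal Y}z_{xy}=h^X_x\ (x\in\mathcal X),\qquad \sum_{x\in\mathcal X}z_{xy}=h^Y_y\ (y\in\mathcal Y_*)$$ has exactly one solution $(z,a,b)\in V\times\ell^\infty(\mathcal X)\times\ell^\infty_{E_Y}(\mathcal Y_*)$, and $z=D(h^X,h^Y)$. That is, $D$ is the $\pi$-component of $-[\mathcal D_{\pi,\alpha,\beta_*}\mathcal F]^{-1}\circ\mathcal D_{r,s_*}\mathcal F$, where $\mathcal F=\big(\pi-e^{(A_*^T(\alpha,\beta_*)-c)/\lambda}\odot(r\otimes s),\ A_*\pi-(r,s_*)\big)$, $A_*$ maps $\pi$ to its marginals on $\mathcal X$ and $\mathcal Y_*$, and $\beta_*,s_*$ are the restrictions of $\beta,s$ to $\mathcal Y_*$. -/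

import Mathlib

open Filter Topology
open scoped ENNReal

noncomputable section

namespace EROT

variable {ι X Y : Type*}

/-! ### Weighted sequence spaces -/

/-- A strictly positive weight function. -/
class PosWeight (f : ι → ℝ) : Prop where
  pos : ∀ i, 0 < f i

/-- The functions `a` with `∑ i, f i * |a i| < ∞`. -/
def wl1Submodule (f : ι → ℝ) [PosWeight f] : Submodule ℝ (ι → ℝ) where
  carrier := {a | Summable fun i => f i * |a i|}
  zero_mem' := by simp [summable_zero]
  add_mem' := by
    intro a b ha hb
    refine Summable.of_nonneg_of_le
      (fun i => mul_nonneg (PosWeight.pos i).le (abs_nonneg _)) (fun i => ?_) (ha.add hb)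
    have h := mul_le_mul_of_nonneg_left (abs_add_le (a i) (b i)) (PosWeight.pos (f := f) i).le
    simpa [mul_add] using h
  smul_mem' := by
    intro t a ha
    have h : Summable fun i => |t| * (f i * |a i|) := Summable.mul_left |t| ha
    refine h.congr fun i => ?_
    simp only [Pi.smul_apply, smul_eq_mul, abs_mul]
    ring

/-- The weighted space `ℓ¹_f`, with norm `∑ i, f i * |a i|`. -/
def WL1 (f : ι → ℝ) [PosWeight f] : Type _ := wl1Submodule f

namespace WL1

variable {f : ι → ℝ} [PosWeight f]

instance : AddCommGroup (WL1 f) := inferInstanceAs (AddCommGroup (wl1Submodule f))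

instance : Module ℝ (WL1 f) := inferInstanceAs (Module ℝ (wl1Submodule f))

instance : CoeFun (WL1 f) (fun _ => ι → ℝ) := ⟨fun a => a.1⟩

/-- A function with finite weighted norm, as an element of `ℓ¹_f`. -/
def mk (a : ι → ℝ) (ha : Summable fun i => f i * |a i|) : WL1 f := ⟨a, ha⟩

open Classical in
/-- The element of `ℓ¹_f` given by `a` if `a` has finite weighted norm, and `0` otherwise. -/
def ofFun (f : ι → ℝ) [PosWeight f] (a : ι → ℝ) : WL1 f :=
  if ha : Summable fun i => f i * |a i| then mk a ha else 0

theorem summable (a : WL1 f) : Summable fun i => f i * |a i| := a.2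

theorem term_nonneg (a : WL1 f) (i : ι) : 0 ≤ f i * |a i| :=
  mul_nonneg (PosWeight.pos i).le (abs_nonneg _)

instance : NormedAddCommGroup (WL1 f) :=
  AddGroupNorm.toNormedAddCommGroup
    { toFun := fun a => ∑' i, f i * |a i|
      map_zero' := by
        have h : ∀ i, f i * |(0 : WL1 f) i| = 0 := fun i => by
          change f i * |(0 : ℝ)| = 0
          simp
        simp [h]
      add_le' := by
        intro a b
        rw [← (summable a).tsum_add (summable b)]
        refine Summable.tsum_le_tsum (fun i => ?_) (summable (a + b))
          ((summable a).add (summable b))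
        have h := mul_le_mul_of_nonneg_left (abs_add_le (a i) (b i)) (PosWeight.pos (f := f) i).le
        rw [mul_add] at h
        exact h
      neg' := by
        intro a
        refine tsum_congr fun i => ?_
        change f i * |-(a i)| = _
        rw [abs_neg]
      eq_zero_of_map_eq_zero' := by
        intro a ha
        have h := (summable a).hasSum
        rw [ha] at h
        have h0 := (hasSum_zero_iff_of_nonneg (term_nonneg a)).1 h
        refine Subtype.ext (funext fun i => ?_)
        have hi : f i * |a i| = 0 := congrFun h0 i
        exact abs_eq_zero.1 ((mul_eq_zero.1 hi).resolve_left (PosWeight.pos i).ne') }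

theorem norm_def (a : WL1 f) : ‖a‖ = ∑' i, f i * |a i| := rfl

instance : NormedSpace ℝ (WL1 f) where
  norm_smul_le := by
    intro t a
    rw [norm_def, norm_def, Real.norm_eq_abs, ← tsum_mul_left]
    refine le_of_eq (tsum_congr fun i => ?_)
    change f i * |t * a i| = _
    rw [abs_mul]
    ring

end WL1

/-- The functions `b` with `sup i, (f i)⁻¹ * |b i| < ∞`. -/
def wlinfSubmodule (f : ι → ℝ) [PosWeight f] : Submodule ℝ (ι → ℝ) where
  carrier := {b | BddAbove (Set.range fun i => (f i)⁻¹ * |b i|)}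
  zero_mem' := ⟨0, by rintro _ ⟨i, rfl⟩; simp⟩
  add_mem' := by
    rintro a b ⟨A, hA⟩ ⟨B, hB⟩
    refine ⟨A + B, ?_⟩
    rintro _ ⟨i, rfl⟩
    have h := mul_le_mul_of_nonneg_left (abs_add_le (a i) (b i))
      (inv_pos.2 (PosWeight.pos (f := f) i)).le
    have h1 := hA ⟨i, rfl⟩
    have h2 := hB ⟨i, rfl⟩
    simp only [Pi.add_apply] at h1 h2 ⊢
    linarith
  smul_mem' := by
    rintro t a ⟨A, hA⟩
    refine ⟨|t| * A, ?_⟩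
    rintro _ ⟨i, rfl⟩
    have h1 := mul_le_mul_of_nonneg_left (hA ⟨i, rfl⟩) (abs_nonneg t)
    simp only [Pi.smul_apply, smul_eq_mul, abs_mul] at h1 ⊢
    linarith

/-- The weighted space `ℓ^∞_f`, with norm `sup i, (f i)⁻¹ * |b i|`. -/
def WLinf (f : ι → ℝ) [PosWeight f] : Type _ := wlinfSubmodule f

namespace WLinf

variable {f : ι → ℝ} [PosWeight f]

instance : AddCommGroup (WLinf f) := inferInstanceAs (AddCommGroup (wlinfSubmodule f))

instance : Module ℝ (WLinf f) := inferInstanceAs (Module ℝ (wlinfSubmodule f))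

instance : CoeFun (WLinf f) (fun _ => ι → ℝ) := ⟨fun a => a.1⟩

theorem bdd (b : WLinf f) : BddAbove (Set.range fun i => (f i)⁻¹ * |b i|) := b.2

theorem term_nonneg (b : WLinf f) (i : ι) : 0 ≤ (f i)⁻¹ * |b i| :=
  mul_nonneg (inv_pos.2 (PosWeight.pos i)).le (abs_nonneg _)

instance : NormedAddCommGroup (WLinf f) :=
  AddGroupNorm.toNormedAddCommGroup
    { toFun := fun b => ⨆ i, (f i)⁻¹ * |b i|
      map_zero' := by
        have h : ∀ i, (f i)⁻¹ * |(0 : WLinf f) i| = 0 := fun i => by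
          change (f i)⁻¹ * |(0 : ℝ)| = 0
          simp
        simp [h]
      add_le' := by
        intro a b
        refine Real.iSup_le (fun i => ?_)
          (add_nonneg (Real.iSup_nonneg (term_nonneg a)) (Real.iSup_nonneg (term_nonneg b)))
        have h := mul_le_mul_of_nonneg_left (abs_add_le (a i) (b i))
          (inv_pos.2 (PosWeight.pos (f := f) i)).le
        rw [mul_add] at h
        exact h.trans (add_le_add (le_ciSup (bdd a) i) (le_ciSup (bdd b) i))
      neg' := by
        intro a
        refine iSup_congr fun i => ?_
        change (f i)⁻¹ * |-(a i)| = _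
        rw [abs_neg]
      eq_zero_of_map_eq_zero' := by
        intro a ha
        refine Subtype.ext (funext fun i => ?_)
        have h1 : (f i)⁻¹ * |a i| ≤ 0 := (le_ciSup (bdd a) i).trans ha.le
        have h2 : (f i)⁻¹ * |a i| = 0 := le_antisymm h1 (term_nonneg a i)
        exact abs_eq_zero.1 ((mul_eq_zero.1 h2).resolve_left
          (inv_pos.2 (PosWeight.pos (f := f) i)).ne') }

theorem norm_def (b : WLinf f) : ‖b‖ = ⨆ i, (f i)⁻¹ * |b i| := rfl

instance : NormedSpace ℝ (WLinf f) where
  norm_smul_le := by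
    intro t b
    rw [norm_def, norm_def, Real.norm_eq_abs, Real.mul_iSup_of_nonneg (abs_nonneg t)]
    refine le_of_eq (iSup_congr fun i => ?_)
    change (f i)⁻¹ * |t * b i| = _
    rw [abs_mul]
    ring

end WLinf

/-! ### The weights attached to dominating functions -/

/-- `1 + |c⁺| + |c⁻|`. -/
def growthWeight (cm cp : ι → ℝ) : ι → ℝ := fun i => 1 + |cp i| + |cm i|

/-- `exp ((c⁺ - c⁻) / lam)`. -/
def expWeight (lam : ℝ) (cm cp : ι → ℝ) : ι → ℝ := fun i => Real.exp ((cp i - cm i) / lam)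

/-- `(1 + |c⁺| + |c⁻|) * exp ((c⁺ - c⁻) / lam) ^ m`. -/
def kWeight (lam : ℝ) (m : ℕ) (cm cp : ι → ℝ) : ι → ℝ :=
  fun i => growthWeight cm cp i * expWeight lam cm cp i ^ m

/-- The tensor sum `f ⊕ g`. -/
def sumWeight (f : X → ℝ) (g : Y → ℝ) : X × Y → ℝ := fun p => f p.1 + g p.2

/-- The constant weight `1`. -/
def oneWeight (ι : Type*) : ι → ℝ := fun _ => 1

/-- The exponential weight restricted to `Y ∖ {y₁}`. -/
def expWeightOff (y₁ : Y) (lam : ℝ) (cm cp : Y → ℝ) : {y : Y // y ≠ y₁} → ℝ :=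
  fun y => expWeight lam cm cp y.1

instance (cm cp : ι → ℝ) : PosWeight (growthWeight cm cp) :=
  ⟨fun i => by unfold growthWeight; positivity⟩

instance (lam : ℝ) (cm cp : ι → ℝ) : PosWeight (expWeight lam cm cp) :=
  ⟨fun _ => Real.exp_pos _⟩

instance (lam : ℝ) (m : ℕ) (cm cp : ι → ℝ) : PosWeight (kWeight lam m cm cp) :=
  ⟨fun i => mul_pos (PosWeight.pos i) (pow_pos (PosWeight.pos i) m)⟩

instance (f : X → ℝ) (g : Y → ℝ) [PosWeight f] [PosWeight g] : PosWeight (sumWeight f g) :=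
  ⟨fun p => add_pos (PosWeight.pos p.1) (PosWeight.pos p.2)⟩

instance : PosWeight (oneWeight ι) := ⟨fun _ => one_pos⟩

instance (y₁ : Y) (lam : ℝ) (cm cp : Y → ℝ) : PosWeight (expWeightOff y₁ lam cm cp) :=
  ⟨fun _ => Real.exp_pos _⟩

/-! ### Entropy regularized optimal transport -/

/-- Probability vectors. -/
def IsProb (r : ι → ℝ) : Prop := (∀ i, 0 ≤ r i) ∧ HasSum r 1

/-- The couplings of `r` and `s`. -/
def couplings (r : X → ℝ) (s : Y → ℝ) : Set (X × Y → ℝ) :=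
  {π | (∀ p, 0 ≤ π p) ∧ Summable π ∧ (∀ x, HasSum (fun y => π (x, y)) (r x)) ∧
    ∀ y, HasSum (fun x => π (x, y)) (s y)}

/-- The sum of a real series with values in `[-∞, ∞]`: the sum of the positive parts minus the sum
of the negative parts. (It is used only where the latter is finite.) -/
def extSum (f : ι → ℝ) : EReal :=
  ((∑' i, ENNReal.ofReal (f i) : ℝ≥0∞) : EReal) - ((∑' i, ENNReal.ofReal (-f i) : ℝ≥0∞) : EReal)

/-- The mutual information `∑ π log (π / (first marginal ⊗ second marginal))`, in `[0, ∞]` for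
probability vectors; the convention `0 log 0 = 0` is built in. -/
def mutualInfo (π : X × Y → ℝ) : EReal :=
  extSum fun p : X × Y => π p * Real.log (π p / ((∑' y, π (p.1, y)) * ∑' x, π (x, p.2)))

/-- The primal objective `⟨c, π⟩ + lam * M(π)`. -/
def primalObjective (c : X → Y → ℝ) (lam : ℝ) (π : X × Y → ℝ) : EReal :=
  ((∑' p : X × Y, c p.1 p.2 * π p : ℝ) : EReal) + (lam : EReal) * mutualInfo π

/-- `π` minimizes the primal objective over all couplings of `r` and `s`. -/
def IsPlan (c : X → Y → ℝ) (lam : ℝ) (r : X → ℝ) (s : Y → ℝ) (π : X × Y → ℝ) : Prop :=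
  π ∈ couplings r s ∧ ∀ π' ∈ couplings r s, primalObjective c lam π ≤ primalObjective c lam π'

/-- The EROT plan: a minimizer (unspecified if there is none). -/
def plan (c : X → Y → ℝ) (lam : ℝ) (r : X → ℝ) (s : Y → ℝ) : X × Y → ℝ :=
  Classical.epsilon (IsPlan c lam r s)

/-- The dual objective
`⟨α, r⟩ + ⟨β, s⟩ - lam * ∑ (exp ((α + β - c) / lam) * r * s - r * s)`. -/
def dualObjective (c : X → Y → ℝ) (lam : ℝ) (r : X → ℝ) (s : Y → ℝ) (α : X → ℝ) (β : Y → ℝ) :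
    EReal :=
  ((∑' x, α x * r x + ∑' y, β y * s y : ℝ) : EReal) -
    (lam : EReal) * extSum fun p : X × Y =>
      Real.exp ((α p.1 + β p.2 - c p.1 p.2) / lam) * (r p.1 * s p.2) - r p.1 * s p.2

/-- `(α, β)` are EROT potentials: `α` is `r`-integrable, `β` is `s`-integrable, and the pair
maximizes the dual objective among all such pairs. -/
def IsPotentials (c : X → Y → ℝ) (lam : ℝ) (r : X → ℝ) (s : Y → ℝ) (α : X → ℝ) (β : Y → ℝ) :
    Prop :=
  (Summable fun x => |α x| * r x) ∧ (Summable fun y => |β y| * s y) ∧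
    ∀ (α' : X → ℝ) (β' : Y → ℝ),
      (Summable fun x => |α' x| * r x) → (Summable fun y => |β' y| * s y) →
        dualObjective c lam r s α' β' ≤ dualObjective c lam r s α β

/-! ### Hadamard differentiability -/

section Hadamard

variable {U V : Type*} [NormedAddCommGroup U] [NormedSpace ℝ U]
  [NormedAddCommGroup V] [NormedSpace ℝ V]

/-- `Ψ` is Hadamard differentiable at `u` tangentially to `U₀` with derivative `D`. -/
def HasHadamardDerivTangentially (Ψ : U → V) (D : U →L[ℝ] V) (U₀ : Set U) (u : U) : Prop :=
  ∀ (k : ℕ → U) (t : ℕ → ℝ) (h : U), (∀ n, k n ∈ U₀) → (∀ n, 0 < t n) →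
    Tendsto t atTop (𝓝 0) → Tendsto (fun n => (t n)⁻¹ • (k n - u)) atTop (𝓝 h) →
      Tendsto (fun n => (t n)⁻¹ • (Ψ (k n) - Ψ u)) atTop (𝓝 (D h))

/-- The contingent (Bouligand) cone to `U₀` at `u`. -/
def contingentCone (U₀ : Set U) (u : U) : Set U :=
  {h | ∃ (k : ℕ → U) (t : ℕ → ℝ), (∀ n, k n ∈ U₀) ∧ (∀ n, 0 < t n) ∧
    Tendsto t atTop (𝓝 0) ∧ Tendsto (fun n => (t n)⁻¹ • (k n - u)) atTop (𝓝 h)}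

end Hadamard

/-- `(𝒫(X) ∩ ℓ¹_f) × (𝒫(Y) ∩ ℓ¹_g)`. -/
def probPairs (f : X → ℝ) (g : Y → ℝ) [PosWeight f] [PosWeight g] : Set (WL1 f × WL1 g) :=
  {k | IsProb k.1 ∧ IsProb k.2}

/-- The pairs of mass-zero elements of `ℓ¹_f × ℓ¹_g`. -/
def massZeroPairs (f : X → ℝ) (g : Y → ℝ) [PosWeight f] [PosWeight g] : Set (WL1 f × WL1 g) :=
  {h | HasSum h.1 0 ∧ HasSum h.2 0}

/-- The EROT plan as a map from pairs of marginals in `ℓ¹_f × ℓ¹_g` to `ℓ¹_w`. -/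
def planMap (c : X → Y → ℝ) (lam : ℝ) (f : X → ℝ) (g : Y → ℝ) (w : X × Y → ℝ)
    [PosWeight f] [PosWeight g] [PosWeight w] (k : WL1 f × WL1 g) : WL1 w :=
  WL1.ofFun w (plan c lam k.1 k.2)

/-! ### The optimality system and its componentwise partial derivatives -/

open Classical in
/-- The extension of a function on `Y ∖ {y₁}` by the value `v` at `y₁`. -/
def extendAt (y₁ : Y) (v : ℝ) (b : {y : Y // y ≠ y₁} → ℝ) : Y → ℝ :=
  fun y => if h : y = y₁ then v else b ⟨y, h⟩

/-- The operator `A_*ᵀ`, `(a, b) ↦ a ⊕ (0, b)`. -/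
def starT (y₁ : Y) (a : X → ℝ) (b : {y : Y // y ≠ y₁} → ℝ) : X × Y → ℝ :=
  fun p => a p.1 + extendAt y₁ 0 b p.2

/-- The partial derivative with respect to `(π, α, β_*)`, at `(α, β_*, r, s)`, of
`(π, α, β_*, r, s_*) ↦ (π - exp ((A_*ᵀ(α, β_*) - c) / lam) ⊙ (r ⊗ s), A_* π - (r, s_*))`,
applied to `(z, a, b)`. -/
def systemDerivSol (c : X → Y → ℝ) (lam : ℝ) (y₁ : Y) (r : X → ℝ) (s : Y → ℝ)
    (α : X → ℝ) (β : {y : Y // y ≠ y₁} → ℝ)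
    (z : X × Y → ℝ) (a : X → ℝ) (b : {y : Y // y ≠ y₁} → ℝ) :
    (X × Y → ℝ) × (X → ℝ) × ({y : Y // y ≠ y₁} → ℝ) :=
  (fun p => z p - lam⁻¹ * Real.exp ((starT y₁ α β p - c p.1 p.2) / lam) * (r p.1 * s p.2) *
      starT y₁ a b p,
    fun x => ∑' y, z (x, y), fun y => ∑' x, z (x, y.1))

/-- The partial derivative of the same map with respect to `(r, s_*)`, at `(α, β_*, r, s)`,
applied to `(h, h_*)`; the entry of the second perturbation at `y₁` is minus the sum of the other
entries. -/
def systemDerivMarg (c : X → Y → ℝ) (lam : ℝ) (y₁ : Y) (r : X → ℝ) (s : Y → ℝ)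
    (α : X → ℝ) (β : {y : Y // y ≠ y₁} → ℝ) (hX : X → ℝ) (hY : {y : Y // y ≠ y₁} → ℝ) :
    (X × Y → ℝ) × (X → ℝ) × ({y : Y // y ≠ y₁} → ℝ) :=
  (fun p => -(Real.exp ((starT y₁ α β p - c p.1 p.2) / lam) *
      (r p.1 * extendAt y₁ (-∑' y, hY y) hY p.2 + hX p.1 * s p.2)),
    fun x => -hX x, fun y => -hY y)

end EROT

end

open EROT

/-!
Reduce the cost by its lower dominating functions and consider the kernel
`k = exp (-(c - c_X⁻ - c_Y⁻) / λ)`. The assumptions say that `κ / E_Y ≤ k ≤ 1` for a constant `κ > 0`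
(`kernelBounds_reducedKernel`), and everything rests on these two bounds.

*Plans and potentials.* Positive functions `f`, `g` for which `f ⊗ g ⊙ k` is a density, with respect
to `r ⊗ s`, of a coupling exist by maximizing a functional on a compact box, where one
Sinkhorn step from the maximizer stays in the box (`KernelBounds.exists_isScaling`). They obey a
priori bounds that depend on the marginals only through `∑ E_Y s`. By Gibbs' inequality the coupling
obtained is the only plan, and `λ log f`, `λ log g`, corrected by the lower dominating functions and
a constant, are the only potentials (`isPlan_iff`, `isPotentials_iff`).

*The operators.* The rows and columns of `π / r` and `π / s` are conditional probabilities. As the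
sum defining `A^X` omits `y₁`, which carries conditional mass at least `δ > 0`, the norm of `A^X A^Y`
is at most `1 - δ`, and the Neumann series converge (`exists_isMarginalOps`,
`neumann_of_norm_comp_lt_one`).

*The derivative.* For the scalings `f'`, `g'` of a second pair of marginals put `u = f' / f` and
`v = g' / g`, normalized by `v y₁ = 1`. The marginal equations express `1 / u` and `1 / v` as averages
of `v` and `u`. Omitting `y₁` gives a contraction again, so `u - 1` and `v - 1` are of the order of
the distance `η` of the marginals (`Perturbation.abs_inv_u_sub_one_le`); inserting this into the
equations shows that `(u - 1, v - 1)` solves, up to an error of order `η ^ 2`, a linear system that is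
inverted by `(1 - A^X A^Y)⁻¹` (`exists_factor_expansion`). Hence the plan map differs from its
linearization by a quadratic error (`exists_planMap_quadratic`), which is stronger than Hadamard
differentiability. Each step costs a power of `E_Y`, which is why the weight contains `E_Y ^ 4`.

*The linearized system.* Solving its first equation for `z` leaves two equations for `(a, b)`, which
are inverted by the same Neumann series (`linearized_system_iff`).

*The contingent cone.* A mass-zero direction is a limit of difference quotients of probability
vectors, obtained by truncating the negative part and renormalizing
(`WL1.exists_prob_seq_tendsto`).
-/

/-! ### Weighted sequence spaces and the contingent cone -/

namespace EROT

variable {ι X Y : Type*}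

namespace WL1

variable {f : ι → ℝ} [PosWeight f]

@[simp] theorem add_apply (a b : WL1 f) (i : ι) : (a + b) i = a i + b i := rfl
@[simp] theorem sub_apply (a b : WL1 f) (i : ι) : (a - b) i = a i - b i := rfl
@[simp] theorem smul_apply (t : ℝ) (a : WL1 f) (i : ι) : (t • a) i = t * a i := rfl
@[simp] theorem mk_apply (a : ι → ℝ) (ha : Summable fun i => f i * |a i|) (i : ι) :
    (mk a ha) i = a i := rfl

theorem ext {a b : WL1 f} (h : ∀ i, a i = b i) : a = b := Subtype.ext (funext h)

theorem ofFun_eq_mk {a : ι → ℝ} (ha : Summable fun i => f i * |a i|) : ofFun f a = mk a ha :=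
  dif_pos ha

theorem ofFun_coe {a : ι → ℝ} (ha : Summable fun i => f i * |a i|) :
    (ofFun f a : ι → ℝ) = a := by
  rw [ofFun_eq_mk ha]; rfl

theorem summable_abs (hf : ∀ i, 1 ≤ f i) (a : WL1 f) : Summable fun i => |a i| :=
  Summable.of_nonneg_of_le (fun _ => abs_nonneg _)
    (fun i => le_mul_of_one_le_left (abs_nonneg _) (hf i)) (summable a)

theorem summable_coe (hf : ∀ i, 1 ≤ f i) (a : WL1 f) : Summable (a : ι → ℝ) :=
  (summable_abs hf a).of_abs

theorem tsum_mul_abs_le (a : WL1 f) {w : ι → ℝ} {M : ℝ} (hw : ∀ i, 0 ≤ w i)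
    (hwf : ∀ i, w i ≤ M * f i) :
    (Summable fun i => w i * |a i|) ∧ ∑' i, w i * |a i| ≤ M * ‖a‖ := by
  have hle : ∀ i, w i * |a i| ≤ M * (f i * |a i|) := fun i => by
    rw [← mul_assoc]; exact mul_le_mul_of_nonneg_right (hwf i) (abs_nonneg _)
  have hs : Summable fun i => w i * |a i| :=
    Summable.of_nonneg_of_le (fun i => mul_nonneg (hw i) (abs_nonneg _)) hle
      ((summable a).mul_left M)
  refine ⟨hs, ?_⟩
  rw [norm_def, ← tsum_mul_left]
  exact hs.tsum_le_tsum hle ((summable a).mul_left M)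

/-- The total mass, as a bounded functional on `ℓ¹_f` for a weight `f ≥ 1`. -/
noncomputable def mass (f : ι → ℝ) [PosWeight f] (hf : ∀ i, 1 ≤ f i) : WL1 f →L[ℝ] ℝ :=
  LinearMap.mkContinuous
    { toFun := fun a => ∑' i, a i
      map_add' := fun a b => (summable_coe hf a).tsum_add (summable_coe hf b)
      map_smul' := fun t a => by
        simp only [smul_apply, RingHom.id_apply, smul_eq_mul]
        exact tsum_mul_left } 1 (fun a => by
      have h := tsum_mul_abs_le a (w := fun _ => 1) (M := 1) (fun _ => zero_le_one)
        (fun i => by simpa using hf i)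
      simp only [one_mul] at h ⊢
      exact (norm_tsum_le_tsum_norm (f := (a : ι → ℝ)) h.1).trans h.2)

theorem mass_apply (hf : ∀ i, 1 ≤ f i) (a : WL1 f) : mass f hf a = ∑' i, a i := rfl

/-- Every mass-zero direction at a fully supported probability vector `r` is a limit of difference
quotients of probability vectors. The vectors are `(r + t ĥ) / (1 + t m)`, where
`ĥ = max h (-r / t)` keeps the entries nonnegative and `m = ∑ ĥ ≥ 0` restores the total mass. -/
theorem exists_prob_seq_tendsto (hf : ∀ i, 1 ≤ f i) {r : ι → ℝ} (hr : IsProb r)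
    (hr0 : ∀ i, 0 < r i) (hrf : Summable fun i => f i * |r i|) (h : WL1 f) (hh : HasSum h 0) :
    ∃ k : ℕ → WL1 f, (∀ n, IsProb (k n)) ∧
      Tendsto (fun n : ℕ => (1 / ((n : ℝ) + 1))⁻¹ • (k n - mk r hrf)) atTop (𝓝 h) := by
  set t : ℕ → ℝ := fun n => 1 / ((n : ℝ) + 1) with ht
  have ht0 : ∀ n, 0 < t n := fun n => by simp only [ht]; positivity
  have htl : Tendsto t atTop (𝓝 0) := tendsto_one_div_add_atTop_nhds_zero_nat
  have habs : ∀ n i, |max (h i) (-(r i / t n))| ≤ |h i| := fun n i => by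
    have : 0 < r i / t n := div_pos (hr0 i) (ht0 n)
    rcases max_cases (h i) (-(r i / t n)) with ⟨h1, _⟩ | ⟨h1, h2⟩
    · rw [h1]
    · rw [h1, abs_neg, abs_of_pos this, abs_of_neg (by linarith)]; linarith
  let g : ℕ → WL1 f := fun n => mk (fun i => max (h i) (-(r i / t n)))
    (Summable.of_nonneg_of_le (fun i => mul_nonneg (PosWeight.pos i).le (abs_nonneg _))
      (fun i => mul_le_mul_of_nonneg_left (habs n i) (PosWeight.pos i).le) (summable h))
  have hg : Tendsto g atTop (𝓝 h) := by
    rw [tendsto_iff_norm_sub_tendsto_zero]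
    have h0 : (0 : ℝ) = ∑' i : ι, (0 : ℝ) := by simp
    rw [h0]
    refine tendsto_tsum_of_dominated_convergence (bound := fun i => 2 * (f i * |h i|))
      ((summable h).mul_left 2) (fun i => ?_) (Eventually.of_forall fun n i => ?_)
    · refine tendsto_const_nhds.congr' ?_
      have : ∀ᶠ n : ℕ in atTop, -h i / r i ≤ n := tendsto_natCast_atTop_atTop.eventually_ge_atTop _
      filter_upwards [this] with n hn
      have h1 : -(r i / t n) ≤ h i := by
        rw [div_le_iff₀ (hr0 i)] at hn
        have : r i / t n = r i * (n + 1) := by simp [ht]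
        rw [this]; nlinarith [hr0 i]
      change 0 = f i * |max (h i) (-(r i / t n)) - h i|
      rw [max_eq_left h1]; simp
    · change ‖f i * |max (h i) (-(r i / t n)) - h i|‖ ≤ _
      have hfi := (PosWeight.pos (f := f) i).le
      rw [Real.norm_eq_abs, abs_of_nonneg (mul_nonneg hfi (abs_nonneg _))]
      have h1 := (abs_sub (max (h i) (-(r i / t n))) (h i)).trans
        (add_le_add_left (habs n i) |h i|)
      nlinarith
  let m : ℕ → ℝ := fun n => mass f hf (g n)
  have hm : Tendsto m atTop (𝓝 0) := by
    have := ((mass f hf).continuous.tendsto h).comp hg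
    rwa [mass_apply, hh.tsum_eq] at this
  have hm0 : ∀ n, 0 ≤ m n := fun n => by
    change 0 ≤ ∑' i, g n i
    rw [← hh.tsum_eq]
    exact (summable_coe hf h).tsum_le_tsum (fun i => le_max_left _ _) (summable_coe hf (g n))
  have hpos : ∀ n, 0 < 1 + t n * m n := fun n => by
    have := mul_nonneg (ht0 n).le (hm0 n); linarith
  refine ⟨fun n => (1 + t n * m n)⁻¹ • (mk r hrf + t n • g n), fun n => ⟨fun i => ?_, ?_⟩, ?_⟩
  · simp only [smul_apply, add_apply, mk_apply]
    refine mul_nonneg (inv_nonneg.2 (hpos n).le) ?_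
    have h1 : -(r i / t n) ≤ g n i := le_max_right _ _
    have h2 := mul_le_mul_of_nonneg_left h1 (ht0 n).le
    rw [mul_neg, mul_div_cancel₀ _ (ht0 n).ne'] at h2
    linarith
  · have h1 : HasSum (fun i => r i + t n * g n i) (1 + t n * m n) :=
      hr.2.add ((summable_coe hf (g n)).hasSum.mul_left _)
    have := h1.mul_left (1 + t n * m n)⁻¹
    rwa [inv_mul_cancel₀ (hpos n).ne'] at this
  · have h1 : Tendsto (fun n => (1 + t n * m n)⁻¹ • (g n - m n • mk r hrf)) atTop
        (𝓝 (((1 : ℝ) + 0 * 0)⁻¹ • (h - (0 : ℝ) • mk r hrf))) :=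
      ((tendsto_const_nhds.add (htl.mul hm)).inv₀ (by norm_num)).smul
        (hg.sub (hm.smul_const _))
    simp only [mul_zero, add_zero, inv_one, one_smul, zero_smul, sub_zero] at h1
    refine h1.congr fun n => ext fun i => ?_
    change _ = (t n)⁻¹ * ((1 + t n * m n)⁻¹ * (r i + t n * g n i) - r i)
    have h2 := (hpos n).ne'
    have h3 := (ht0 n).ne'
    simp only [smul_apply, sub_apply, mk_apply]
    field_simp
    ring

end WL1

/-- At a fully supported pair of probability vectors the contingent cone to the probability vectors
consists of all mass-zero directions. -/
theorem contingentCone_probPairs {f : X → ℝ} {g : Y → ℝ} [PosWeight f] [PosWeight g]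
    (hf : ∀ x, 1 ≤ f x) (hg : ∀ y, 1 ≤ g y) {r : X → ℝ} {s : Y → ℝ} (hr : IsProb r)
    (hs : IsProb s) (hr0 : ∀ x, 0 < r x) (hs0 : ∀ y, 0 < s y)
    (hrf : Summable fun x => f x * |r x|) (hsg : Summable fun y => g y * |s y|) :
    contingentCone (probPairs f g) (WL1.mk r hrf, WL1.mk s hsg) = massZeroPairs f g := by
  ext h
  constructor
  · rintro ⟨k, t, hk, -, -, hl⟩
    have h1 : Tendsto (fun n => (t n)⁻¹ • ((k n).1 - WL1.mk r hrf)) atTop (𝓝 h.1) :=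
      (continuous_fst.tendsto h).comp hl
    have h2 : Tendsto (fun n => (t n)⁻¹ • ((k n).2 - WL1.mk s hsg)) atTop (𝓝 h.2) :=
      (continuous_snd.tendsto h).comp hl
    have e1 : ∀ n, WL1.mass f hf ((t n)⁻¹ • ((k n).1 - WL1.mk r hrf)) = 0 := fun n => by
      rw [map_smul, map_sub, WL1.mass_apply, WL1.mass_apply, (hk n).1.2.tsum_eq,
        show ∑' i, (WL1.mk r hrf) i = 1 from hr.2.tsum_eq, sub_self, smul_zero]
    have e2 : ∀ n, WL1.mass g hg ((t n)⁻¹ • ((k n).2 - WL1.mk s hsg)) = 0 := fun n => by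
      rw [map_smul, map_sub, WL1.mass_apply, WL1.mass_apply, (hk n).2.2.tsum_eq,
        show ∑' i, (WL1.mk s hsg) i = 1 from hs.2.tsum_eq, sub_self, smul_zero]
    have l1 := ((WL1.mass f hf).continuous.tendsto h.1).comp h1
    have l2 := ((WL1.mass g hg).continuous.tendsto h.2).comp h2
    have z1 : WL1.mass f hf h.1 = 0 :=
      tendsto_nhds_unique l1 (tendsto_const_nhds.congr fun n => (e1 n).symm)
    have z2 : WL1.mass g hg h.2 = 0 :=
      tendsto_nhds_unique l2 (tendsto_const_nhds.congr fun n => (e2 n).symm)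
    refine ⟨?_, ?_⟩
    · have := (WL1.summable_coe hf h.1).hasSum
      rwa [← WL1.mass_apply hf, z1] at this
    · have := (WL1.summable_coe hg h.2).hasSum
      rwa [← WL1.mass_apply hg, z2] at this
  · rintro ⟨h1, h2⟩
    obtain ⟨k, hk, hkl⟩ := WL1.exists_prob_seq_tendsto hf hr hr0 hrf h.1 h1
    obtain ⟨l, hl, hll⟩ := WL1.exists_prob_seq_tendsto hg hs hs0 hsg h.2 h2
    exact ⟨fun n => (k n, l n), fun n => 1 / ((n : ℝ) + 1), fun n => ⟨hk n, hl n⟩,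
      fun n => by positivity, tendsto_one_div_add_atTop_nhds_zero_nat, hkl.prodMk_nhds hll⟩

namespace WLinf

variable {f : ι → ℝ} [PosWeight f]

@[simp] theorem add_apply (a b : WLinf f) (i : ι) : (a + b) i = a i + b i := rfl
@[simp] theorem sub_apply (a b : WLinf f) (i : ι) : (a - b) i = a i - b i := rfl
@[simp] theorem neg_apply (a : WLinf f) (i : ι) : (-a) i = -a i := rfl
@[simp] theorem smul_apply (t : ℝ) (a : WLinf f) (i : ι) : (t • a) i = t * a i := rfl

theorem ext {a b : WLinf f} (h : ∀ i, a i = b i) : a = b := Subtype.ext (funext h)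

/-- A function bounded by a multiple of the weight, as an element of `ℓ^∞_f`. -/
def ofBound (b : ι → ℝ) (C : ℝ) (h : ∀ i, |b i| ≤ C * f i) : WLinf f :=
  ⟨b, C, by
    rintro _ ⟨i, rfl⟩
    have hi := PosWeight.pos (f := f) i
    change (f i)⁻¹ * |b i| ≤ C
    rw [inv_mul_le_iff₀ hi, mul_comm]
    exact h i⟩

@[simp] theorem ofBound_apply (b : ι → ℝ) (C : ℝ) (h : ∀ i, |b i| ≤ C * f i) (i : ι) :
    (ofBound b C h) i = b i := rfl

theorem abs_apply_le (b : WLinf f) (i : ι) : |b i| ≤ ‖b‖ * f i := by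
  have hi := PosWeight.pos (f := f) i
  have h : (f i)⁻¹ * |b i| ≤ ‖b‖ := le_ciSup (bdd b) i
  rwa [inv_mul_le_iff₀ hi, mul_comm] at h

theorem norm_le {b : WLinf f} {C : ℝ} (hC : 0 ≤ C) (h : ∀ i, |b i| ≤ C * f i) : ‖b‖ ≤ C := by
  refine Real.iSup_le (fun i => ?_) hC
  rw [inv_mul_le_iff₀ (PosWeight.pos i), mul_comm]
  exact h i

instance : CompleteSpace (WLinf f) := by
  refine Metric.complete_of_cauchySeq_tendsto fun b hb => ?_
  have hpt : ∀ i, ∃ L, Tendsto (fun n => b n i) atTop (𝓝 L) := fun i => by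
    refine cauchySeq_tendsto_of_complete (Metric.cauchySeq_iff'.2 fun ε hε => ?_)
    have hi := PosWeight.pos (f := f) i
    obtain ⟨N, hN⟩ := Metric.cauchySeq_iff'.1 hb (ε / f i) (div_pos hε hi)
    refine ⟨N, fun n hn => ?_⟩
    have h1 := hN n hn
    rw [dist_eq_norm, lt_div_iff₀ hi] at h1
    exact (abs_apply_le (b n - b N) i).trans_lt h1
  choose L hL using hpt
  have hclose : ∀ ε > 0, ∃ N, ∀ n ≥ N, ∀ i, |b n i - L i| ≤ ε * f i := fun ε hε => by
    obtain ⟨N, hN⟩ := Metric.cauchySeq_iff.1 hb ε hε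
    refine ⟨N, fun n hn i => ?_⟩
    refine le_of_tendsto ((tendsto_const_nhds.sub (hL i)).abs) ?_
    filter_upwards [eventually_ge_atTop N] with m hm
    have h1 := (hN n hn m hm).le
    rw [dist_eq_norm] at h1
    exact (abs_apply_le (b n - b m) i).trans
      (mul_le_mul_of_nonneg_right h1 (PosWeight.pos i).le)
  obtain ⟨N, hN⟩ := hclose 1 one_pos
  let d : WLinf f := ofBound (fun i => b N i - L i) 1 (hN N le_rfl)
  refine ⟨b N - d, ?_⟩
  rw [Metric.tendsto_atTop]
  intro ε hε
  obtain ⟨M, hM⟩ := hclose (ε / 2) (half_pos hε)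
  refine ⟨M, fun n hn => ?_⟩
  rw [dist_eq_norm]
  refine (norm_le (half_pos hε).le fun i => ?_).trans_lt (half_lt_self hε)
  simpa [d] using hM n hn i

end WLinf

end EROT

/-! ### Existence and size of Schrödinger scalings -/

namespace EROT

variable {X Y : Type*}

/-- A kernel with `κ / E y ≤ k x y ≤ 1`, for a constant `κ > 0` and a function `E ≥ 1`. -/
structure KernelBounds (k : X → Y → ℝ) (E : Y → ℝ) (κ : ℝ) : Prop where
  kappa_pos : 0 < κ
  one_le : ∀ y, 1 ≤ E y
  lower : ∀ x y, κ / E y ≤ k x y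
  upper : ∀ x y, k x y ≤ 1

/-- Positive functions `f`, `g` for which `f x * g y * k x y` is a density, with respect to `r ⊗ s`,
of a coupling of `r` and `s`. The marginal equations are imposed at all points, including those of
mass zero. -/
structure IsScaling (k : X → Y → ℝ) (r : X → ℝ) (s : Y → ℝ) (f : X → ℝ) (g : Y → ℝ) : Prop where
  left_pos : ∀ x, 0 < f x
  right_pos : ∀ y, 0 < g y
  left : ∀ x, HasSum (fun y => f x * g y * k x y * s y) 1
  right : ∀ y, HasSum (fun x => f x * g y * k x y * r x) 1

namespace IsProb

variable {r : X → ℝ}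

theorem exists_pos (hr : IsProb r) : ∃ x, 0 < r x := by
  by_contra h
  have h0 : r = 0 := funext fun x => le_antisymm (not_lt.1 fun hx => h ⟨x, hx⟩) (hr.1 x)
  have := hr.2
  rw [h0] at this
  exact zero_ne_one (hasSum_zero.unique this)

theorem hasSum_const (hr : IsProb r) (a : ℝ) : HasSum (fun x => a * r x) a := by
  simpa using hr.2.mul_left a

end IsProb

namespace KernelBounds

variable {k : X → Y → ℝ} {E : Y → ℝ} {κ : ℝ} {r : X → ℝ} {s : Y → ℝ}

theorem E_pos (h : KernelBounds k E κ) (y : Y) : 0 < E y := zero_lt_one.trans_le (h.one_le y)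

theorem pos (h : KernelBounds k E κ) (x : X) (y : Y) : 0 < k x y :=
  (div_pos h.kappa_pos (h.E_pos y)).trans_le (h.lower x y)

theorem one_le_of_hasSum (h : KernelBounds k E κ) (hs : IsProb s) {S : ℝ}
    (hS : HasSum (fun y => E y * s y) S) : 1 ≤ S :=
  hasSum_le (fun y => le_mul_of_one_le_left (hs.1 y) (h.one_le y)) hs.2 hS

theorem summable_left (h : KernelBounds k E κ) (hr : IsProb r) {f : X → ℝ} (hf : ∀ x, 0 < f x)
    (hfs : Summable fun x => f x * r x) (y : Y) : Summable fun x => k x y * f x * r x :=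
  Summable.of_nonneg_of_le
    (fun x => mul_nonneg (mul_nonneg (h.pos x y).le (hf x).le) (hr.1 x))
    (fun x => mul_le_mul_of_nonneg_right (mul_le_of_le_one_left (hf x).le (h.upper x y)) (hr.1 x))
    hfs

theorem sum_left_bounds (h : KernelBounds k E κ) (hr : IsProb r) {f : X → ℝ} (hf : ∀ x, 0 < f x)
    {F : ℝ} (hF : HasSum (fun x => f x * r x) F) (y : Y) :
    κ * F / E y ≤ ∑' x, k x y * f x * r x ∧ ∑' x, k x y * f x * r x ≤ F := by
  have hs := (h.summable_left hr hf hF.summable y).hasSum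
  constructor
  · refine hasSum_le (fun x => ?_) (hF.mul_left (κ / E y)) hs |>.trans' ?_
    · rw [mul_assoc]
      exact mul_le_mul_of_nonneg_right (h.lower x y) (mul_nonneg (hf x).le (hr.1 x))
    · rw [div_mul_eq_mul_div]
  · exact hasSum_le (fun x => mul_le_mul_of_nonneg_right
      (mul_le_of_le_one_left (hf x).le (h.upper x y)) (hr.1 x)) hs hF

theorem summable_right (h : KernelBounds k E κ) (hs : IsProb s)
    (hS : Summable fun y => E y * s y) {g : Y → ℝ} {M : ℝ} (hg : ∀ y, 0 < g y)
    (hgE : ∀ y, g y ≤ M * E y) (x : X) : Summable fun y => k x y * g y * s y := by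
  refine Summable.of_nonneg_of_le
    (fun y => mul_nonneg (mul_nonneg (h.pos x y).le (hg y).le) (hs.1 y))
    (fun y => ?_) (hS.mul_left M)
  rw [← mul_assoc]
  exact mul_le_mul_of_nonneg_right
    ((mul_le_of_le_one_left (hg y).le (h.upper x y)).trans (hgE y)) (hs.1 y)

/-- The lower bound rests on the inequality `1 / E ≥ 2 / S - E / S ^ 2`, whose `s`-average is
`∑ s / E ≥ 1 / S`. -/
theorem sum_right_bounds (h : KernelBounds k E κ) (hs : IsProb s) {S F : ℝ} (hF : 0 < F)
    (hS : HasSum (fun y => E y * s y) S) {g : Y → ℝ} (hg1 : ∀ y, 1 / F ≤ g y)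
    (hg2 : ∀ y, g y ≤ E y / (κ * F)) (x : X) :
    κ / (S * F) ≤ ∑' y, k x y * g y * s y ∧ ∑' y, k x y * g y * s y ≤ S / (κ * F) := by
  have hg : ∀ y, 0 < g y := fun y => (div_pos one_pos hF).trans_le (hg1 y)
  have hκ := h.kappa_pos
  have hS0 : 0 < S := zero_lt_one.trans_le (h.one_le_of_hasSum hs hS)
  have hg2' : ∀ y, g y ≤ 1 / (κ * F) * E y := fun y => (hg2 y).trans_eq (by ring)
  have hsum := (h.summable_right hs hS.summable hg hg2' x).hasSum
  constructor
  · have h1 : HasSum (fun y => κ / F * (2 / S * s y - 1 / S ^ 2 * (E y * s y)))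
        (κ / F * (2 / S * 1 - 1 / S ^ 2 * S)) :=
      ((hs.2.mul_left _).sub (hS.mul_left _)).mul_left _
    have h2 : κ / (S * F) = κ / F * (2 / S * 1 - 1 / S ^ 2 * S) := by field_simp; ring
    rw [h2]
    refine hasSum_le (fun y => ?_) h1 hsum
    have hE := h.E_pos y
    have h3 : 2 / S - 1 / S ^ 2 * E y ≤ 1 / E y := by
      have : 1 / E y - (2 / S - 1 / S ^ 2 * E y) = (S - E y) ^ 2 / (E y * S ^ 2) := by
        field_simp; ring
      have h4 : 0 ≤ (S - E y) ^ 2 / (E y * S ^ 2) := by positivity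
      linarith
    calc κ / F * (2 / S * s y - 1 / S ^ 2 * (E y * s y))
        = κ / F * (2 / S - 1 / S ^ 2 * E y) * s y := by ring
      _ ≤ κ / F * (1 / E y) * s y := by
          have := hs.1 y
          gcongr
      _ = κ / E y * (1 / F) * s y := by ring
      _ ≤ k x y * g y * s y := by
          refine mul_le_mul_of_nonneg_right ?_ (hs.1 y)
          exact mul_le_mul (h.lower x y) (hg1 y) (by positivity) (h.pos x y).le
  · refine hasSum_le (fun y => ?_) hsum ((hS.mul_left (1 / (κ * F)))) |>.trans_eq (by ring)
    rw [← mul_assoc]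
    exact mul_le_mul_of_nonneg_right
      ((mul_le_of_le_one_left (hg y).le (h.upper x y)).trans (hg2' y)) (hs.1 y)

theorem interchange (h : KernelBounds k E κ) (hr : IsProb r) (hs : IsProb s)
    (hS : Summable fun y => E y * s y) {f : X → ℝ} {g : Y → ℝ} {M N : ℝ} (hf : ∀ x, 0 < f x)
    (hfM : ∀ x, f x ≤ M) (hg : ∀ y, 0 < g y) (hgN : ∀ y, g y ≤ N * E y) :
    ∃ T, HasSum (fun x => f x * (∑' y, k x y * g y * s y) * r x) T ∧
      HasSum (fun y => g y * (∑' x, k x y * f x * r x) * s y) T := by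
  have hfs : Summable fun x => f x * r x :=
    Summable.of_nonneg_of_le (fun x => mul_nonneg (hf x).le (hr.1 x))
      (fun x => mul_le_mul_of_nonneg_right (hfM x) (hr.1 x)) (hr.hasSum_const M).summable
  have hgs : Summable fun y => g y * s y :=
    Summable.of_nonneg_of_le (fun y => mul_nonneg (hg y).le (hs.1 y))
      (fun y => by rw [← mul_assoc]; exact mul_le_mul_of_nonneg_right (hgN y) (hs.1 y))
      (hS.mul_left N)
  have hprod : Summable fun p : X × Y => f p.1 * r p.1 * (g p.2 * s p.2) :=
    hfs.mul_of_nonneg hgs (fun x => mul_nonneg (hf x).le (hr.1 x))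
      (fun y => mul_nonneg (hg y).le (hs.1 y))
  have hall : Summable fun p : X × Y => k p.1 p.2 * (f p.1 * r p.1 * (g p.2 * s p.2)) := by
    have h0 : ∀ p : X × Y, 0 ≤ f p.1 * r p.1 * (g p.2 * s p.2) := fun p =>
      mul_nonneg (mul_nonneg (hf p.1).le (hr.1 p.1)) (mul_nonneg (hg p.2).le (hs.1 p.2))
    exact Summable.of_nonneg_of_le (fun p => mul_nonneg (h.pos _ _).le (h0 p))
      (fun p => mul_le_of_le_one_left (h0 p) (h.upper _ _)) hprod
  refine ⟨_, hall.hasSum.prod_fiberwise fun x => ?_,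
    ((Equiv.prodComm Y X).hasSum_iff.2 hall.hasSum).prod_fiberwise fun y => ?_⟩
  · have := ((h.summable_right hs hS hg hgN x).hasSum.mul_left (f x)).mul_right (r x)
    refine this.congr_fun fun y => ?_
    ring
  · have := ((h.summable_left hr hf hfs y).hasSum.mul_left (g y)).mul_right (s y)
    refine this.congr_fun fun x => ?_
    simp only [Function.comp, Equiv.prodComm_apply, Prod.swap_prod_mk]
    ring

/-- Existence of scalings. The concave functional
`f ↦ ∑ r log f - ∑ s log (∑ k f r)` has a maximizer `f₀` on a compact box; by the a priori bounds,
one Sinkhorn step from `f₀` leads, up to a constant factor, to a point `f₂` of the same box, and the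
inequality `log t ≤ t - 1` shows that the step does not decrease the functional, and increases it
unless `f₀` solves the equations where `r ≠ 0`. -/
theorem exists_isScaling (h : KernelBounds k E κ) (hr : IsProb r) (hs : IsProb s)
    (hES : Summable fun y => E y * s y) : ∃ f g, IsScaling k r s f g := by
  obtain ⟨S, hS⟩ := hES
  have hκ := h.kappa_pos
  have hS1 := h.one_le_of_hasSum hs hS
  have hS0 : 0 < S := zero_lt_one.trans_le hS1
  obtain ⟨y₀, -⟩ := hs.exists_pos
  obtain ⟨x₀, -⟩ := hr.exists_pos
  have hκ1 : κ ≤ S := by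
    have h1 := (h.lower x₀ y₀).trans (h.upper x₀ y₀)
    have h2 : ∀ y, κ ≤ E y := fun y => by
      have := (h.lower x₀ y).trans (h.upper x₀ y)
      rwa [div_le_one (h.E_pos y)] at this
    have := hasSum_le (fun y => mul_le_mul_of_nonneg_right (h2 y) (hs.1 y)) (hs.hasSum_const κ) hS
    exact this
  set Λ : ℝ := S ^ 2 / κ ^ 2 with hΛ
  have hΛ1 : 1 ≤ Λ := by
    rw [hΛ, one_le_div (by positivity)]
    exact pow_le_pow_left₀ hκ.le hκ1 2
  have hΛ0 : 0 < Λ := zero_lt_one.trans_le hΛ1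
  let box : Set (X → ℝ) := Set.univ.pi fun _ => Set.Icc 1 Λ
  have hbox : IsCompact box := isCompact_univ_pi fun _ => isCompact_Icc
  have hmem : ∀ {f : X → ℝ}, f ∈ box → ∀ x, 1 ≤ f x ∧ f x ≤ Λ := fun hf x => hf x trivial
  have hpos : ∀ {f : X → ℝ}, f ∈ box → ∀ x, 0 < f x := fun hf x =>
    zero_lt_one.trans_le (hmem hf x).1
  let K : (X → ℝ) → Y → ℝ := fun f y => ∑' x, k x y * f x * r x
  have hfs : ∀ {f : X → ℝ}, f ∈ box → Summable fun x => f x * r x := fun {f} hf =>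
    Summable.of_nonneg_of_le (fun x => mul_nonneg (hpos hf x).le (hr.1 x))
      (fun x => mul_le_mul_of_nonneg_right (hmem hf x).2 (hr.1 x)) (hr.hasSum_const Λ).summable
  have hF : ∀ {f : X → ℝ}, f ∈ box → 1 ≤ ∑' x, f x * r x ∧ ∑' x, f x * r x ≤ Λ := fun {f} hf =>
    ⟨hasSum_le (fun x => mul_le_mul_of_nonneg_right (hmem hf x).1 (hr.1 x)) (hr.hasSum_const 1)
      (hfs hf).hasSum,
     hasSum_le (fun x => mul_le_mul_of_nonneg_right (hmem hf x).2 (hr.1 x)) (hfs hf).hasSum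
      (hr.hasSum_const Λ)⟩
  have hK : ∀ {f : X → ℝ}, f ∈ box → ∀ y, κ / E y ≤ K f y ∧ K f y ≤ Λ := fun {f} hf y => by
    have h1 := h.sum_left_bounds hr (hpos hf) (hfs hf).hasSum y
    refine ⟨le_trans ?_ h1.1, h1.2.trans (hF hf).2⟩
    have := h.E_pos y
    gcongr
    exact le_mul_of_one_le_right hκ.le (hF hf).1
  have hKpos : ∀ {f : X → ℝ}, f ∈ box → ∀ y, 0 < K f y := fun hf y =>
    (div_pos hκ (h.E_pos y)).trans_le (hK hf y).1
  have hb1 : ∀ x, ∀ f ∈ box, ‖Real.log (f x) * r x‖ ≤ Λ * r x := fun x f hf => by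
    have h0 := Real.log_nonneg (hmem hf x).1
    rw [Real.norm_eq_abs, abs_of_nonneg (mul_nonneg h0 (hr.1 x))]
    refine mul_le_mul_of_nonneg_right ?_ (hr.1 x)
    have := Real.log_le_sub_one_of_pos (hpos hf x)
    linarith [(hmem hf x).2]
  have hb2 : ∀ y, ∀ f ∈ box, ‖Real.log (K f y) * s y‖ ≤ Λ * s y + 1 / κ * (E y * s y) :=
    fun y f hf => by
      have hE := h.E_pos y
      have h0 := hKpos hf y
      rw [norm_mul, Real.norm_of_nonneg (hs.1 y), Real.norm_eq_abs]
      rw [← mul_assoc, ← add_mul]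
      refine mul_le_mul_of_nonneg_right (abs_le.2 ⟨?_, ?_⟩) (hs.1 y)
      · have h1 := Real.log_le_sub_one_of_pos (inv_pos.2 h0)
        rw [Real.log_inv] at h1
        have h2 : (K f y)⁻¹ ≤ 1 / κ * E y := by
          have := inv_anti₀ (div_pos hκ hE) (hK hf y).1
          rw [inv_div] at this
          exact this.trans_eq (by ring)
        linarith
      · have h1 := Real.log_le_sub_one_of_pos h0
        have h2 : 0 ≤ 1 / κ * E y := by positivity
        linarith [(hK hf y).2]
  have hsb2 : Summable fun y => Λ * s y + 1 / κ * (E y * s y) :=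
    (hs.hasSum_const Λ).summable.add (hS.summable.mul_left _)
  have hKcont : ∀ y, ContinuousOn (fun f => K f y) box := fun y => by
    refine continuousOn_tsum (u := fun x => Λ * r x) (fun x => ?_) (hr.hasSum_const Λ).summable
      fun x f hf => ?_
    · exact ((continuous_const.mul (continuous_apply x)).mul continuous_const).continuousOn
    · have h0 := mul_nonneg (mul_nonneg (h.pos x y).le (hpos hf x).le) (hr.1 x)
      rw [Real.norm_of_nonneg h0]
      refine mul_le_mul_of_nonneg_right ?_ (hr.1 x)
      exact (mul_le_of_le_one_left (hpos hf x).le (h.upper x y)).trans (hmem hf x).2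
  have hG : ContinuousOn
      (fun f : X → ℝ => ∑' x, Real.log (f x) * r x - ∑' y, Real.log (K f y) * s y) box := by
    refine ContinuousOn.sub ?_ ?_
    · refine continuousOn_tsum (fun x => ?_) (hr.hasSum_const Λ).summable hb1
      exact ((continuous_apply x).continuousOn.log fun f hf => (hpos hf x).ne').mul
        continuousOn_const
    · refine continuousOn_tsum (fun y => ?_) hsb2 hb2
      exact ((hKcont y).log fun f hf => (hKpos hf y).ne').mul continuousOn_const
  obtain ⟨f₀, hf₀, hmax⟩ := hbox.exists_isMaxOn
    ⟨fun _ => 1, fun x _ => ⟨le_rfl, hΛ1⟩⟩ hG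
  -- a Sinkhorn step
  obtain ⟨F, hF₀⟩ := hfs hf₀
  have hF1 : 1 ≤ F := by rw [← hF₀.tsum_eq]; exact (hF hf₀).1
  have hF0 : 0 < F := zero_lt_one.trans_le hF1
  let g : Y → ℝ := fun y => (K f₀ y)⁻¹
  have hg1 : ∀ y, 1 / F ≤ g y := fun y => by
    rw [one_div]
    exact inv_anti₀ (hKpos hf₀ y) (h.sum_left_bounds hr (hpos hf₀) hF₀ y).2
  have hg2 : ∀ y, g y ≤ E y / (κ * F) := fun y => by
    rw [← inv_div]
    exact inv_anti₀ (div_pos (mul_pos hκ hF0) (h.E_pos y))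
      (h.sum_left_bounds hr (hpos hf₀) hF₀ y).1
  have hg0 : ∀ y, 0 < g y := fun y => inv_pos.2 (hKpos hf₀ y)
  have hgE : ∀ y, g y ≤ 1 / (κ * F) * E y := fun y => (hg2 y).trans_eq (by ring)
  let z : X → ℝ := fun x => ∑' y, k x y * g y * s y
  have hz : ∀ x, κ / (S * F) ≤ z x ∧ z x ≤ S / (κ * F) := h.sum_right_bounds hs hF0 hS hg1 hg2
  have hz0 : ∀ x, 0 < z x := fun x => (div_pos hκ (mul_pos hS0 hF0)).trans_le (hz x).1
  let a : ℝ := S / (κ * F)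
  have ha : 0 < a := div_pos hS0 (mul_pos hκ hF0)
  let f₂ : X → ℝ := fun x => a / z x
  have hf₂ : f₂ ∈ box := fun x _ => by
    refine ⟨(one_le_div (hz0 x)).2 (hz x).2, ?_⟩
    change a / z x ≤ Λ
    rw [div_le_iff₀ (hz0 x)]
    calc a = Λ * (κ / (S * F)) := by simp only [a, hΛ]; field_simp
      _ ≤ Λ * z x := mul_le_mul_of_nonneg_left (hz x).1 hΛ0.le
  have hP : ∀ {f}, f ∈ box → Summable fun x => Real.log (f x) * r x := fun {f} hf =>
    Summable.of_norm_bounded (hr.hasSum_const Λ).summable fun x => hb1 x f hf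
  have hQ : ∀ {f}, f ∈ box → Summable fun y => Real.log (K f y) * s y := fun {f} hf =>
    Summable.of_norm_bounded hsb2 fun y => hb2 y f hf
  have hle := hmax hf₂
  simp only [Set.mem_ofPred_eq] at hle
  obtain ⟨T, hT1, hT2⟩ := h.interchange hr hs hS.summable (hpos hf₀) (fun x => (hmem hf₀ x).2)
    hg0 hgE
  have hT : T = 1 := hT2.unique (hs.2.congr_fun fun y => by
    change g y * K f₀ y * s y = s y
    simp only [g]
    rw [inv_mul_cancel₀ (hKpos hf₀ y).ne', one_mul])
  subst hT
  obtain ⟨T, hT3, hT4⟩ := h.interchange hr hs hS.summable (hpos hf₂) (fun x => (hmem hf₂ x).2)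
    hg0 hgE
  have hT : T = a := hT3.unique ((hr.hasSum_const a).congr_fun fun x => by
    change a / z x * z x * r x = a * r x
    rw [div_mul_cancel₀ _ (hz0 x).ne'])
  subst hT
  have hsum2 : HasSum (fun y => (g y * K f₂ y / a - 1 - Real.log (K f₂ y) + Real.log (K f₀ y)
      + Real.log a) * s y) (a / a - 1 - ∑' y, Real.log (K f₂ y) * s y
        + ∑' y, Real.log (K f₀ y) * s y + Real.log a) := by
    refine ((((hT4.div_const a).sub hs.2).sub (hQ hf₂).hasSum).add (hQ hf₀).hasSum).add
      (hs.hasSum_const (Real.log a)) |>.congr_fun fun y => ?_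
    simp only [K]; ring
  have hsum1 : HasSum (fun x => (f₀ x * z x - 1 - Real.log a - Real.log (f₀ x)
      + Real.log (f₂ x)) * r x) (1 - 1 - Real.log a - ∑' x, Real.log (f₀ x) * r x
        + ∑' x, Real.log (f₂ x) * r x) := by
    refine (((hT1.sub hr.2).sub (hr.hasSum_const (Real.log a))).sub (hP hf₀).hasSum).add
      (hP hf₂).hasSum |>.congr_fun fun x => ?_
    simp only [z]; ring
  have hlog : ∀ x, Real.log a + Real.log (f₀ x) - Real.log (f₂ x) = Real.log (f₀ x * z x) :=
    fun x => by
      rw [Real.log_mul (hpos hf₀ x).ne' (hz0 x).ne', Real.log_div ha.ne' (hz0 x).ne']; ring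
  have hn2 : ∀ y, 0 ≤ (g y * K f₂ y / a - 1 - Real.log (K f₂ y) + Real.log (K f₀ y)
      + Real.log a) * s y := fun y => by
    refine mul_nonneg ?_ (hs.1 y)
    have h1 := Real.log_le_sub_one_of_pos (div_pos (mul_pos (hg0 y) (hKpos hf₂ y)) ha)
    rw [Real.log_div (mul_pos (hg0 y) (hKpos hf₂ y)).ne' ha.ne',
      Real.log_mul (hg0 y).ne' (hKpos hf₂ y).ne', Real.log_inv] at h1
    linarith
  have hn1 : ∀ x, 0 ≤ (f₀ x * z x - 1 - Real.log a - Real.log (f₀ x) + Real.log (f₂ x)) * r x :=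
    fun x => by
      refine mul_nonneg ?_ (hr.1 x)
      have h1 := Real.log_le_sub_one_of_pos (mul_pos (hpos hf₀ x) (hz0 x))
      rw [← hlog] at h1
      linarith
  have hge2 := hsum2.nonneg hn2
  have hge1 := hsum1.nonneg hn1
  rw [div_self ha.ne'] at hge2
  have hzero : 1 - 1 - Real.log a - ∑' x, Real.log (f₀ x) * r x
        + ∑' x, Real.log (f₂ x) * r x = 0 := by linarith
  rw [hzero] at hsum1
  have hterm := (hasSum_zero_iff_of_nonneg hn1).1 hsum1
  have hfix : ∀ x, (z x)⁻¹ * r x = f₀ x * r x := fun x => by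
    rcases (hr.1 x).eq_or_lt with h0 | h0
    · rw [← h0, mul_zero, mul_zero]
    have h1 := (mul_eq_zero.1 (congrFun hterm x)).resolve_right h0.ne'
    have h2 : f₀ x * z x = 1 := by
      by_contra hne
      have := Real.log_lt_sub_one_of_pos (mul_pos (hpos hf₀ x) (hz0 x)) hne
      rw [← hlog] at this
      linarith
    rw [eq_div_of_mul_eq (hz0 x).ne' h2, one_div]
  refine ⟨fun x => (z x)⁻¹, g, fun x => inv_pos.2 (hz0 x), hg0, fun x => ?_, fun y => ?_⟩
  · have h1 := (h.summable_right hs hS.summable hg0 hgE x).hasSum.mul_left (z x)⁻¹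
    rw [show (z x)⁻¹ * ∑' y, k x y * g y * s y = 1 from inv_mul_cancel₀ (hz0 x).ne'] at h1
    exact h1.congr_fun fun y => by ring
  · have h1 := (h.summable_left hr (hpos hf₀) (hfs hf₀) y).hasSum.mul_left (g y)
    rw [show g y * ∑' x, k x y * f₀ x * r x = 1 from inv_mul_cancel₀ (hKpos hf₀ y).ne'] at h1
    refine h1.congr_fun fun x => ?_
    calc (z x)⁻¹ * g y * k x y * r x = g y * k x y * ((z x)⁻¹ * r x) := by ring
      _ = g y * (k x y * f₀ x * r x) := by rw [hfix x]; ring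

end KernelBounds

namespace IsScaling

variable {k : X → Y → ℝ} {E : Y → ℝ} {κ : ℝ} {r : X → ℝ} {s : Y → ℝ} {f : X → ℝ} {g : Y → ℝ}

/-- The a priori bounds for scalings, in terms of the `r`-mean `F` of `f` and the `s`-mean `S` of
`E`. -/
theorem exists_bounds (hfg : IsScaling k r s f g) (h : KernelBounds k E κ) (hr : IsProb r)
    (hs : IsProb s) {S : ℝ} (hS : HasSum (fun y => E y * s y) S) :
    ∃ F, 0 < F ∧ (∀ y, 1 / F ≤ g y) ∧ (∀ y, g y ≤ E y / (κ * F)) ∧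
      (∀ x, κ * F / S ≤ f x) ∧ ∀ x, f x ≤ S * F / κ := by
  obtain ⟨y₀, -⟩ := hs.exists_pos
  obtain ⟨x₀, hx₀⟩ := hr.exists_pos
  have hκ := h.kappa_pos
  have hS0 : 0 < S := zero_lt_one.trans_le (h.one_le_of_hasSum hs hS)
  have hg := hfg.right_pos
  have hf := hfg.left_pos
  have hkf : ∀ y, HasSum (fun x => k x y * f x * r x) (g y)⁻¹ := fun y => by
    have := (hfg.right y).mul_left (g y)⁻¹
    rw [mul_one] at this
    refine this.congr_fun fun x => ?_
    have := (hg y).ne'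
    field_simp
  have hkg : ∀ x, HasSum (fun y => k x y * g y * s y) (f x)⁻¹ := fun x => by
    have := (hfg.left x).mul_left (f x)⁻¹
    rw [mul_one] at this
    refine this.congr_fun fun y => ?_
    have := (hf x).ne'
    field_simp
  have hfs : Summable fun x => f x * r x := by
    have hE := h.E_pos y₀
    refine Summable.of_nonneg_of_le (fun x => mul_nonneg (hf x).le (hr.1 x)) (fun x => ?_)
      ((hkf y₀).summable.mul_left (E y₀ / κ))
    calc f x * r x = E y₀ / κ * (κ / E y₀ * f x * r x) := by field_simp
      _ ≤ E y₀ / κ * (k x y₀ * f x * r x) := by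
        have := h.lower x y₀
        have := (hf x).le
        have := hr.1 x
        gcongr
  obtain ⟨F, hF⟩ := hfs
  have hF0 : 0 < F := by
    refine (mul_pos (hf x₀) hx₀).trans_le ?_
    exact le_hasSum hF x₀ fun x _ => mul_nonneg (hf x).le (hr.1 x)
  have hgi : ∀ y, g y = ((g y)⁻¹)⁻¹ := fun y => (inv_inv _).symm
  have hfi : ∀ x, f x = ((f x)⁻¹)⁻¹ := fun x => (inv_inv _).symm
  have b1 : ∀ y, 1 / F ≤ g y := fun y => by
    have := (h.sum_left_bounds hr hf hF y).2
    rw [(hkf y).tsum_eq] at this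
    rw [hgi, one_div]
    exact inv_anti₀ (inv_pos.2 (hg y)) this
  have b2 : ∀ y, g y ≤ E y / (κ * F) := fun y => by
    have := (h.sum_left_bounds hr hf hF y).1
    rw [(hkf y).tsum_eq] at this
    rw [hgi, ← inv_div]
    exact inv_anti₀ (div_pos (mul_pos hκ hF0) (h.E_pos y)) this
  refine ⟨F, hF0, b1, b2, fun x => ?_, fun x => ?_⟩
  · have := (h.sum_right_bounds hs hF0 hS b1 b2 x).2
    rw [(hkg x).tsum_eq] at this
    rw [hfi, ← inv_div]
    exact inv_anti₀ (inv_pos.2 (hf x)) this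
  · have := (h.sum_right_bounds hs hF0 hS b1 b2 x).1
    rw [(hkg x).tsum_eq] at this
    rw [hfi, ← inv_div]
    exact inv_anti₀ (div_pos hκ (mul_pos hS0 hF0)) this

end IsScaling

end EROT

/-! ### Plans and potentials from the Schrödinger system -/

namespace EROT

variable {ι X Y : Type*}

/-- The density `exp ((α ⊕ β - c) / lam)` with respect to the product of the marginals. -/
noncomputable def density (c : X → Y → ℝ) (lam : ℝ) (α : X → ℝ) (β : Y → ℝ) : X → Y → ℝ :=
  fun x y => Real.exp ((α x + β y - c x y) / lam)

/-- The measure with density `ρ` with respect to `r ⊗ s`. -/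
def withDensity (ρ : X → Y → ℝ) (r : X → ℝ) (s : Y → ℝ) : X × Y → ℝ :=
  fun p => ρ p.1 p.2 * (r p.1 * s p.2)

/-- `ρ` is a positive density with respect to `r ⊗ s`, all of whose conditional masses are `1`, also
at points of mass zero. -/
structure IsDensity (ρ : X → Y → ℝ) (r : X → ℝ) (s : Y → ℝ) : Prop where
  pos : ∀ x y, 0 < ρ x y
  left : ∀ x, HasSum (fun y => ρ x y * s y) 1
  right : ∀ y, HasSum (fun x => ρ x y * r x) 1

section Couplings

variable {r : X → ℝ} {s : Y → ℝ} {π : X × Y → ℝ}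

theorem hasSum_of_mem_couplings_left (hπ : π ∈ couplings r s) {w : X → ℝ}
    (hw : Summable fun x => |w x| * r x) :
    HasSum (fun p : X × Y => w p.1 * π p) (∑' x, w x * r x) := by
  obtain ⟨h0, -, hX, -⟩ := hπ
  have hs : Summable fun p : X × Y => |w p.1| * π p := by
    refine (summable_prod_of_nonneg fun p => mul_nonneg (abs_nonneg _) (h0 p)).2
      ⟨fun x => (hX x).summable.mul_left |w x|, hw.congr fun x => ?_⟩
    rw [((hX x).mul_left |w x|).tsum_eq]
  have hs' : Summable fun p : X × Y => w p.1 * π p :=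
    Summable.of_norm (hs.congr fun p => by
      rw [Real.norm_eq_abs, abs_mul, abs_of_nonneg (h0 p)])
  have := hs'.hasSum.prod_fiberwise fun x => (hX x).mul_left (w x)
  rw [this.tsum_eq]
  exact hs'.hasSum

theorem swap_mem_couplings (hπ : π ∈ couplings r s) :
    (fun p : Y × X => π p.swap) ∈ couplings s r :=
  ⟨fun p => hπ.1 p.swap, (Equiv.prodComm Y X).summable_iff.2 hπ.2.1, hπ.2.2.2, hπ.2.2.1⟩

theorem hasSum_of_mem_couplings_right (hπ : π ∈ couplings r s) {w : Y → ℝ}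
    (hw : Summable fun y => |w y| * s y) :
    HasSum (fun p : X × Y => w p.2 * π p) (∑' y, w y * s y) :=
  (Equiv.prodComm Y X).hasSum_iff.1
    (hasSum_of_mem_couplings_left (swap_mem_couplings hπ) hw)

theorem hasSum_one_of_mem_couplings (hr : IsProb r) (hπ : π ∈ couplings r s) : HasSum π 1 := by
  have := hasSum_of_mem_couplings_left hπ (w := fun _ => 1) (by simpa using hr.2.summable)
  simpa [hr.2.tsum_eq] using this

theorem eq_zero_of_mem_couplings (hπ : π ∈ couplings r s) (p : X × Y)
    (hp : r p.1 * s p.2 = 0) : π p = 0 := by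
  refine le_antisymm ?_ (hπ.1 p)
  rcases mul_eq_zero.1 hp with h | h
  · rw [← h]; exact le_hasSum (hπ.2.2.1 p.1) p.2 fun y _ => hπ.1 _
  · rw [← h]; exact le_hasSum (hπ.2.2.2 p.2) p.1 fun x _ => hπ.1 _

theorem summable_mul_prod (hr : IsProb r) (hs : IsProb s) :
    HasSum (fun p : X × Y => r p.1 * s p.2) 1 := by
  simpa using hr.2.mul hs.2 (hr.2.summable.mul_of_nonneg hs.2.summable hr.1 hs.1)

theorem IsDensity.mem_couplings {ρ : X → Y → ℝ} (h : IsDensity ρ r s) (hr : IsProb r)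
    (hs : IsProb s) : withDensity ρ r s ∈ couplings r s := by
  have h0 : ∀ p, 0 ≤ withDensity ρ r s p := fun p =>
    mul_nonneg (h.pos _ _).le (mul_nonneg (hr.1 _) (hs.1 _))
  have hX : ∀ x, HasSum (fun y => withDensity ρ r s (x, y)) (r x) := fun x => by
    have := (h.left x).mul_left (r x)
    rw [mul_one] at this
    exact this.congr_fun fun y => by simp only [withDensity]; ring
  have hY : ∀ y, HasSum (fun x => withDensity ρ r s (x, y)) (s y) := fun y => by
    have := (h.right y).mul_left (s y)
    rw [mul_one] at this
    exact this.congr_fun fun x => by simp only [withDensity]; ring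
  refine ⟨h0, (summable_prod_of_nonneg h0).2 ⟨fun x => (hX x).summable, ?_⟩, hX, hY⟩
  exact hr.2.summable.congr fun x => (hX x).tsum_eq.symm

end Couplings

section ExtSum

theorem extSum_of_summable {f : ι → ℝ} (hf : Summable f) :
    extSum f = ((∑' i, f i : ℝ) : EReal) := by
  have key : ∀ g : ι → ℝ, Summable g →
      ((∑' i, ENNReal.ofReal (g i) : ℝ≥0∞) : EReal) = ((∑' i, max (g i) 0 : ℝ) : EReal) := by
    intro g hg
    have hs : Summable fun i => max (g i) 0 :=
      Summable.of_nonneg_of_le (fun i => le_max_right _ _)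
        (fun i => max_le (le_abs_self _) (abs_nonneg _)) hg.abs
    have h1 : ∑' i, ENNReal.ofReal (g i) = ENNReal.ofReal (∑' i, max (g i) 0) := by
      rw [ENNReal.ofReal_tsum_of_nonneg (fun i => le_max_right _ _) hs]
      exact tsum_congr fun i => by rw [ENNReal.ofReal_max, ENNReal.ofReal_zero]; simp
    rw [h1, EReal.coe_ennreal_ofReal, max_eq_left (tsum_nonneg fun i => le_max_right _ _)]
  have hs : ∀ g : ι → ℝ, Summable g → Summable fun i => max (g i) 0 := fun g hg =>
    Summable.of_nonneg_of_le (fun i => le_max_right _ _)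
      (fun i => max_le (le_abs_self _) (abs_nonneg _)) hg.abs
  rw [extSum, key f hf, key (fun i => -f i) hf.neg, ← EReal.coe_sub,
    ← (hs f hf).tsum_sub (hs _ hf.neg)]
  congr 2
  funext i
  rcases le_total 0 (f i) with h | h
  · rw [max_eq_left h, max_eq_right (by linarith), sub_zero]
  · rw [max_eq_right h, max_eq_left (by linarith)]; ring

theorem extSum_of_not_summable {f g : ι → ℝ} (hg : Summable g) (h : ∀ i, -g i ≤ f i)
    (hf : ¬Summable f) : extSum f = ⊤ := by
  have hneg : ∑' i, ENNReal.ofReal (-f i) ≠ ⊤ := by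
    have h1 : ∑' i, ENNReal.ofReal (-f i) ≤ ∑' i, ENNReal.ofReal |g i| :=
      ENNReal.tsum_le_tsum fun i => ENNReal.ofReal_le_ofReal
        ((neg_le.1 (h i)).trans (le_abs_self _))
    rw [← ENNReal.ofReal_tsum_of_nonneg (fun i => abs_nonneg _) hg.abs] at h1
    exact ne_top_of_le_ne_top ENNReal.ofReal_ne_top h1
  have hpos : ∑' i, ENNReal.ofReal (f i) = ⊤ := by
    by_contra hne
    have h1 := ENNReal.summable_toReal hne
    have h2 := ENNReal.summable_toReal hneg
    refine hf ((h1.sub h2).congr fun i => ?_)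
    rcases le_total 0 (f i) with h3 | h3
    · rw [ENNReal.toReal_ofReal h3, ENNReal.ofReal_of_nonpos (by linarith)]; simp
    · rw [ENNReal.ofReal_of_nonpos h3, ENNReal.toReal_ofReal (by linarith)]; simp
  rw [extSum, hpos]
  lift ∑' i, ENNReal.ofReal (-f i) to NNReal using hneg with d
  exact EReal.top_sub_coe (d : ℝ)

end ExtSum

section Plan

variable {c : X → Y → ℝ} {lam : ℝ} {r : X → ℝ} {s : Y → ℝ} {α : X → ℝ} {β : Y → ℝ}

/-- Gibbs' inequality for one entry. -/
theorem log_div_ge {a q t : ℝ} (ha : 0 < a) (hq : 0 ≤ q) (ht : 0 ≤ t) (hqt : q = 0 → t = 0) :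
    0 ≤ t * Real.log (t / q) - t * Real.log a - t + a * q ∧
      (t * Real.log (t / q) - t * Real.log a - t + a * q = 0 ↔ t = a * q) := by
  rcases ht.eq_or_lt with h0 | h0
  · rw [← h0]
    simp only [zero_mul, sub_zero, zero_add]
    exact ⟨mul_nonneg ha.le hq, eq_comm⟩
  have hq0 : 0 < q := hq.lt_of_ne fun h => h0.ne' (hqt h.symm)
  have hx : 0 < a * q / t := div_pos (mul_pos ha hq0) h0
  have hlog : Real.log (a * q / t) = Real.log a - Real.log (t / q) := by
    rw [Real.log_div (mul_pos ha hq0).ne' h0.ne', Real.log_mul ha.ne' hq0.ne',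
      Real.log_div h0.ne' hq0.ne']
    ring
  have heq : t * Real.log (t / q) - t * Real.log a - t + a * q =
      t * (a * q / t - 1 - Real.log (a * q / t)) := by
    rw [hlog]; field_simp; ring
  rw [heq]
  refine ⟨mul_nonneg ht (by linarith [Real.log_le_sub_one_of_pos hx]), fun h => ?_, fun h => ?_⟩
  · by_contra hne
    have hne' : a * q / t ≠ 1 := fun h1 => hne ((div_eq_one_iff_eq h0.ne').1 h1).symm
    have := Real.log_lt_sub_one_of_pos hx hne'
    rcases mul_eq_zero.1 h with h1 | h1 <;> linarith
  · rw [← h, div_self h0.ne']; simp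

/-- The primal objective of a coupling is infinite, or it exceeds `⟨α, r⟩ + ⟨β, s⟩` by `lam` times
a nonnegative quantity, a relative entropy, that vanishes only at the coupling with density
`exp ((α ⊕ β - c) / lam)`. -/
theorem primalObjective_cases (hr : IsProb r) (hs : IsProb s) (hlam : 0 < lam)
    (hρ : IsDensity (density c lam α β) r s) (hα : Summable fun x => |α x| * r x)
    (hβ : Summable fun y => |β y| * s y)
    {π : X × Y → ℝ} (hπ : π ∈ couplings r s) (hc : Summable fun p : X × Y => c p.1 p.2 * π p) :
    (primalObjective c lam π = ⊤ ∧ π ≠ withDensity (density c lam α β) r s) ∨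
    ∃ d : ℝ, 0 ≤ d ∧ (d = 0 ↔ π = withDensity (density c lam α β) r s) ∧
      primalObjective c lam π = ((∑' x, α x * r x + ∑' y, β y * s y + lam * d : ℝ) : EReal) := by
  set ρ := density c lam α β with hρdef
  have hq : ∀ p : X × Y, 0 ≤ r p.1 * s p.2 := fun p => mul_nonneg (hr.1 _) (hs.1 _)
  have hmi : mutualInfo π = extSum fun p : X × Y => π p * Real.log (π p / (r p.1 * s p.2)) := by
    unfold mutualInfo
    congr 1
    funext p
    rw [(hπ.2.2.1 p.1).tsum_eq, (hπ.2.2.2 p.2).tsum_eq]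
  have hπ1 := hasSum_one_of_mem_couplings hr hπ
  have hsα := hasSum_of_mem_couplings_left hπ hα
  have hsβ := hasSum_of_mem_couplings_right hπ hβ
  have hlogρ : HasSum (fun p : X × Y => π p * Real.log (ρ p.1 p.2))
      ((∑' x, α x * r x + ∑' y, β y * s y - ∑' p : X × Y, c p.1 p.2 * π p) / lam) := by
    refine (((hsα.add hsβ).sub hc.hasSum).div_const lam).congr_fun fun p => ?_
    simp only [hρdef, density, Real.log_exp]
    ring
  have hρ1 : HasSum (fun p : X × Y => ρ p.1 p.2 * (r p.1 * s p.2)) 1 :=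
    hasSum_one_of_mem_couplings hr (hρ.mem_couplings hr hs)
  have hterm := fun p : X × Y => log_div_ge (hρ.pos p.1 p.2) (hq p) (hπ.1 p)
    (eq_zero_of_mem_couplings hπ p)
  by_cases hsum : Summable fun p : X × Y => π p * Real.log (π p / (r p.1 * s p.2))
  · right
    have hd := ((hsum.hasSum.sub hlogρ).sub hπ1).add hρ1
    refine ⟨_, hd.nonneg fun p => (hterm p).1, ⟨fun h => ?_, fun h => ?_⟩, ?_⟩
    · rw [h] at hd
      have := (hasSum_zero_iff_of_nonneg fun p => (hterm p).1).1 hd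
      exact funext fun p => (hterm p).2.1 (congrFun this p)
    · have h0 : ∀ p : X × Y, π p * Real.log (π p / (r p.1 * s p.2)) - π p * Real.log (ρ p.1 p.2)
          - π p + ρ p.1 p.2 * (r p.1 * s p.2) = 0 := fun p => (hterm p).2.2 (congrFun h p)
      exact hd.unique (hasSum_zero.congr_fun h0)
    · rw [primalObjective, hmi, extSum_of_summable hsum, ← EReal.coe_mul, ← EReal.coe_add]
      congr 1
      field_simp
      ring
  · left
    have hlow : ∀ p : X × Y, -(r p.1 * s p.2) ≤ π p * Real.log (π p / (r p.1 * s p.2)) := fun p => by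
      have := (log_div_ge one_pos (hq p) (hπ.1 p) (eq_zero_of_mem_couplings hπ p)).1
      rw [Real.log_one] at this
      linarith [hπ.1 p]
    constructor
    · rw [primalObjective, hmi,
        extSum_of_not_summable (summable_mul_prod hr hs).summable hlow hsum,
        EReal.coe_mul_top_of_pos hlam, EReal.coe_add_top]
    · intro h
      refine hsum ?_
      refine (((hlogρ.add hπ1).sub hρ1).summable).congr fun p => ?_
      have := (hterm p).2.2 (congrFun h p)
      linarith

theorem isPlan_iff (hr : IsProb r) (hs : IsProb s) (hlam : 0 < lam)
    (hρ : IsDensity (density c lam α β) r s) (hα : Summable fun x => |α x| * r x)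
    (hβ : Summable fun y => |β y| * s y)
    (hc : ∀ π ∈ couplings r s, Summable fun p : X × Y => c p.1 p.2 * π p) (π : X × Y → ℝ) :
    IsPlan c lam r s π ↔ π = withDensity (density c lam α β) r s := by
  set π₀ := withDensity (density c lam α β) r s with hπ₀
  have hmem : π₀ ∈ couplings r s := hρ.mem_couplings hr hs
  have hval : primalObjective c lam π₀ =
      ((∑' x, α x * r x + ∑' y, β y * s y : ℝ) : EReal) := by
    rcases primalObjective_cases hr hs hlam hρ hα hβ hmem (hc _ hmem) with h | ⟨d, -, h1, h2⟩
    · exact absurd rfl h.2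
    · rw [h2, h1.2 rfl, mul_zero, add_zero]
  constructor
  · rintro ⟨hπ, hmin⟩
    have hle := hmin π₀ hmem
    rw [hval] at hle
    rcases primalObjective_cases hr hs hlam hρ hα hβ hπ (hc _ hπ) with h | ⟨d, h0, h1, h2⟩
    · rw [h.1] at hle
      exact absurd (top_le_iff.1 hle) (EReal.coe_ne_top _)
    · rw [h2, EReal.coe_le_coe_iff] at hle
      refine h1.1 (le_antisymm ?_ h0)
      by_contra hd
      have := mul_pos hlam (not_le.1 hd)
      linarith
  · rintro rfl
    refine ⟨hmem, fun π' hπ' => ?_⟩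
    rw [hval]
    rcases primalObjective_cases hr hs hlam hρ hα hβ hπ' (hc _ hπ') with h | ⟨d, h0, -, h2⟩
    · rw [h.1]; exact le_top
    · rw [h2, EReal.coe_le_coe_iff]
      linarith [mul_nonneg hlam.le h0]

/-- The dual objective is `-∞`, or it falls short of `⟨α, r⟩ + ⟨β, s⟩` by `lam` times a nonnegative
quantity that vanishes only if `α' ⊕ β' = α ⊕ β`. -/
theorem dualObjective_cases (hr : IsProb r) (hs : IsProb s) (hr0 : ∀ x, 0 < r x)
    (hs0 : ∀ y, 0 < s y) (hlam : 0 < lam)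
    (hρ : IsDensity (density c lam α β) r s) (hα : Summable fun x => |α x| * r x)
    (hβ : Summable fun y => |β y| * s y) {α' : X → ℝ} {β' : Y → ℝ}
    (hα' : Summable fun x => |α' x| * r x) (hβ' : Summable fun y => |β' y| * s y) :
    (dualObjective c lam r s α' β' = ⊥ ∧ ¬∀ x y, α' x + β' y = α x + β y) ∨
    ∃ d : ℝ, 0 ≤ d ∧ (d = 0 ↔ ∀ x y, α' x + β' y = α x + β y) ∧
      dualObjective c lam r s α' β' =
        ((∑' x, α x * r x + ∑' y, β y * s y - lam * d : ℝ) : EReal) := by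
  set π := withDensity (density c lam α β) r s with hπdef
  have hπ : π ∈ couplings r s := hρ.mem_couplings hr hs
  have hπ1 := hasSum_one_of_mem_couplings hr hπ
  have hπ0 : ∀ p, 0 < π p := fun p => mul_pos (hρ.pos _ _) (mul_pos (hr0 _) (hs0 _))
  let τ : X × Y → ℝ := fun p => (α' p.1 - α p.1 + (β' p.2 - β p.2)) / lam
  have hτ : HasSum (fun p => τ p * π p)
      ((∑' x, α' x * r x - ∑' x, α x * r x + (∑' y, β' y * s y - ∑' y, β y * s y)) / lam) := by
    refine (((hasSum_of_mem_couplings_left hπ hα').sub (hasSum_of_mem_couplings_left hπ hα)).add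
      ((hasSum_of_mem_couplings_right hπ hβ').sub
        (hasSum_of_mem_couplings_right hπ hβ))).div_const lam |>.congr_fun fun p => ?_
    simp only [τ]
    ring
  have hexp : ∀ p : X × Y, Real.exp ((α' p.1 + β' p.2 - c p.1 p.2) / lam) * (r p.1 * s p.2) =
      Real.exp (τ p) * π p := fun p => by
    simp only [hπdef, withDensity, density, τ]
    rw [← mul_assoc (Real.exp _) (Real.exp _), ← Real.exp_add]
    ring_nf
  have hrs := summable_mul_prod hr hs
  have hn : ∀ p, 0 ≤ Real.exp (τ p) * π p - π p - τ p * π p := fun p => by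
    have := mul_le_mul_of_nonneg_right (Real.add_one_le_exp (τ p)) (hπ0 p).le
    linarith
  have hz : ∀ p, Real.exp (τ p) * π p - π p - τ p * π p = 0 ↔
      α' p.1 + β' p.2 = α p.1 + β p.2 := fun p => by
    have h1 : τ p = 0 ↔ α' p.1 + β' p.2 = α p.1 + β p.2 := by
      simp only [τ, div_eq_zero_iff, hlam.ne', or_false]
      constructor <;> intro h <;> linarith
    rw [← h1]
    constructor
    · intro h
      by_contra hne
      have := mul_lt_mul_of_pos_right (Real.add_one_lt_exp hne) (hπ0 p)
      linarith
    · intro h; rw [h]; simp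
  by_cases hsum : Summable fun p : X × Y =>
      Real.exp ((α' p.1 + β' p.2 - c p.1 p.2) / lam) * (r p.1 * s p.2) - r p.1 * s p.2
  · right
    have hes : HasSum (fun p => Real.exp (τ p) * π p) ((∑' p : X × Y,
        (Real.exp ((α' p.1 + β' p.2 - c p.1 p.2) / lam) * (r p.1 * s p.2) - r p.1 * s p.2)) + 1) :=
      (hsum.hasSum.add hrs).congr_fun fun p => by rw [← hexp p]; ring
    have hd := (hes.sub hπ1).sub hτ
    refine ⟨_, hd.nonneg hn, ⟨fun h x y => ?_, fun h => ?_⟩, ?_⟩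
    · rw [h] at hd
      exact (hz (x, y)).1 (congrFun ((hasSum_zero_iff_of_nonneg hn).1 hd) (x, y))
    · exact hd.unique (hasSum_zero.congr_fun fun p => (hz p).2 (h p.1 p.2))
    · rw [dualObjective, extSum_of_summable hsum, ← EReal.coe_mul, ← EReal.coe_sub]
      congr 1
      field_simp
      ring
  · left
    refine ⟨?_, fun h => hsum ?_⟩
    · rw [dualObjective, extSum_of_not_summable hrs.summable (fun p => ?_) hsum,
        EReal.coe_mul_top_of_pos hlam, EReal.sub_top]
      rw [hexp p]
      linarith [mul_pos (Real.exp_pos (τ p)) (hπ0 p)]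
    · refine (hπ1.sub hrs).summable.congr fun p => ?_
      simp only [h p.1 p.2, hπdef, withDensity, density]

theorem isPotentials_iff (hr : IsProb r) (hs : IsProb s) (hr0 : ∀ x, 0 < r x)
    (hs0 : ∀ y, 0 < s y) (hlam : 0 < lam)
    (hρ : IsDensity (density c lam α β) r s) (hα : Summable fun x => |α x| * r x)
    (hβ : Summable fun y => |β y| * s y) (y₁ : Y) (α' : X → ℝ) (β' : Y → ℝ)
    (hnorm : β' y₁ = β y₁) :
    IsPotentials c lam r s α' β' ↔ α' = α ∧ β' = β := by
  have hval : dualObjective c lam r s α β =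
      ((∑' x, α x * r x + ∑' y, β y * s y : ℝ) : EReal) := by
    rcases dualObjective_cases hr hs hr0 hs0 hlam hρ hα hβ hα hβ with h | ⟨d, -, h1, h2⟩
    · exact absurd (fun _ _ => rfl) h.2
    · rw [h2, h1.2 fun _ _ => rfl, mul_zero, sub_zero]
  constructor
  · rintro ⟨hα', hβ', hmax⟩
    have hle := hmax α β hα hβ
    rw [hval] at hle
    have key : ∀ x y, α' x + β' y = α x + β y := by
      rcases dualObjective_cases hr hs hr0 hs0 hlam hρ hα hβ hα' hβ' with h | ⟨d, h0, h1, h2⟩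
      · rw [h.1] at hle
        exact absurd (le_bot_iff.1 hle) (EReal.coe_ne_bot _)
      · rw [h2, EReal.coe_le_coe_iff] at hle
        refine h1.1 (le_antisymm ?_ h0)
        by_contra hd
        have := mul_pos hlam (not_le.1 hd)
        linarith
    have h1 : ∀ x, α' x = α x := fun x => by have := key x y₁; linarith
    obtain ⟨x₀, -⟩ := hr.exists_pos
    exact ⟨funext h1, funext fun y => by have := key x₀ y; linarith [h1 x₀]⟩
  · rintro ⟨rfl, rfl⟩
    refine ⟨hα, hβ, fun α'' β'' h1 h2 => ?_⟩
    rw [hval]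
    rcases dualObjective_cases hr hs hr0 hs0 hlam hρ hα hβ h1 h2 with h | ⟨d, h0, -, h3⟩
    · rw [h.1]; exact bot_le
    · rw [h3, EReal.coe_le_coe_iff]
      linarith [mul_nonneg hlam.le h0]

end Plan

end EROT

/-! ### Operators with nonnegative kernels and the Neumann series -/

namespace EROT

variable {ι ι' X Y : Type*}

theorem hasSum_subtype_ne {F : Y → ℝ} {T : ℝ} (h : HasSum F T) (y₁ : Y) :
    HasSum (fun y : {y : Y // y ≠ y₁} => F y) (T - F y₁) := by
  classical
  have h1 := h.sub (hasSum_ite_eq y₁ (F y₁))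
  have h2 := (Subtype.val_injective (p := fun y => y ≠ y₁)).hasSum_iff
    (f := fun y => F y - if y = y₁ then F y₁ else 0) (a := T - F y₁) (fun y hy => by
      have : y = y₁ := by
        by_contra hne
        exact hy ⟨⟨y, hne⟩, rfl⟩
      subst this
      simp)
  exact (h2.2 h1).congr_fun fun y => by simp [y.2]

theorem abs_tsum_mul_le {m b w : ι → ℝ} {C M : ℝ} (hm : ∀ i, 0 ≤ m i)
    (hb : ∀ i, |b i| ≤ C * w i) (hC : 0 ≤ C) (hs : Summable fun i => m i * w i)
    (hM : ∑' i, m i * w i ≤ M) :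
    (Summable fun i => m i * b i) ∧ |∑' i, m i * b i| ≤ C * M := by
  have hle : ∀ i, ‖m i * b i‖ ≤ C * (m i * w i) := fun i => by
    rw [Real.norm_eq_abs, abs_mul, abs_of_nonneg (hm i)]
    calc m i * |b i| ≤ m i * (C * w i) := mul_le_mul_of_nonneg_left (hb i) (hm i)
      _ = C * (m i * w i) := by ring
  refine ⟨Summable.of_norm_bounded (hs.mul_left C) hle, ?_⟩
  calc |∑' i, m i * b i| ≤ C * ∑' i, m i * w i :=
        tsum_of_norm_bounded (hs.hasSum.mul_left C) hle
    _ ≤ C * M := mul_le_mul_of_nonneg_left hM hC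

/-- A nonnegative kernel defines a bounded operator between weighted `ℓ^∞` spaces as soon as it does
so on the weight. -/
theorem WLinf.exists_kernel_clm {w : ι' → ℝ} {v : ι → ℝ} [PosWeight w] [PosWeight v]
    (m : ι → ι' → ℝ) (hm : ∀ i j, 0 ≤ m i j) {M : ℝ} (hM0 : 0 ≤ M)
    (hs : ∀ i, Summable fun j => m i j * w j) (hM : ∀ i, ∑' j, m i j * w j ≤ M * v i) :
    ∃ T : WLinf w →L[ℝ] WLinf v, (∀ b i, HasSum (fun j => m i j * b j) (T b i)) ∧ ‖T‖ ≤ M := by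
  have key : ∀ (b : WLinf w) i,
      (Summable fun j => m i j * b j) ∧ |∑' j, m i j * b j| ≤ ‖b‖ * (M * v i) := fun b i =>
    abs_tsum_mul_le (hm i) (WLinf.abs_apply_le b) (norm_nonneg b) (hs i) (hM i)
  let L : WLinf w →ₗ[ℝ] WLinf v :=
    { toFun := fun b => WLinf.ofBound (fun i => ∑' j, m i j * b j) (‖b‖ * M) fun i => by
        rw [mul_assoc]; exact (key b i).2
      map_add' := fun a b => WLinf.ext fun i => by
        simp only [WLinf.ofBound_apply, WLinf.add_apply, mul_add]
        exact (key a i).1.tsum_add (key b i).1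
      map_smul' := fun t b => WLinf.ext fun i => by
        simp only [WLinf.ofBound_apply, WLinf.smul_apply, RingHom.id_apply]
        rw [← tsum_mul_left]
        exact tsum_congr fun j => by ring }
  have hL : ∀ b, ‖L b‖ ≤ M * ‖b‖ := fun b =>
    WLinf.norm_le (mul_nonneg hM0 (norm_nonneg b)) fun i => (key b i).2.trans_eq (by ring)
  exact ⟨L.mkContinuous M hL, fun b i => (key b i).1.hasSum, L.mkContinuous_norm_le hM0 hL⟩

theorem WL1.exists_kernel_clm {w : ι' → ℝ} {v : ι → ℝ} [PosWeight w] [PosWeight v]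
    (m : ι → ι' → ℝ) (hm : ∀ i j, 0 ≤ m i j) {M : ℝ} (hM0 : 0 ≤ M)
    (hM : ∀ i j, m i j ≤ M * v i * w j) :
    ∃ T : WL1 w →L[ℝ] WLinf v, ∀ h i, HasSum (fun j => m i j * h j) (T h i) := by
  have key : ∀ (h : WL1 w) i,
      (Summable fun j => m i j * h j) ∧ |∑' j, m i j * h j| ≤ M * v i * ‖h‖ := fun h i => by
    have h1 := WL1.tsum_mul_abs_le h (hm i) (hM i)
    have h2 : ∀ j, ‖m i j * h j‖ = m i j * |h j| := fun j => by
      rw [Real.norm_eq_abs, abs_mul, abs_of_nonneg (hm i j)]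
    exact ⟨Summable.of_norm (h1.1.congr fun j => (h2 j).symm),
      (tsum_of_norm_bounded h1.1.hasSum fun j => (h2 j).le).trans h1.2⟩
  let L : WL1 w →ₗ[ℝ] WLinf v :=
    { toFun := fun h => WLinf.ofBound (fun i => ∑' j, m i j * h j) (M * ‖h‖) fun i =>
        (key h i).2.trans_eq (by ring)
      map_add' := fun a b => WLinf.ext fun i => by
        simp only [WLinf.ofBound_apply, WLinf.add_apply, WL1.add_apply, mul_add]
        exact (key a i).1.tsum_add (key b i).1
      map_smul' := fun t b => WLinf.ext fun i => by
        simp only [WLinf.ofBound_apply, WLinf.smul_apply, WL1.smul_apply, RingHom.id_apply]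
        rw [← tsum_mul_left]
        exact tsum_congr fun j => by ring }
  have hL : ∀ b, ‖L b‖ ≤ M * ‖b‖ := fun h =>
    WLinf.norm_le (mul_nonneg hM0 (norm_nonneg h)) fun i => (key h i).2.trans_eq (by ring)
  exact ⟨L.mkContinuous M hL, fun h i => (key h i).1.hasSum⟩

section Neumann

variable {G H : Type*} [NormedAddCommGroup G] [NormedSpace ℝ G] [CompleteSpace G]
  [NormedAddCommGroup H] [NormedSpace ℝ H]

theorem ring_inverse_eq_of_mul_eq_one {R : Type*} [Ring R] {a b : R} (h : a * b = 1)
    (h' : b * a = 1) : IsUnit a ∧ Ring.inverse a = b :=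
  ⟨⟨⟨a, b, h, h'⟩, rfl⟩, Ring.inverse_unit ⟨a, b, h, h'⟩⟩

/-- If `‖A ∘ B‖ < 1`, then both `1 - A ∘ B` and `1 - B ∘ A` are inverted by their Neumann series,
as `(B ∘ A) ^ (m + 1) = B ∘ (A ∘ B) ^ m ∘ A`. -/
theorem neumann_of_norm_comp_lt_one (A : H →L[ℝ] G) (B : G →L[ℝ] H) (hAB : ‖A ∘L B‖ < 1) :
    IsUnit (1 - A ∘L B) ∧ IsUnit (1 - B ∘L A) ∧
      HasSum (fun m : ℕ => (A ∘L B) ^ m) (Ring.inverse (1 - A ∘L B)) ∧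
      HasSum (fun m : ℕ => (B ∘L A) ^ m) (Ring.inverse (1 - B ∘L A)) ∧
      Ring.inverse (1 - B ∘L A) = 1 + B ∘L Ring.inverse (1 - A ∘L B) ∘L A := by
  set T : G →L[ℝ] G := A ∘L B with hT
  have hP := (summable_geometric_of_norm_lt_one hAB).hasSum
  set P : G →L[ℝ] G := ∑' m : ℕ, T ^ m with hPdef
  have h1 : (1 - T) * P = 1 := mul_neg_geom_series T hAB
  have h2 : P * (1 - T) = 1 := geom_series_mul_neg T hAB
  obtain ⟨u1, i1⟩ := ring_inverse_eq_of_mul_eq_one h1 h2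
  have e1 : ∀ g, P g - A (B (P g)) = g := fun g => congrArg (fun S : G →L[ℝ] G => S g) h1
  have e2 : ∀ g, P (g - A (B g)) = g := fun g => congrArg (fun S : G →L[ℝ] G => S g) h2
  have h3 : (1 - B ∘L A) * (1 + B ∘L P ∘L A) = 1 := by
    ext h
    change h + B (P (A h)) - B (A (h + B (P (A h)))) = h
    have := congrArg B (e1 (A h))
    rw [map_sub] at this
    rw [map_add, map_add, ← this]
    abel
  have h4 : (1 + B ∘L P ∘L A) * (1 - B ∘L A) = 1 := by
    ext h
    change h - B (A h) + B (P (A (h - B (A h)))) = h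
    rw [map_sub A, e2 (A h)]
    abel
  obtain ⟨u2, i2⟩ := ring_inverse_eq_of_mul_eq_one h3 h4
  refine ⟨u1, u2, ?_, ?_, ?_⟩
  · rw [i1]; exact hP
  · have hpow : ∀ m : ℕ, (B ∘L A) ^ (m + 1) = B ∘L (T ^ m) ∘L A := fun m => by
      induction m with
      | zero => ext h; simp
      | succ m ih =>
        rw [pow_succ, ih, pow_succ]
        rfl
    have hS : HasSum (fun m : ℕ => (B ∘L A) ^ (m + 1)) (B ∘L P ∘L A) := by
      have h5 := (ContinuousLinearMap.compL ℝ H G H B).hasSum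
        (((ContinuousLinearMap.compL ℝ H G G).flip A).hasSum hP)
      exact h5.congr_fun hpow
    rw [i2]
    have := (hasSum_nat_add_iff' (f := fun m : ℕ => (B ∘L A) ^ m) 1
      (g := 1 + B ∘L P ∘L A)).1 (by simpa using hS)
    exact this
  · rw [i2, i1]

end Neumann

end EROT

/-! ### Perturbation of the marginals -/

namespace EROT

variable {X Y : Type*}

/-- The probability densities `ρ` with respect to `r ⊗ s` and `ρ u v` with respect to `r' ⊗ s'`
solve the same Schrödinger problem for two pairs of marginals, with quantitative bounds: `M` bounds
the sizes of `ρ`, `u` and `v`, `δ` bounds the conditional masses of `y₁` from below, and `η` bounds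
the distances of the marginals. The factors `u`, `v` are normalized by `v y₁ = 1`. -/
structure Perturbation (ρ : X → Y → ℝ) (E : Y → ℝ) (y₁ : Y) (M δ S : ℝ) (r : X → ℝ) (s : Y → ℝ)
    (r' : X → ℝ) (s' : Y → ℝ) (u : X → ℝ) (v : Y → ℝ) (η : ℝ) : Prop where
  dens : IsDensity ρ r s
  prob_left : ∀ x, 0 ≤ r x
  prob_right : ∀ y, 0 ≤ s y
  dens' : IsDensity (fun x y => ρ x y * (u x * v y)) r' s'
  one_le_E : ∀ y, 1 ≤ E y
  rho_le : ∀ x y, ρ x y ≤ M * E y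
  delta_pos : 0 < δ
  delta_le : ∀ x, δ ≤ ρ x y₁ * s y₁
  u_pos : ∀ x, 0 < u x
  u_le : ∀ x, u x ≤ M
  u_ge : ∀ x, (u x)⁻¹ ≤ M
  v_pos : ∀ y, 0 < v y
  v_le : ∀ y, v y ≤ M * E y
  v_one : v y₁ = 1
  M_nonneg : 0 ≤ M
  S_nonneg : 0 ≤ S
  eta_nonneg : 0 ≤ η
  sum_E : Summable fun y => E y ^ 4 * s y
  sum_E_le : ∑' y, E y ^ 4 * s y ≤ S
  sum_dr : Summable fun x => |r' x - r x|
  sum_dr_le : ∑' x, |r' x - r x| ≤ η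
  sum_ds : Summable fun y => E y ^ 4 * |s' y - s y|
  sum_ds_le : ∑' y, E y ^ 4 * |s' y - s y| ≤ η

namespace Perturbation

variable {ρ : X → Y → ℝ} {E : Y → ℝ} {y₁ : Y} {M δ S : ℝ} {r : X → ℝ} {s : Y → ℝ}
  {r' : X → ℝ} {s' : Y → ℝ} {u : X → ℝ} {v : Y → ℝ} {η : ℝ}

section

variable (h : Perturbation ρ E y₁ M δ S r s r' s' u v η)
include h

theorem E_pos (y : Y) : 0 < E y := zero_lt_one.trans_le (h.one_le_E y)

theorem E_pow_le (y : Y) {m n : ℕ} (hmn : m ≤ n) : E y ^ m ≤ E y ^ n :=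
  pow_le_pow_right₀ (h.one_le_E y) hmn

theorem sum_rho_s {b : Y → ℝ} {C : ℝ} (hC : 0 ≤ C) (hb : ∀ y, |b y| ≤ C * E y ^ 3) (x : X) :
    (Summable fun y => ρ x y * s y * b y) ∧ |∑' y, ρ x y * s y * b y| ≤ C * (M * S) := by
  have h0 : ∀ y, 0 ≤ ρ x y * s y := fun y => mul_nonneg (h.dens.pos x y).le (h.prob_right y)
  have hle : ∀ y, ρ x y * s y * E y ^ 3 ≤ M * (E y ^ 4 * s y) := fun y => by
    have h1 := mul_le_mul_of_nonneg_right (h.rho_le x y)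
      (mul_nonneg (h.prob_right y) (pow_pos (h.E_pos y) 3).le)
    calc ρ x y * s y * E y ^ 3 = ρ x y * (s y * E y ^ 3) := by ring
      _ ≤ M * E y * (s y * E y ^ 3) := h1
      _ = M * (E y ^ 4 * s y) := by ring
  have hs : Summable fun y => ρ x y * s y * E y ^ 3 :=
    Summable.of_nonneg_of_le (fun y => mul_nonneg (h0 y) (pow_pos (h.E_pos y) 3).le) hle
      (h.sum_E.mul_left M)
  refine abs_tsum_mul_le h0 hb hC hs ?_
  calc ∑' y, ρ x y * s y * E y ^ 3 ≤ ∑' y, M * (E y ^ 4 * s y) :=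
        hs.tsum_le_tsum hle (h.sum_E.mul_left M)
    _ = M * ∑' y, E y ^ 4 * s y := tsum_mul_left
    _ ≤ M * S := mul_le_mul_of_nonneg_left h.sum_E_le h.M_nonneg

theorem sum_rho_ds {b : Y → ℝ} {C : ℝ} (hC : 0 ≤ C) (hb : ∀ y, |b y| ≤ C * E y ^ 3) (x : X) :
    (Summable fun y => ρ x y * b y * (s' y - s y)) ∧
      |∑' y, ρ x y * b y * (s' y - s y)| ≤ M * C * η := by
  have hle : ∀ y, ‖ρ x y * b y * (s' y - s y)‖ ≤ M * C * (E y ^ 4 * |s' y - s y|) := fun y => by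
    rw [Real.norm_eq_abs, abs_mul, abs_mul, abs_of_pos (h.dens.pos x y)]
    have h1 : ρ x y * |b y| ≤ M * E y * (C * E y ^ 3) :=
      mul_le_mul (h.rho_le x y) (hb y) (abs_nonneg _) (mul_nonneg h.M_nonneg (h.E_pos y).le)
    calc ρ x y * |b y| * |s' y - s y| ≤ M * E y * (C * E y ^ 3) * |s' y - s y| :=
          mul_le_mul_of_nonneg_right h1 (abs_nonneg _)
      _ = M * C * (E y ^ 4 * |s' y - s y|) := by ring
  refine ⟨Summable.of_norm_bounded (h.sum_ds.mul_left _) hle, ?_⟩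
  exact (tsum_of_norm_bounded (h.sum_ds.hasSum.mul_left _) hle).trans
    (mul_le_mul_of_nonneg_left h.sum_ds_le (mul_nonneg h.M_nonneg hC))

theorem sum_rho_r {b : X → ℝ} {C : ℝ} (hC : 0 ≤ C) (hb : ∀ x, |b x| ≤ C) (y : Y) :
    (Summable fun x => ρ x y * r x * b x) ∧ |∑' x, ρ x y * r x * b x| ≤ C := by
  have := abs_tsum_mul_le (m := fun x => ρ x y * r x) (b := b) (w := fun _ => 1) (C := C) (M := 1)
    (fun x => mul_nonneg (h.dens.pos x y).le (h.prob_left x)) (fun x => by simpa using hb x) hC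
    (by simpa using (h.dens.right y).summable) (by simpa using (h.dens.right y).tsum_eq.le)
  simpa using this

theorem sum_rho_dr {b : X → ℝ} {C : ℝ} (hC : 0 ≤ C) (hb : ∀ x, |b x| ≤ C) (y : Y) :
    (Summable fun x => ρ x y * b x * (r' x - r x)) ∧
      |∑' x, ρ x y * b x * (r' x - r x)| ≤ M * C * E y * η := by
  have hME : 0 ≤ M * E y := mul_nonneg h.M_nonneg (h.E_pos y).le
  have hle : ∀ x, ‖ρ x y * b x * (r' x - r x)‖ ≤ M * C * E y * |r' x - r x| := fun x => by
    rw [Real.norm_eq_abs, abs_mul, abs_mul, abs_of_pos (h.dens.pos x y)]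
    refine mul_le_mul_of_nonneg_right ?_ (abs_nonneg _)
    calc ρ x y * |b x| ≤ M * E y * C := mul_le_mul (h.rho_le x y) (hb x) (abs_nonneg _) hME
      _ = M * C * E y := by ring
  refine ⟨Summable.of_norm_bounded (h.sum_dr.mul_left _) hle, ?_⟩
  refine (tsum_of_norm_bounded (h.sum_dr.hasSum.mul_left _) hle).trans
    (mul_le_mul_of_nonneg_left h.sum_dr_le ?_)
  exact mul_nonneg (mul_nonneg h.M_nonneg hC) (h.E_pos y).le

theorem abs_u_le (x : X) : |u x| ≤ M := by rw [abs_of_pos (h.u_pos x)]; exact h.u_le x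

theorem abs_v_le (y : Y) : |v y| ≤ M * E y ^ 3 := by
  rw [abs_of_pos (h.v_pos y)]
  refine (h.v_le y).trans (mul_le_mul_of_nonneg_left ?_ h.M_nonneg)
  simpa using h.E_pow_le y (show 1 ≤ 3 by norm_num)

/-- The equation at `x`: `1 / u - 1 = ∑ ρ s (v - 1) + ∑ ρ (s' - s) v`. -/
theorem inv_u_eq (x : X) :
    (u x)⁻¹ - 1 = ∑' y, ρ x y * s y * (v y - 1) + ∑' y, ρ x y * v y * (s' y - s y) := by
  have h1 : HasSum (fun y => ρ x y * v y * s' y) (u x)⁻¹ := by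
    have := (h.dens'.left x).mul_left (u x)⁻¹
    rw [mul_one] at this
    refine this.congr_fun fun y => ?_
    have := (h.u_pos x).ne'
    field_simp
  have h2 := (h.sum_rho_ds h.M_nonneg h.abs_v_le x).1.hasSum
  have h3 := (h1.sub h2).sub (h.dens.left x)
  have h4 := h3.congr_fun (g := fun y => ρ x y * s y * (v y - 1)) fun y => by ring
  rw [h4.tsum_eq]; ring

/-- The equation at `y`: `1 / v = ∑ ρ r u + ∑ ρ (r' - r) u`. -/
theorem inv_v_eq (y : Y) :
    (v y)⁻¹ = ∑' x, ρ x y * r x * u x + ∑' x, ρ x y * u x * (r' x - r x) := by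
  have h1 : HasSum (fun x => ρ x y * u x * r' x) (v y)⁻¹ := by
    have := (h.dens'.right y).mul_left (v y)⁻¹
    rw [mul_one] at this
    refine this.congr_fun fun x => ?_
    have := (h.v_pos y).ne'
    field_simp
  have h2 := (h.sum_rho_r h.M_nonneg h.abs_u_le y).1.hasSum
  have h3 := (h.sum_rho_dr h.M_nonneg h.abs_u_le y).1.hasSum
  refine h1.unique ((h2.add h3).congr_fun fun x => by ring)

/-- The average `∑ ρ r u` inherits every bound `|1 / u - 1| ≤ N`. -/
theorem inv_mean_bounds {N : ℝ} (hN : ∀ x, |(u x)⁻¹ - 1| ≤ N) (y : Y) :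
    0 < ∑' x, ρ x y * r x * u x ∧ (∑' x, ρ x y * r x * u x)⁻¹ ≤ M ∧
      |(∑' x, ρ x y * r x * u x)⁻¹ - 1| ≤ N := by
  have hw := (h.sum_rho_r h.M_nonneg h.abs_u_le y).1.hasSum
  set w := ∑' x, ρ x y * r x * u x with hwdef
  have h0 : ∀ x, 0 ≤ ρ x y * r x := fun x => mul_nonneg (h.dens.pos x y).le (h.prob_left x)
  have hx : ∃ x : X, True := by
    by_contra hne
    have hem : ∀ x : X, False := fun x => hne ⟨x, trivial⟩
    have := h.dens.right y
    rw [show (fun x => ρ x y * r x) = fun _ => (0 : ℝ) from funext fun x => (hem x).elim] at this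
    exact zero_ne_one (hasSum_zero.unique this)
  obtain ⟨x₀, -⟩ := hx
  -- a lower bound `1 / P` for `u` is a lower bound for its average, and an upper bound as well
  have lower : ∀ P, 0 < P → (∀ x, (u x)⁻¹ ≤ P) → P⁻¹ ≤ w := fun P hP hu => by
    have h1 := (h.dens.right y).mul_left P⁻¹
    rw [mul_one] at h1
    refine hasSum_le (fun x => ?_) h1 hw
    rw [mul_comm]
    refine mul_le_mul_of_nonneg_left ?_ (h0 x)
    have := inv_anti₀ (inv_pos.2 (h.u_pos x)) (hu x)
    rwa [inv_inv] at this
  have upper : ∀ Q, 0 < Q → (∀ x, Q ≤ (u x)⁻¹) → w ≤ Q⁻¹ := fun Q hQ hu => by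
    have h1 := (h.dens.right y).mul_left Q⁻¹
    rw [mul_one] at h1
    refine hasSum_le (fun x => ?_) hw h1
    rw [mul_comm Q⁻¹]
    refine mul_le_mul_of_nonneg_left ?_ (h0 x)
    have := inv_anti₀ hQ (hu x)
    rwa [inv_inv] at this
  have hM : 0 < M := (inv_pos.2 (h.u_pos x₀)).trans_le (h.u_ge x₀)
  have hw0 : 0 < w := (inv_pos.2 hM).trans_le (lower M hM h.u_ge)
  refine ⟨hw0, ?_, abs_le.2 ⟨?_, ?_⟩⟩
  · have := inv_anti₀ (inv_pos.2 hM) (lower M hM h.u_ge)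
    rwa [inv_inv] at this
  · rcases le_or_gt 1 N with h1 | h1
    · have := inv_pos.2 hw0
      linarith
    · have := inv_anti₀ hw0 (upper (1 - N) (by linarith) fun x => by
        have := (abs_le.1 (hN x)).1; linarith)
      rw [inv_inv] at this
      linarith
  · have hP : 0 < 1 + N := by
      have := (abs_nonneg _).trans (hN x₀)
      linarith
    have := inv_anti₀ (inv_pos.2 hP) (lower (1 + N) hP fun x => by
      have := (abs_le.1 (hN x)).2; linarith)
    rw [inv_inv] at this
    linarith

/-- Lipschitz stability of the first factor. The supremum `N` of `|1 / u - 1|` satisfies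
`N ≤ (1 - δ) N + O(η)`: averaging over `x` and over `y` does not increase the deviation, and the
point `y₁`, where `v = 1`, contributes a share of at least `δ` without deviation. -/
theorem abs_inv_u_sub_one_le (x : X) :
    |(u x)⁻¹ - 1| ≤ (M ^ 5 * S + M ^ 2) / δ * η := by
  have hM := h.M_nonneg
  have hη := h.eta_nonneg
  have hbdd : BddAbove (Set.range fun x => |(u x)⁻¹ - 1|) := by
    refine ⟨M + 1, ?_⟩
    rintro _ ⟨x, rfl⟩
    refine abs_le.2 ⟨?_, ?_⟩
    · have := inv_pos.2 (h.u_pos x); linarith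
    · have := h.u_ge x; linarith
  set N := ⨆ x, |(u x)⁻¹ - 1| with hNdef
  have hN : ∀ x, |(u x)⁻¹ - 1| ≤ N := fun x => le_ciSup hbdd x
  have hN0 : 0 ≤ N := (abs_nonneg _).trans (hN x)
  have hstep : ∀ x, |(u x)⁻¹ - 1| ≤ (1 - δ) * N + (M ^ 5 * S + M ^ 2) * η := fun x => by
    let w : Y → ℝ := fun y => ∑' x, ρ x y * r x * u x
    have hv1 : ∀ y, |v y - (w y)⁻¹| ≤ M ^ 4 * η * E y ^ 2 := fun y => by
      obtain ⟨hw0, hwM, -⟩ := h.inv_mean_bounds hN y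
      have he := (h.sum_rho_dr h.M_nonneg h.abs_u_le y).2
      have hve := h.inv_v_eq y
      set e := ∑' x, ρ x y * u x * (r' x - r x)
      have hvp := h.v_pos y
      have hwne : w y ≠ 0 := hw0.ne'
      have : v y - (w y)⁻¹ = -(v y * e * (w y)⁻¹) := by
        have h1 : e = (v y)⁻¹ - w y := by rw [hve]; ring
        rw [h1]
        field_simp
        ring
      rw [this, abs_neg, abs_mul, abs_mul, abs_of_pos hvp, abs_of_pos (inv_pos.2 hw0)]
      have hE := (h.E_pos y).le
      calc v y * |e| * (w y)⁻¹ ≤ M * E y * (M * M * E y * η) * M := by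
            have := h.v_le y
            have := (inv_pos.2 hw0).le
            gcongr
        _ = M ^ 4 * η * E y ^ 2 := by ring
    -- the deviation of `v`, with its exact value at `y₁`
    have hv2 : ∀ y, |ρ x y * s y * (v y - 1)| ≤
        N * (ρ x y * s y - Set.indicator {y₁} (fun y => ρ x y * s y) y) +
          ρ x y * s y * (M ^ 4 * η * E y ^ 2) := fun y => by
      have hρs : 0 ≤ ρ x y * s y := mul_nonneg (h.dens.pos x y).le (h.prob_right y)
      have hlast : 0 ≤ ρ x y * s y * (M ^ 4 * η * E y ^ 2) :=
        mul_nonneg hρs (by have := h.E_pos y; positivity)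
      by_cases hy : y = y₁
      · subst hy
        rw [h.v_one, Set.indicator_of_mem (Set.mem_singleton _)]
        simpa using hlast
      · rw [Set.indicator_of_notMem (by simpa using hy), sub_zero, abs_mul, abs_of_nonneg hρs]
        have h1 := (h.inv_mean_bounds hN y).2.2
        have h2 : |v y - 1| ≤ M ^ 4 * η * E y ^ 2 + N := by
          calc |v y - 1| = |(v y - (w y)⁻¹) + ((w y)⁻¹ - 1)| := by ring_nf
            _ ≤ _ := (abs_add_le _ _).trans (add_le_add (hv1 y) h1)
        calc ρ x y * s y * |v y - 1| ≤ ρ x y * s y * (M ^ 4 * η * E y ^ 2 + N) :=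
              mul_le_mul_of_nonneg_left h2 hρs
          _ = _ := by ring
    have hb2 : ∀ y, |M ^ 4 * η * E y ^ 2| ≤ M ^ 4 * η * E y ^ 3 := fun y => by
      have := h.E_pos y
      rw [abs_of_nonneg (by positivity)]
      exact mul_le_mul_of_nonneg_left (h.E_pow_le y (by norm_num)) (by positivity)
    obtain ⟨hs3, hle3⟩ := h.sum_rho_s (by positivity) hb2 x
    have hind : HasSum (Set.indicator {y₁} fun y => ρ x y * s y) (ρ x y₁ * s y₁) := by
      have := hasSum_single (f := Set.indicator {y₁} fun y => ρ x y * s y) y₁ fun y hy =>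
        Set.indicator_of_notMem (by simpa using hy) _
      rwa [Set.indicator_of_mem (Set.mem_singleton _)] at this
    have hbig := ((((h.dens.left x).sub hind).mul_left N).add hs3.hasSum)
    have hfirst : |∑' y, ρ x y * s y * (v y - 1)| ≤ N * (1 - ρ x y₁ * s y₁) +
        ∑' y, ρ x y * s y * (M ^ 4 * η * E y ^ 2) :=
      tsum_of_norm_bounded (f := fun y => ρ x y * s y * (v y - 1)) hbig hv2
    have hsecond := (h.sum_rho_ds h.M_nonneg h.abs_v_le x).2
    rw [h.inv_u_eq x]
    have h1 := (abs_le.1 hle3).2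
    have h2 : N * (1 - ρ x y₁ * s y₁) ≤ N * (1 - δ) :=
      mul_le_mul_of_nonneg_left (by linarith [h.delta_le x]) hN0
    calc _ ≤ _ := abs_add_le _ _
      _ ≤ (N * (1 - δ) + M ^ 4 * η * (M * S)) + M * M * η := by linarith
      _ = (1 - δ) * N + (M ^ 5 * S + M ^ 2) * η := by ring
  have hfin : N ≤ (1 - δ) * N + (M ^ 5 * S + M ^ 2) * η :=
    have : Nonempty X := ⟨x⟩
    ciSup_le hstep
  refine (hN x).trans ?_
  rw [div_mul_eq_mul_div, le_div_iff₀ h.delta_pos]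
  linarith

end

/-- The Lipschitz constant of the first factor `u`. -/
noncomputable def lipU (M δ S : ℝ) : ℝ := (M ^ 5 * S + M ^ 2) / δ

/-- The Lipschitz constant of the second factor `v`. -/
noncomputable def lipV (M δ S : ℝ) : ℝ := M * lipU M δ S + M ^ 2

section

variable (h : Perturbation ρ E y₁ M δ S r s r' s' u v η)
include h

theorem lipU_nonneg : 0 ≤ lipU M δ S :=
  div_nonneg (add_nonneg (mul_nonneg (pow_nonneg h.M_nonneg 5) h.S_nonneg) (sq_nonneg M))
    h.delta_pos.le

theorem lipV_nonneg : 0 ≤ lipV M δ S :=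
  add_nonneg (mul_nonneg h.M_nonneg h.lipU_nonneg) (sq_nonneg M)

theorem abs_u_sub_one_le (x : X) : |u x - 1| ≤ M * lipU M δ S * η := by
  have h1 := h.abs_inv_u_sub_one_le x
  have h2 := (h.u_pos x)
  have : u x - 1 = -(u x * ((u x)⁻¹ - 1)) := by field_simp; ring
  rw [this, abs_neg, abs_mul, abs_of_pos h2, mul_assoc]
  exact mul_le_mul (h.u_le x) h1 (abs_nonneg _) h.M_nonneg

theorem abs_u_add_inv_le (x : X) :
    |(u x - 1) + ((u x)⁻¹ - 1)| ≤ M * lipU M δ S ^ 2 * η ^ 2 := by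
  have h1 := h.abs_inv_u_sub_one_le x
  have h2 := (h.u_pos x)
  have : (u x - 1) + ((u x)⁻¹ - 1) = u x * ((u x)⁻¹ - 1) ^ 2 := by field_simp; ring
  rw [this, abs_mul, abs_of_pos h2, abs_pow, mul_assoc, ← mul_pow]
  exact mul_le_mul (h.u_le x) (pow_le_pow_left₀ (abs_nonneg _) h1 2)
    (by positivity) h.M_nonneg

/-- `1 / v - 1` to first order: the product of the two perturbations is quadratic in `η`. -/
theorem inv_v_sub_one (y : Y) :
    |(v y)⁻¹ - 1 - ∑' x, ρ x y * r x * (u x - 1) - ∑' x, ρ x y * (r' x - r x)| ≤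
      M ^ 2 * lipU M δ S * E y * η ^ 2 := by
  have hU := h.lipU_nonneg
  have hM := h.M_nonneg
  have hη := h.eta_nonneg
  have h1 := (h.sum_rho_r (b := fun _ => 1) zero_le_one (by simp) y).1.hasSum
  have h2 := (h.sum_rho_r h.M_nonneg h.abs_u_le y).1.hasSum
  have h3 := (h.sum_rho_dr h.M_nonneg h.abs_u_le y).1.hasSum
  have h4 := (h.sum_rho_dr (b := fun _ => 1) zero_le_one (by simp) y).1.hasSum
  have h5 := h.sum_rho_dr (by positivity) h.abs_u_sub_one_le y
  have e1 : ∑' x, ρ x y * r x * (u x - 1) = ∑' x, ρ x y * r x * u x - 1 := by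
    have h6 := h2.sub (h.dens.right y)
    exact (h6.congr_fun fun x => by ring).tsum_eq
  have e2 : ∑' x, ρ x y * (u x - 1) * (r' x - r x) =
      ∑' x, ρ x y * u x * (r' x - r x) - ∑' x, ρ x y * (r' x - r x) := by
    have h6 := h3.sub h4
    simp only [mul_one] at h6
    exact (h6.congr_fun fun x => by ring).tsum_eq
  have : (v y)⁻¹ - 1 - ∑' x, ρ x y * r x * (u x - 1) - ∑' x, ρ x y * (r' x - r x) =
      ∑' x, ρ x y * (u x - 1) * (r' x - r x) := by
    rw [e1, e2, h.inv_v_eq y]; ring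
  rw [this]
  exact h5.2.trans_eq (by ring)

theorem abs_inv_v_sub_one_le (y : Y) : |(v y)⁻¹ - 1| ≤ lipV M δ S * E y * η := by
  have hU := h.lipU_nonneg
  have hM := h.M_nonneg
  have hη := h.eta_nonneg
  have h2 := (h.sum_rho_r h.M_nonneg h.abs_u_le y).1.hasSum
  have h3 := h.sum_rho_dr h.M_nonneg h.abs_u_le y
  have h5 := h.sum_rho_r (by positivity) h.abs_u_sub_one_le y
  have e1 : ∑' x, ρ x y * r x * (u x - 1) = ∑' x, ρ x y * r x * u x - 1 := by
    have h6 := h2.sub (h.dens.right y)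
    exact (h6.congr_fun fun x => by ring).tsum_eq
  have : (v y)⁻¹ - 1 = ∑' x, ρ x y * r x * (u x - 1) + ∑' x, ρ x y * u x * (r' x - r x) := by
    rw [e1, h.inv_v_eq y]; ring
  rw [this]
  calc _ ≤ _ := abs_add_le _ _
    _ ≤ M * lipU M δ S * η + M * M * E y * η := add_le_add h5.2 h3.2
    _ ≤ M * lipU M δ S * η * E y + M * M * E y * η := by
      exact add_le_add (le_mul_of_one_le_right (by positivity) (h.one_le_E y)) le_rfl
    _ = lipV M δ S * E y * η := by unfold lipV; ring

theorem abs_v_sub_one_le (y : Y) : |v y - 1| ≤ M * lipV M δ S * η * E y ^ 2 := by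
  have h1 := h.abs_inv_v_sub_one_le y
  have h2 := h.v_pos y
  have : v y - 1 = -(v y * ((v y)⁻¹ - 1)) := by field_simp; ring
  rw [this, abs_neg, abs_mul, abs_of_pos h2]
  calc v y * |(v y)⁻¹ - 1| ≤ M * E y * (lipV M δ S * E y * η) :=
        mul_le_mul (h.v_le y) h1 (abs_nonneg _) (mul_nonneg h.M_nonneg (h.E_pos y).le)
    _ = _ := by ring

theorem abs_v_add_inv_le (y : Y) :
    |(v y - 1) + ((v y)⁻¹ - 1)| ≤ M * lipV M δ S ^ 2 * η ^ 2 * E y ^ 3 := by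
  have h1 := h.abs_inv_v_sub_one_le y
  have h2 := h.v_pos y
  have : (v y - 1) + ((v y)⁻¹ - 1) = v y * ((v y)⁻¹ - 1) ^ 2 := by field_simp; ring
  rw [this, abs_mul, abs_of_pos h2, abs_pow]
  calc v y * |(v y)⁻¹ - 1| ^ 2 ≤ M * E y * (lipV M δ S * E y * η) ^ 2 :=
        mul_le_mul (h.v_le y) (pow_le_pow_left₀ (abs_nonneg _) h1 2) (by positivity)
          (mul_nonneg h.M_nonneg (h.E_pos y).le)
    _ = _ := by ring

theorem inv_u_sub_one (x : X) :
    |(u x)⁻¹ - 1 - ∑' y, ρ x y * s y * (v y - 1) - ∑' y, ρ x y * (s' y - s y)| ≤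
      M ^ 2 * lipV M δ S * η ^ 2 := by
  have hV := h.lipV_nonneg
  have hM := h.M_nonneg
  have hη := h.eta_nonneg
  have hb : ∀ y, |v y - 1| ≤ M * lipV M δ S * η * E y ^ 3 := fun y =>
    (h.abs_v_sub_one_le y).trans
      (mul_le_mul_of_nonneg_left (h.E_pow_le y (by norm_num)) (by positivity))
  have h3 := (h.sum_rho_ds h.M_nonneg h.abs_v_le x).1.hasSum
  have h4 := (h.sum_rho_ds (b := fun _ => 1) zero_le_one (fun y => by
    simpa using one_le_pow₀ (h.one_le_E y)) x).1.hasSum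
  have h5 := h.sum_rho_ds (by positivity) hb x
  have e2 : ∑' y, ρ x y * (v y - 1) * (s' y - s y) =
      ∑' y, ρ x y * v y * (s' y - s y) - ∑' y, ρ x y * (s' y - s y) := by
    have h6 := h3.sub h4
    simp only [mul_one] at h6
    exact (h6.congr_fun fun x => by ring).tsum_eq
  have : (u x)⁻¹ - 1 - ∑' y, ρ x y * s y * (v y - 1) - ∑' y, ρ x y * (s' y - s y) =
      ∑' y, ρ x y * (v y - 1) * (s' y - s y) := by
    rw [e2, h.inv_u_eq x]; ring
  rw [this]
  exact h5.2.trans_eq (by ring)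

end

end Perturbation

end EROT

/-! ### The linearized plan -/

namespace EROT

variable {ι X Y : Type*}

theorem extendAt_of_ne {y₁ : Y} {a : ℝ} (b : {y : Y // y ≠ y₁} → ℝ) {y : Y} (hy : y ≠ y₁) :
    extendAt y₁ a b y = b ⟨y, hy⟩ := dif_neg hy

@[simp] theorem extendAt_self {y₁ : Y} {a : ℝ} (b : {y : Y // y ≠ y₁} → ℝ) :
    extendAt y₁ a b y₁ = a := dif_pos rfl

theorem hasSum_mul_extendAt {y₁ : Y} (m : Y → ℝ) (b : {y : Y // y ≠ y₁} → ℝ) {T : ℝ} :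
    HasSum (fun y => m y * extendAt y₁ 0 b y) T ↔
      HasSum (fun y : {y : Y // y ≠ y₁} => m y * b y) T := by
  rw [← (Subtype.val_injective (p := fun y => y ≠ y₁)).hasSum_iff]
  · refine iff_of_eq ?_
    congr 1
    funext y
    simp [extendAt_of_ne b y.2]
  · intro y hy
    have : y = y₁ := by
      by_contra hne
      exact hy ⟨⟨y, hne⟩, rfl⟩
    rw [this, extendAt_self, mul_zero]

theorem one_le_growthWeight (cm cp : ι → ℝ) (i : ι) : 1 ≤ growthWeight cm cp i := by
  unfold growthWeight
  linarith [abs_nonneg (cp i), abs_nonneg (cm i)]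

theorem one_le_expWeight {lam : ℝ} (hlam : 0 < lam) {cm cp : ι → ℝ} (h : ∀ i, cm i ≤ cp i)
    (i : ι) : 1 ≤ expWeight lam cm cp i :=
  Real.one_le_exp (div_nonneg (sub_nonneg.2 (h i)) hlam.le)

/-- The operators `A^X`, `A^Y`, `B^X`, `B^Y` attached to a density `ρ = π / (r ⊗ s)`. -/
structure IsMarginalOps {lam : ℝ} {cXm cXp : X → ℝ} {cYm cYp : Y → ℝ} {y₁ : Y}
    (ρ : X → Y → ℝ) (r : X → ℝ) (s : Y → ℝ)
    (AX : WLinf (expWeightOff y₁ lam cYm cYp) →L[ℝ] WLinf (oneWeight X))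
    (AY : WLinf (oneWeight X) →L[ℝ] WLinf (expWeightOff y₁ lam cYm cYp))
    (BX : WL1 (kWeight lam 4 cYm cYp) →L[ℝ] WLinf (oneWeight X))
    (BY : WL1 (growthWeight cXm cXp) →L[ℝ] WLinf (expWeightOff y₁ lam cYm cYp)) : Prop where
  AX_apply : ∀ b x, HasSum (fun y : {y : Y // y ≠ y₁} => ρ x y * s y * b y) (AX b x)
  AY_apply : ∀ a y, HasSum (fun x : X => ρ x y.1 * r x * a x) (AY a y)
  BX_apply : ∀ h x, HasSum (fun y : Y => ρ x y * h y) (BX h x)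
  BY_apply : ∀ h y, HasSum (fun x : X => ρ x y.1 * h x) (BY h y)
  norm_lt : ‖AX ∘L AY‖ < 1

section Ops

variable {lam : ℝ} {cXm cXp : X → ℝ} {cYm cYp : Y → ℝ} {y₁ : Y} {ρ : X → Y → ℝ} {r : X → ℝ}
  {s : Y → ℝ} {M δ : ℝ}

theorem exists_isMarginalOps (cXm cXp : X → ℝ) (hρ : IsDensity ρ r s) (hr : ∀ x, 0 ≤ r x)
    (hs : ∀ y, 0 ≤ s y)
    (hE : ∀ y, 1 ≤ expWeight lam cYm cYp y) (hM : 0 ≤ M)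
    (hρM : ∀ x y, ρ x y ≤ M * expWeight lam cYm cYp y) (hδ : 0 < δ)
    (hρδ : ∀ x, δ ≤ ρ x y₁ * s y₁)
    (hES : Summable fun y => expWeight lam cYm cYp y ^ 4 * s y) :
    ∃ (AX : WLinf (expWeightOff y₁ lam cYm cYp) →L[ℝ] WLinf (oneWeight X))
      (AY : WLinf (oneWeight X) →L[ℝ] WLinf (expWeightOff y₁ lam cYm cYp))
      (BX : WL1 (kWeight lam 4 cYm cYp) →L[ℝ] WLinf (oneWeight X))
      (BY : WL1 (growthWeight cXm cXp) →L[ℝ] WLinf (expWeightOff y₁ lam cYm cYp)),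
      IsMarginalOps ρ r s AX AY BX BY := by
  set E := expWeight lam cYm cYp with hEdef
  have hE0 : ∀ y, 0 < E y := fun y => zero_lt_one.trans_le (hE y)
  have hρs : ∀ x y, 0 ≤ ρ x y * s y := fun x y => mul_nonneg (hρ.pos x y).le (hs y)
  have hρr : ∀ x y, 0 ≤ ρ x y * r x := fun x y => mul_nonneg (hρ.pos x y).le (hr x)
  have hle : ∀ x y, ρ x y * s y * E y ≤ M * (E y ^ 4 * s y) := fun x y => by
    calc ρ x y * s y * E y = ρ x y * (s y * E y) := by ring
      _ ≤ M * E y * (s y * E y) :=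
        mul_le_mul_of_nonneg_right (hρM x y) (mul_nonneg (hs y) (hE0 y).le)
      _ = M * (E y ^ 2 * s y) := by ring
      _ ≤ M * (E y ^ 4 * s y) := by
        refine mul_le_mul_of_nonneg_left (mul_le_mul_of_nonneg_right ?_ (hs y)) hM
        exact pow_le_pow_right₀ (hE y) (by norm_num)
  have hsumE : ∀ x, Summable fun y => ρ x y * s y * E y := fun x =>
    Summable.of_nonneg_of_le (fun y => mul_nonneg (hρs x y) (hE0 y).le) (hle x) (hES.mul_left M)
  have hsub : ∀ {F : Y → ℝ}, Summable F → Summable fun y : {y : Y // y ≠ y₁} => F y :=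
    fun hF => (hasSum_subtype_ne hF.hasSum y₁).summable
  obtain ⟨AX, hAX, -⟩ := WLinf.exists_kernel_clm (w := expWeightOff y₁ lam cYm cYp)
    (v := oneWeight X) (fun x y => ρ x y.1 * s y.1) (fun x y => hρs x y.1)
    (M := M * ∑' y, E y ^ 4 * s y)
    (mul_nonneg hM (tsum_nonneg fun y => mul_nonneg (pow_pos (hE0 y) 4).le (hs y)))
    (fun x => hsub (hsumE x)) (fun x => by
      have h1 := (hasSum_subtype_ne (hsumE x).hasSum y₁).tsum_eq
      have h2 := (hsumE x).tsum_le_tsum (hle x) (hES.mul_left M)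
      rw [tsum_mul_left] at h2
      have h3 := mul_nonneg (hρs x y₁) (hE0 y₁).le
      refine h1.trans_le ?_
      simp only [oneWeight, mul_one]
      linarith)
  obtain ⟨AY, hAY, -⟩ := WLinf.exists_kernel_clm (w := oneWeight X)
    (v := expWeightOff y₁ lam cYm cYp) (fun y x => ρ x y.1 * r x) (fun y x => hρr x y.1)
    (M := 1) zero_le_one
    (fun y => by simpa [oneWeight] using (hρ.right y.1).summable) (fun y => by
      simp only [oneWeight, mul_one, one_mul]
      rw [(hρ.right y.1).tsum_eq]
      exact hE y.1)
  obtain ⟨BX, hBX⟩ := WL1.exists_kernel_clm (w := kWeight lam 4 cYm cYp) (v := oneWeight X)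
    (fun x y => ρ x y) (fun x y => (hρ.pos x y).le) hM (fun x y => by
      refine (hρM x y).trans ?_
      simp only [oneWeight, mul_one]
      refine mul_le_mul_of_nonneg_left ?_ hM
      calc E y ≤ E y ^ 4 := le_self_pow₀ (hE y) (by norm_num)
        _ ≤ growthWeight cYm cYp y * E y ^ 4 :=
          le_mul_of_one_le_left (pow_pos (hE0 y) 4).le (one_le_growthWeight _ _ y))
  obtain ⟨BY, hBY⟩ := WL1.exists_kernel_clm (w := growthWeight cXm cXp)
    (v := expWeightOff y₁ lam cYm cYp)
    (fun y x => ρ x y.1) (fun y x => (hρ.pos x y.1).le) hM (fun y x => by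
      refine (hρM x y.1).trans ?_
      exact le_mul_of_one_le_right (mul_nonneg hM (hE0 y.1).le) (one_le_growthWeight _ _ x))
  refine ⟨AX, AY, BX, BY, hAX, hAY, hBX, hBY, ?_⟩
  -- the averages over `x` have mass `1`, those over `y ≠ y₁` have mass at most `1 - δ`
  have hAYle : ∀ a y, |AY a y| ≤ ‖a‖ := fun a y => by
    have h1 := abs_tsum_mul_le (m := fun x => ρ x y.1 * r x) (b := a) (w := oneWeight X)
      (M := 1) (fun x => hρr x y.1) (WLinf.abs_apply_le a) (norm_nonneg a)
      (by simpa [oneWeight] using (hρ.right y.1).summable)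
      (by simpa [oneWeight] using (hρ.right y.1).tsum_eq.le)
    rw [(hAY a y).tsum_eq, mul_one] at h1
    exact h1.2
  have hcomp : ∀ a x, |(AX ∘L AY) a x| ≤ ‖a‖ * (1 - ρ x y₁ * s y₁) := fun a x => by
    have hh := hasSum_subtype_ne (hρ.left x) y₁
    have h1 := abs_tsum_mul_le (m := fun y : {y : Y // y ≠ y₁} => ρ x y.1 * s y.1) (b := AY a)
      (w := fun _ => 1) (M := 1 - ρ x y₁ * s y₁) (fun y => hρs x y.1)
      (fun y => by simpa using hAYle a y) (norm_nonneg a)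
      (by simpa using hh.summable) (by simpa using hh.tsum_eq.le)
    rw [(hAX (AY a) x).tsum_eq] at h1
    exact h1.2
  have hmax : ‖AX ∘L AY‖ ≤ max 0 (1 - δ) := by
    refine ContinuousLinearMap.opNorm_le_bound _ (le_max_left _ _) fun a => ?_
    refine WLinf.norm_le (mul_nonneg (le_max_left _ _) (norm_nonneg a)) fun x => ?_
    refine (hcomp a x).trans ?_
    simp only [oneWeight, mul_one]
    rw [mul_comm]
    exact mul_le_mul_of_nonneg_right
      (le_max_of_le_right (by linarith [hρδ x])) (norm_nonneg a)
  exact hmax.trans_lt (max_lt one_pos (by linarith))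

namespace IsMarginalOps

variable {AX : WLinf (expWeightOff y₁ lam cYm cYp) →L[ℝ] WLinf (oneWeight X)}
  {AY : WLinf (oneWeight X) →L[ℝ] WLinf (expWeightOff y₁ lam cYm cYp)}
  {BX : WL1 (kWeight lam 4 cYm cYp) →L[ℝ] WLinf (oneWeight X)}
  {BY : WL1 (growthWeight cXm cXp) →L[ℝ] WLinf (expWeightOff y₁ lam cYm cYp)}

theorem AX_extendAt (h : IsMarginalOps ρ r s AX AY BX BY)
    (b : WLinf (expWeightOff y₁ lam cYm cYp)) (x : X) :
    HasSum (fun y => ρ x y * s y * extendAt y₁ 0 b y) (AX b x) :=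
  (hasSum_mul_extendAt _ _).2 (h.AX_apply b x)

theorem inverse_apply (h : IsMarginalOps ρ r s AX AY BX BY) (a : WLinf (oneWeight X)) :
    Ring.inverse (1 - AX ∘L AY) (a - AX (AY a)) = a ∧
      Ring.inverse (1 - AX ∘L AY) a - AX (AY (Ring.inverse (1 - AX ∘L AY) a)) = a := by
  obtain ⟨hu, -⟩ := neumann_of_norm_comp_lt_one AX AY h.norm_lt
  exact ⟨congrArg (fun S : WLinf (oneWeight X) →L[ℝ] WLinf (oneWeight X) => S a)
      (Ring.inverse_mul_cancel _ hu),
    congrArg (fun S : WLinf (oneWeight X) →L[ℝ] WLinf (oneWeight X) => S a)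
      (Ring.mul_inverse_cancel _ hu)⟩

end IsMarginalOps

/-- The first-order change of `u`. -/
noncomputable def derivU (AX : WLinf (expWeightOff y₁ lam cYm cYp) →L[ℝ] WLinf (oneWeight X))
    (AY : WLinf (oneWeight X) →L[ℝ] WLinf (expWeightOff y₁ lam cYm cYp))
    (BX : WL1 (kWeight lam 4 cYm cYp) →L[ℝ] WLinf (oneWeight X))
    (BY : WL1 (growthWeight cXm cXp) →L[ℝ] WLinf (expWeightOff y₁ lam cYm cYp)) :
    (WL1 (growthWeight cXm cXp) × WL1 (kWeight lam 4 cYm cYp)) →L[ℝ] WLinf (oneWeight X) :=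
  Ring.inverse (1 - AX ∘L AY) ∘L
    (AX ∘L BY ∘L ContinuousLinearMap.fst ℝ _ _ - BX ∘L ContinuousLinearMap.snd ℝ _ _)

/-- The first-order change of `v`, off `y₁`. -/
noncomputable def derivV (AX : WLinf (expWeightOff y₁ lam cYm cYp) →L[ℝ] WLinf (oneWeight X))
    (AY : WLinf (oneWeight X) →L[ℝ] WLinf (expWeightOff y₁ lam cYm cYp))
    (BX : WL1 (kWeight lam 4 cYm cYp) →L[ℝ] WLinf (oneWeight X))
    (BY : WL1 (growthWeight cXm cXp) →L[ℝ] WLinf (expWeightOff y₁ lam cYm cYp)) :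
    (WL1 (growthWeight cXm cXp) × WL1 (kWeight lam 4 cYm cYp)) →L[ℝ]
      WLinf (expWeightOff y₁ lam cYm cYp) :=
  -(AY ∘L derivU AX AY BX BY) - BY ∘L ContinuousLinearMap.fst ℝ _ _

variable {AX : WLinf (expWeightOff y₁ lam cYm cYp) →L[ℝ] WLinf (oneWeight X)}
  {AY : WLinf (oneWeight X) →L[ℝ] WLinf (expWeightOff y₁ lam cYm cYp)}
  {BX : WL1 (kWeight lam 4 cYm cYp) →L[ℝ] WLinf (oneWeight X)}
  {BY : WL1 (growthWeight cXm cXp) →L[ℝ] WLinf (expWeightOff y₁ lam cYm cYp)}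

theorem derivU_apply (h : WL1 (growthWeight cXm cXp) × WL1 (kWeight lam 4 cYm cYp)) :
    derivU AX AY BX BY h = Ring.inverse (1 - AX ∘L AY) (AX (BY h.1) - BX h.2) := rfl

theorem derivV_apply (h : WL1 (growthWeight cXm cXp) × WL1 (kWeight lam 4 cYm cYp)) :
    derivV AX AY BX BY h = -AY (derivU AX AY BX BY h) - BY h.1 := rfl

/-- The block form of the solution of the linearized system, with the sign of the potentials. -/
theorem neg_deriv_eq_block (hops : IsMarginalOps ρ r s AX AY BX BY)
    (h : WL1 (growthWeight cXm cXp) × WL1 (kWeight lam 4 cYm cYp)) :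
    Ring.inverse (1 - AX ∘L AY) (BX h.2) - Ring.inverse (1 - AX ∘L AY) (AX (BY h.1)) =
        -derivU AX AY BX BY h ∧
      -AY (Ring.inverse (1 - AX ∘L AY) (BX h.2)) + Ring.inverse (1 - AY ∘L AX) (BY h.1) =
        -derivV AX AY BX BY h := by
  obtain ⟨-, -, -, -, hR⟩ := neumann_of_norm_comp_lt_one AX AY hops.norm_lt
  constructor
  · rw [derivU_apply, map_sub]; abel
  · rw [derivV_apply, derivU_apply, hR, map_sub, map_sub]
    change _ + (BY h.1 + AY (Ring.inverse (1 - AX ∘L AY) (AX (BY h.1)))) = _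
    abel

/-- The directions solve the linearized marginal equations. -/
theorem deriv_system (hops : IsMarginalOps ρ r s AX AY BX BY)
    (h : WL1 (growthWeight cXm cXp) × WL1 (kWeight lam 4 cYm cYp)) :
    derivU AX AY BX BY h + AX (derivV AX AY BX BY h) = -BX h.2 ∧
      AY (derivU AX AY BX BY h) + derivV AX AY BX BY h = -BY h.1 := by
  have h1 := (hops.inverse_apply (AX (BY h.1) - BX h.2)).2
  rw [← derivU_apply] at h1
  constructor
  · rw [derivV_apply, map_sub, map_neg]
    have h2 := congrArg (fun t => t - AX (BY h.1)) h1
    rw [sub_sub_cancel_left] at h2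
    rw [← h2]; abel
  · rw [derivV_apply]; abel

/-- Uniqueness for the linearized marginal equations. -/
theorem deriv_system_unique (hops : IsMarginalOps ρ r s AX AY BX BY)
    (h : WL1 (growthWeight cXm cXp) × WL1 (kWeight lam 4 cYm cYp)) {a : WLinf (oneWeight X)}
    {b : WLinf (expWeightOff y₁ lam cYm cYp)} (h1 : a + AX b = -BX h.2) (h2 : AY a + b = -BY h.1) :
    a = derivU AX AY BX BY h ∧ b = derivV AX AY BX BY h := by
  have hb : b = -AY a - BY h.1 := by rw [← sub_eq_zero] at h2 ⊢; rw [← h2]; abel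
  have ha : a = derivU AX AY BX BY h := by
    rw [derivU_apply, ← (hops.inverse_apply a).1]
    congr 1
    rw [hb, map_sub, map_neg] at h1
    rw [← sub_eq_zero] at h1 ⊢
    rw [← h1]; abel
  exact ⟨ha, by rw [hb, ha, derivV_apply]⟩

end Ops

/-! ### Second-order expansion of the plan -/

namespace Perturbation

variable {lam : ℝ} {cXm cXp : X → ℝ} {cYm cYp : Y → ℝ} {y₁ : Y} {ρ : X → Y → ℝ}
  {M δ S : ℝ} {r r' : X → ℝ} {s s' : Y → ℝ} {u : X → ℝ} {v : Y → ℝ} {η : ℝ}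
  {AX : WLinf (expWeightOff y₁ lam cYm cYp) →L[ℝ] WLinf (oneWeight X)}
  {AY : WLinf (oneWeight X) →L[ℝ] WLinf (expWeightOff y₁ lam cYm cYp)}
  {BX : WL1 (kWeight lam 4 cYm cYp) →L[ℝ] WLinf (oneWeight X)}
  {BY : WL1 (growthWeight cXm cXp) →L[ℝ] WLinf (expWeightOff y₁ lam cYm cYp)}

/-- The factors `u`, `v` agree to second order with `1 + derivU`, `1 + derivV`. -/
theorem exists_factor_expansion (hops : IsMarginalOps ρ r s AX AY BX BY) (M δ S : ℝ)
    (hM : 0 ≤ M) (hS : 0 ≤ S) (hδ : 0 < δ) :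
    ∃ C, 0 ≤ C ∧ ∀ (r' : X → ℝ) (s' : Y → ℝ) (u : X → ℝ) (v : Y → ℝ) (η : ℝ)
      (d : WL1 (growthWeight cXm cXp) × WL1 (kWeight lam 4 cYm cYp)),
      Perturbation ρ (expWeight lam cYm cYp) y₁ M δ S r s r' s' u v η →
      (∀ x, d.1 x = r' x - r x) → (∀ y, d.2 y = s' y - s y) →
      (∀ x, |u x - 1 - derivU AX AY BX BY d x| ≤ C * η ^ 2) ∧
      ∀ y, |v y - 1 - extendAt y₁ 0 (derivV AX AY BX BY d) y| ≤
        C * η ^ 2 * expWeight lam cYm cYp y ^ 3 := by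
  set E := expWeight lam cYm cYp
  have hU : 0 ≤ lipU M δ S := by unfold lipU; positivity
  have hV : 0 ≤ lipV M δ S := by unfold lipV; positivity
  set R := Ring.inverse (1 - AX ∘L AY) with hRdef
  set C₁ := M * lipV M δ S ^ 2 + M ^ 2 * lipU M δ S with hC₁
  set C₂ := ‖R‖ * (M * lipU M δ S ^ 2 + M ^ 2 * lipV M δ S + C₁ * (M * S)) with hC₂
  have hC₁0 : 0 ≤ C₁ := by positivity
  have hC₂0 : 0 ≤ C₂ := by positivity
  refine ⟨C₁ + C₂, by positivity, fun r' s' u v η d h hd1 hd2 => ?_⟩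
  have hη := h.eta_nonneg
  have hE := h.one_le_E
  have hE0 := h.E_pos
  let du : WLinf (oneWeight X) := WLinf.ofBound (fun x => u x - 1) (M * lipU M δ S * η)
    fun x => by simpa [oneWeight] using h.abs_u_sub_one_le x
  let dv : WLinf (expWeightOff y₁ lam cYm cYp) := WLinf.ofBound (fun y => v y.1 - 1) (M + 1)
    fun y => by
      have h1 := h.v_pos y.1
      have h2 := h.v_le y.1
      have h3 := hE y.1
      change |v y.1 - 1| ≤ (M + 1) * E y.1
      rw [abs_le]
      constructor
      · nlinarith [mul_nonneg hM (hE0 y.1).le]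
      · nlinarith
  -- the second equation, to second order
  let e : WLinf (expWeightOff y₁ lam cYm cYp) := dv + AY du + BY d.1
  have hAYdu : ∀ y : {y : Y // y ≠ y₁}, AY du y = ∑' x, ρ x y.1 * r x * (u x - 1) := fun y =>
    (hops.AY_apply du y).tsum_eq.symm
  have hBYd : ∀ y : {y : Y // y ≠ y₁}, BY d.1 y = ∑' x, ρ x y.1 * (r' x - r x) := fun y => by
    rw [← (hops.BY_apply d.1 y).tsum_eq]
    exact tsum_congr fun x => by rw [hd1]
  have he : ∀ y : {y : Y // y ≠ y₁}, |e y| ≤ C₁ * η ^ 2 * E y.1 ^ 3 := fun y => by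
    have h1 := h.abs_v_add_inv_le y.1
    have h2 := h.inv_v_sub_one y.1
    rw [← hAYdu y, ← hBYd y] at h2
    have h3 : M ^ 2 * lipU M δ S * E y.1 * η ^ 2 ≤ M ^ 2 * lipU M δ S * η ^ 2 * E y.1 ^ 3 := by
      have : E y.1 ≤ E y.1 ^ 3 := le_self_pow₀ (hE y.1) (by norm_num)
      calc _ = M ^ 2 * lipU M δ S * η ^ 2 * E y.1 := by ring
        _ ≤ _ := mul_le_mul_of_nonneg_left this (by positivity)
    have h4 : e y = ((v y.1 - 1) + ((v y.1)⁻¹ - 1)) - ((v y.1)⁻¹ - 1 - AY du y - BY d.1 y) := by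
      change v y.1 - 1 + AY du y + BY d.1 y = _
      ring
    rw [h4]
    calc _ ≤ _ := abs_sub _ _
      _ ≤ M * lipV M δ S ^ 2 * η ^ 2 * E y.1 ^ 3 + M ^ 2 * lipU M δ S * η ^ 2 * E y.1 ^ 3 :=
        add_le_add h1 (h2.trans h3)
      _ = _ := by rw [hC₁]; ring
  have hAXe : ∀ x, |AX e x| ≤ C₁ * η ^ 2 * (M * S) := fun x => by
    have h1 := (h.sum_rho_s (b := extendAt y₁ 0 e) (C := C₁ * η ^ 2) (by positivity) (fun y => by
      by_cases hy : y = y₁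
      · subst hy
        rw [extendAt_self, abs_zero]
        have := hE0 y
        positivity
      · rw [extendAt_of_ne _ hy]; exact he ⟨y, hy⟩) x).2
    rwa [(hops.AX_extendAt e x).tsum_eq] at h1
  have hAXdv : ∀ x, AX dv x = ∑' y, ρ x y * s y * (v y - 1) := fun x => by
    rw [← (hops.AX_extendAt dv x).tsum_eq]
    refine tsum_congr fun y => ?_
    by_cases hy : y = y₁
    · subst hy; rw [extendAt_self, h.v_one, sub_self]
    · rw [extendAt_of_ne _ hy]; rfl
  have hBXd : ∀ x, BX d.2 x = ∑' y, ρ x y * (s' y - s y) := fun x => by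
    rw [← (hops.BX_apply d.2 x).tsum_eq]
    exact tsum_congr fun y => by rw [hd2]
  -- the first equation, to second order
  let q : WLinf (oneWeight X) := (du - AX (AY du)) - (AX (BY d.1) - BX d.2)
  have hq : ‖q‖ ≤ (M * lipU M δ S ^ 2 + M ^ 2 * lipV M δ S + C₁ * (M * S)) * η ^ 2 := by
    refine WLinf.norm_le (by positivity) fun x => ?_
    have h1 := h.abs_u_add_inv_le x
    have h2 := h.inv_u_sub_one x
    rw [← hAXdv x, ← hBXd x] at h2
    have h3 : q x = ((u x - 1) + ((u x)⁻¹ - 1)) - ((u x)⁻¹ - 1 - AX dv x - BX d.2 x) - AX e x := by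
      simp only [e, map_add, WLinf.add_apply, q, WLinf.sub_apply]
      change u x - 1 - AX (AY du) x - (AX (BY d.1) x - BX d.2 x) = _
      ring
    rw [h3]
    simp only [oneWeight, mul_one]
    calc _ ≤ _ := (abs_sub _ _).trans (add_le_add (abs_sub _ _) le_rfl)
      _ ≤ _ := add_le_add (add_le_add h1 h2) (hAXe x)
      _ = _ := by ring
  have hdu : ‖du - derivU AX AY BX BY d‖ ≤ C₂ * η ^ 2 := by
    have h1 : du - derivU AX AY BX BY d = R q := by
      simp only [q]
      rw [map_sub R, (hops.inverse_apply du).1, derivU_apply]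
    rw [h1]
    calc _ ≤ ‖R‖ * ‖q‖ := R.le_opNorm q
      _ ≤ ‖R‖ * ((M * lipU M δ S ^ 2 + M ^ 2 * lipV M δ S + C₁ * (M * S)) * η ^ 2) :=
        mul_le_mul_of_nonneg_left hq (norm_nonneg _)
      _ = _ := by rw [hC₂]; ring
  have hdu' : ∀ x, |u x - 1 - derivU AX AY BX BY d x| ≤ C₂ * η ^ 2 := fun x => by
    have := (WLinf.abs_apply_le (du - derivU AX AY BX BY d) x)
    simp only [oneWeight, mul_one] at this
    exact this.trans hdu
  refine ⟨fun x => (hdu' x).trans ?_, fun y => ?_⟩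
  · exact mul_le_mul_of_nonneg_right (by linarith) (by positivity)
  · by_cases hy : y = y₁
    · subst hy
      rw [extendAt_self, h.v_one]
      have := hE0 y
      simp only [sub_self, abs_zero]
      positivity
    · rw [extendAt_of_ne _ hy]
      have h1 := h.sum_rho_r (b := fun x => u x - 1 - derivU AX AY BX BY d x) (by positivity)
        hdu' y
      have h2 : AY (du - derivU AX AY BX BY d) ⟨y, hy⟩ =
          ∑' x, ρ x y * r x * (u x - 1 - derivU AX AY BX BY d x) :=
        (hops.AY_apply (du - derivU AX AY BX BY d) ⟨y, hy⟩).tsum_eq.symm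
      have h3 : v y - 1 - derivV AX AY BX BY d ⟨y, hy⟩ =
          e ⟨y, hy⟩ - AY (du - derivU AX AY BX BY d) ⟨y, hy⟩ := by
        rw [derivV_apply, map_sub]
        simp only [e, WLinf.add_apply, WLinf.sub_apply, WLinf.neg_apply]
        change _ = v y - 1 + _ + _ - _
        ring
      rw [h3, h2]
      calc _ ≤ _ := abs_sub _ _
        _ ≤ C₁ * η ^ 2 * E y ^ 3 + C₂ * η ^ 2 * 1 := by
          rw [mul_one]; exact add_le_add (he ⟨y, hy⟩) h1.2
        _ ≤ C₁ * η ^ 2 * E y ^ 3 + C₂ * η ^ 2 * E y ^ 3 := by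
          have := one_le_pow₀ (hE y) (n := 3)
          gcongr
        _ = _ := by ring

/-- The density `ρ u v` with respect to `r' ⊗ s'`, expanded to second order. -/
theorem exists_plan_expansion (hops : IsMarginalOps ρ r s AX AY BX BY) (M δ S : ℝ)
    (hM : 0 ≤ M) (hS : 0 ≤ S) (hδ : 0 < δ) :
    ∃ C, 0 ≤ C ∧ ∀ (r' : X → ℝ) (s' : Y → ℝ) (u : X → ℝ) (v : Y → ℝ) (η : ℝ)
      (d : WL1 (growthWeight cXm cXp) × WL1 (kWeight lam 4 cYm cYp)),
      Perturbation ρ (expWeight lam cYm cYp) y₁ M δ S r s r' s' u v η →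
      (∀ x, d.1 x = r' x - r x) → (∀ y, d.2 y = s' y - s y) → ∀ x y,
      |ρ x y * (u x * v y) * (r' x * s' y) - ρ x y * (r x * s y) -
        (ρ x y * (r x * d.2 y + d.1 x * s y) + ρ x y * (r x * s y) *
          (derivU AX AY BX BY d x + extendAt y₁ 0 (derivV AX AY BX BY d) y))| ≤
      expWeight lam cYm cYp y ^ 4 * (C * η ^ 2 * (|r x| * |s y|) + C * η * (|r x| * |d.2 y|) +
        C * η * (|d.1 x| * |s y|) + C * (η + 1) * (|d.1 x| * |d.2 y|)) := by
  obtain ⟨C₀, hC₀, hexp⟩ := exists_factor_expansion hops M δ S hM hS hδ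
  set E := expWeight lam cYm cYp
  have hU : 0 ≤ lipU M δ S := by unfold lipU; positivity
  have hV : 0 ≤ lipV M δ S := by unfold lipV; positivity
  set C₁ := 2 * C₀ + M * lipU M δ S * (M * lipV M δ S) with hC₁
  set C₂ := M * lipU M δ S * M + M * lipV M δ S with hC₂
  have hC₁0 : 0 ≤ C₁ := by positivity
  have hC₂0 : 0 ≤ C₂ := by positivity
  refine ⟨M * (C₁ + C₂ + 1), by positivity, fun r' s' u v η d h hd1 hd2 x y => ?_⟩
  obtain ⟨hu, hv⟩ := hexp r' s' u v η d h hd1 hd2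
  have hη := h.eta_nonneg
  have hE := h.one_le_E y
  have hE0 := h.E_pos y
  have hu1 := h.abs_u_sub_one_le x
  have hv1 := h.abs_v_sub_one_le y
  have hux := hu x
  have hvy := hv y
  have hv0 := h.v_pos y
  have hρ0 := h.dens.pos x y
  have hρE := h.rho_le x y
  have hr0 := h.prob_left x
  have hs0 := h.prob_right y
  set a := derivU AX AY BX BY d x
  set b := extendAt y₁ 0 (derivV AX AY BX BY d) y
  have e1 : |u x * v y - 1 - a - b| ≤ C₁ * η ^ 2 * E y ^ 3 := by
    have h1 : u x * v y - 1 - a - b = (u x - 1 - a) + (v y - 1 - b) + (u x - 1) * (v y - 1) := by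
      ring
    have hE3 : 1 ≤ E y ^ 3 := one_le_pow₀ hE
    have hE23 : E y ^ 2 ≤ E y ^ 3 := pow_le_pow_right₀ hE (by norm_num)
    rw [h1]
    calc _ ≤ |u x - 1 - a| + |v y - 1 - b| + |(u x - 1) * (v y - 1)| :=
          (abs_add_le _ _).trans (add_le_add (abs_add_le _ _) le_rfl)
      _ ≤ C₀ * η ^ 2 * 1 + C₀ * η ^ 2 * E y ^ 3 +
          (M * lipU M δ S * η) * (M * lipV M δ S * η * E y ^ 2) := by
          rw [abs_mul, mul_one]
          gcongr
      _ ≤ C₀ * η ^ 2 * E y ^ 3 + C₀ * η ^ 2 * E y ^ 3 +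
          (M * lipU M δ S * η) * (M * lipV M δ S * η * E y ^ 3) := by gcongr
      _ = _ := by rw [hC₁]; ring
  have e2 : |u x * v y - 1| ≤ C₂ * η * E y ^ 2 := by
    have h1 : u x * v y - 1 = (u x - 1) * v y + (v y - 1) := by ring
    have hE12 : E y ≤ E y ^ 2 := le_self_pow₀ hE (by norm_num)
    rw [h1]
    calc _ ≤ |u x - 1| * |v y| + |v y - 1| := by rw [← abs_mul]; exact abs_add_le _ _
      _ ≤ M * lipU M δ S * η * (M * E y ^ 2) + M * lipV M δ S * η * E y ^ 2 := by
          rw [abs_of_pos hv0]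
          have := (h.v_le y).trans (mul_le_mul_of_nonneg_left hE12 hM)
          gcongr
      _ = _ := by rw [hC₂]; ring
  have hr' : r' x = r x + d.1 x := by rw [hd1]; ring
  have hs' : s' y = s y + d.2 y := by rw [hd2]; ring
  have hdec : ρ x y * (u x * v y) * (r' x * s' y) - ρ x y * (r x * s y) -
        (ρ x y * (r x * d.2 y + d.1 x * s y) + ρ x y * (r x * s y) * (a + b)) =
      ρ x y * ((u x * v y - 1 - a - b) * (r x * s y) + (u x * v y - 1) * (r x * d.2 y) +
        (u x * v y - 1) * (d.1 x * s y) + (u x * v y - 1 + 1) * (d.1 x * d.2 y)) := by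
    rw [hr', hs']; ring
  have e3 : |u x * v y - 1 + 1| ≤ C₂ * η * E y ^ 2 + 1 :=
    (abs_add_le _ _).trans (by rw [abs_one]; linarith)
  have hE3 : 1 ≤ E y ^ 3 := one_le_pow₀ hE
  have hE23 : E y ^ 2 ≤ E y ^ 3 := pow_le_pow_right₀ hE (by norm_num)
  have hinner : |(u x * v y - 1 - a - b) * (r x * s y) + (u x * v y - 1) * (r x * d.2 y) +
        (u x * v y - 1) * (d.1 x * s y) + (u x * v y - 1 + 1) * (d.1 x * d.2 y)| ≤
      (C₁ + C₂ + 1) * η ^ 2 * E y ^ 3 * (|r x| * |s y|) +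
      (C₁ + C₂ + 1) * η * E y ^ 3 * (|r x| * |d.2 y|) +
      (C₁ + C₂ + 1) * η * E y ^ 3 * (|d.1 x| * |s y|) +
      (C₁ + C₂ + 1) * (η + 1) * E y ^ 3 * (|d.1 x| * |d.2 y|) := by
    have k1 : C₁ * η ^ 2 * E y ^ 3 ≤ (C₁ + C₂ + 1) * η ^ 2 * E y ^ 3 := by
      gcongr; linarith
    have k2 : C₂ * η * E y ^ 2 ≤ (C₁ + C₂ + 1) * η * E y ^ 3 := by
      gcongr; linarith
    have k3 : C₂ * η * E y ^ 2 + 1 ≤ (C₁ + C₂ + 1) * (η + 1) * E y ^ 3 := by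
      calc C₂ * η * E y ^ 2 + 1 ≤ (C₁ + C₂ + 1) * η * E y ^ 3 + 1 * E y ^ 3 := by linarith
        _ ≤ (C₁ + C₂ + 1) * η * E y ^ 3 + (C₁ + C₂ + 1) * E y ^ 3 := by gcongr; linarith
        _ = _ := by ring
    refine (abs_add_le _ _).trans (add_le_add ((abs_add_le _ _).trans
      (add_le_add ((abs_add_le _ _).trans (add_le_add ?_ ?_)) ?_)) ?_)
    · rw [abs_mul, abs_mul (r x)]
      exact mul_le_mul_of_nonneg_right (e1.trans k1) (by positivity)
    · rw [abs_mul, abs_mul (r x)]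
      exact mul_le_mul_of_nonneg_right (e2.trans k2) (by positivity)
    · rw [abs_mul, abs_mul (d.1 x)]
      exact mul_le_mul_of_nonneg_right (e2.trans k2) (by positivity)
    · rw [abs_mul, abs_mul (d.1 x)]
      exact mul_le_mul_of_nonneg_right (e3.trans k3) (by positivity)
  rw [hdec, abs_mul, abs_of_pos hρ0]
  calc _ ≤ _ := mul_le_mul hρE hinner (abs_nonneg _) (by positivity)
    _ = _ := by ring

end Perturbation

end EROT

/-! ### The derivative as a bounded operator -/

namespace EROT

variable {ι X Y : Type*}

theorem WL1.exists_clm {G : Type*} [NormedAddCommGroup G] [NormedSpace ℝ G] {w : ι → ℝ}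
    [PosWeight w] (φ : G →ₗ[ℝ] (ι → ℝ)) (M : ℝ)
    (hφ : ∀ g, (Summable fun i => w i * |φ g i|) ∧ ∑' i, w i * |φ g i| ≤ M * ‖g‖) :
    ∃ T : G →L[ℝ] WL1 w, ∀ g i, T g i = φ g i := by
  let L : G →ₗ[ℝ] WL1 w :=
    { toFun := fun g => WL1.mk (φ g) (hφ g).1
      map_add' := fun a b => WL1.ext fun i => by simp
      map_smul' := fun t a => WL1.ext fun i => by simp }
  exact ⟨L.mkContinuous M fun g => (hφ g).2, fun g i => rfl⟩

/-- A quadratic estimate on `U₀` near `u` implies Hadamard differentiability tangentially to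
`U₀`. -/
theorem hasHadamardDerivTangentially_of_quadratic {U V : Type*} [NormedAddCommGroup U]
    [NormedSpace ℝ U] [NormedAddCommGroup V] [NormedSpace ℝ V] {Ψ : U → V} {D : U →L[ℝ] V}
    {U₀ : Set U} {u : U} {C : ℝ}
    (h : ∀ k ∈ U₀, ‖k - u‖ ≤ 1 → ‖Ψ k - Ψ u - D (k - u)‖ ≤ C * ‖k - u‖ ^ 2) :
    HasHadamardDerivTangentially Ψ D U₀ u := by
  intro k t d hk ht ht0 hd
  have heq : ∀ n, k n - u = t n • ((t n)⁻¹ • (k n - u)) := fun n => by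
    rw [smul_smul, mul_inv_cancel₀ (ht n).ne', one_smul]
  have hk0 : Tendsto (fun n => k n - u) atTop (𝓝 0) := by
    have := ht0.smul hd
    rw [zero_smul] at this
    exact this.congr fun n => (heq n).symm
  have hrem : Tendsto (fun n => (t n)⁻¹ • (Ψ (k n) - Ψ u - D (k n - u))) atTop (𝓝 0) := by
    have hlim : Tendsto (fun n => C * (‖(t n)⁻¹ • (k n - u)‖ * ‖k n - u‖)) atTop (𝓝 0) := by
      have := (hd.norm.mul hk0.norm).const_mul C
      simpa using this
    refine squeeze_zero_norm' ?_ hlim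
    have hev : ∀ᶠ n in atTop, ‖k n - u‖ < 1 := by
      have := hk0.norm
      rw [norm_zero] at this
      exact this.eventually_lt_const one_pos
    filter_upwards [hev] with n hn
    rw [norm_smul, norm_smul]
    calc ‖(t n)⁻¹‖ * ‖Ψ (k n) - Ψ u - D (k n - u)‖ ≤ ‖(t n)⁻¹‖ * (C * ‖k n - u‖ ^ 2) :=
          mul_le_mul_of_nonneg_left (h _ (hk n) hn.le) (norm_nonneg _)
      _ = _ := by ring
  have := hrem.add ((D.continuous.tendsto d).comp hd)
  rw [zero_add] at this
  refine this.congr fun n => ?_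
  simp only [Function.comp, map_smul]
  rw [← smul_add, sub_add_cancel]

section Product

variable {lam : ℝ} {cXm cXp : X → ℝ} {cYm cYp : Y → ℝ}

theorem hasSum_norm_mul_norm (a : WL1 (growthWeight cXm cXp)) (b : WL1 (kWeight lam 4 cYm cYp)) :
    HasSum (fun p : X × Y => growthWeight cXm cXp p.1 * |a p.1| *
      (kWeight lam 4 cYm cYp p.2 * |b p.2|)) (‖a‖ * ‖b‖) :=
  a.summable.hasSum.mul b.summable.hasSum
    (a.summable.mul_of_nonneg b.summable a.term_nonneg b.term_nonneg)

/-- The weight `C_X ⊕ C_Y` is at most `2 C_X ⊗ C_Y`, so entries bounded by `E ^ 4` times products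
have a finite norm. -/
theorem weighted_sum_le (k d : WL1 (growthWeight cXm cXp) × WL1 (kWeight lam 4 cYm cYp))
    {z : X × Y → ℝ} {A B C D : ℝ}
    (hz : ∀ p, |z p| ≤ expWeight lam cYm cYp p.2 ^ 4 *
      (A * (|k.1 p.1| * |k.2 p.2|) + B * (|k.1 p.1| * |d.2 p.2|) +
        C * (|d.1 p.1| * |k.2 p.2|) + D * (|d.1 p.1| * |d.2 p.2|))) :
    (Summable fun p => sumWeight (growthWeight cXm cXp) (growthWeight cYm cYp) p * |z p|) ∧
      ∑' p, sumWeight (growthWeight cXm cXp) (growthWeight cYm cYp) p * |z p| ≤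
        2 * (A * (‖k.1‖ * ‖k.2‖) + B * (‖k.1‖ * ‖d.2‖) + C * (‖d.1‖ * ‖k.2‖) +
          D * (‖d.1‖ * ‖d.2‖)) := by
  have hbig := (((((hasSum_norm_mul_norm k.1 k.2).mul_left A).add
    ((hasSum_norm_mul_norm k.1 d.2).mul_left B)).add
    ((hasSum_norm_mul_norm d.1 k.2).mul_left C)).add
    ((hasSum_norm_mul_norm d.1 d.2).mul_left D)).mul_left 2
  have hle : ∀ p : X × Y, sumWeight (growthWeight cXm cXp) (growthWeight cYm cYp) p * |z p| ≤
      2 * (A * (growthWeight cXm cXp p.1 * |k.1 p.1| * (kWeight lam 4 cYm cYp p.2 * |k.2 p.2|)) +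
        B * (growthWeight cXm cXp p.1 * |k.1 p.1| * (kWeight lam 4 cYm cYp p.2 * |d.2 p.2|)) +
        C * (growthWeight cXm cXp p.1 * |d.1 p.1| * (kWeight lam 4 cYm cYp p.2 * |k.2 p.2|)) +
        D * (growthWeight cXm cXp p.1 * |d.1 p.1| * (kWeight lam 4 cYm cYp p.2 * |d.2 p.2|))) :=
    fun p => by
      have h1 := one_le_growthWeight cXm cXp p.1
      have h2 := one_le_growthWeight cYm cYp p.2
      have hw : sumWeight (growthWeight cXm cXp) (growthWeight cYm cYp) p ≤
          2 * (growthWeight cXm cXp p.1 * growthWeight cYm cYp p.2) := by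
        simp only [sumWeight]
        nlinarith
      refine (mul_le_mul hw (hz p) (abs_nonneg _) (by positivity)).trans_eq ?_
      simp only [kWeight]
      ring
  have hs := Summable.of_nonneg_of_le
    (fun p => mul_nonneg (PosWeight.pos p).le (abs_nonneg _)) hle hbig.summable
  exact ⟨hs, hasSum_le hle hs.hasSum hbig⟩

theorem exists_plan_deriv {y₁ : Y} {ρ : X → Y → ℝ} {M : ℝ} (hM : 0 ≤ M)
    (hρ0 : ∀ x y, 0 < ρ x y) (hρM : ∀ x y, ρ x y ≤ M * expWeight lam cYm cYp y)
    (hE : ∀ y, 1 ≤ expWeight lam cYm cYp y)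
    (k : WL1 (growthWeight cXm cXp) × WL1 (kWeight lam 4 cYm cYp))
    (LA : (WL1 (growthWeight cXm cXp) × WL1 (kWeight lam 4 cYm cYp)) →L[ℝ] WLinf (oneWeight X))
    (LB : (WL1 (growthWeight cXm cXp) × WL1 (kWeight lam 4 cYm cYp)) →L[ℝ]
      WLinf (expWeightOff y₁ lam cYm cYp)) :
    ∃ D : (WL1 (growthWeight cXm cXp) × WL1 (kWeight lam 4 cYm cYp)) →L[ℝ]
        WL1 (sumWeight (growthWeight cXm cXp) (growthWeight cYm cYp)),
      ∀ h p, D h p = ρ p.1 p.2 * (k.1 p.1 * h.2 p.2 + h.1 p.1 * k.2 p.2) +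
        ρ p.1 p.2 * (k.1 p.1 * k.2 p.2) * (LA h p.1 + extendAt y₁ 0 (LB h) p.2) := by
  set E := expWeight lam cYm cYp
  let φ : (WL1 (growthWeight cXm cXp) × WL1 (kWeight lam 4 cYm cYp)) →ₗ[ℝ] (X × Y → ℝ) :=
    { toFun := fun h p => ρ p.1 p.2 * (k.1 p.1 * h.2 p.2 + h.1 p.1 * k.2 p.2) +
        ρ p.1 p.2 * (k.1 p.1 * k.2 p.2) * (LA h p.1 + extendAt y₁ 0 (LB h) p.2)
      map_add' := fun a b => funext fun p => by
        by_cases hy : p.2 = y₁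
        · simp only [map_add, hy, extendAt_self, Prod.fst_add, Prod.snd_add, WL1.add_apply,
            WLinf.add_apply, Pi.add_apply]
          ring
        · simp only [map_add, extendAt_of_ne _ hy, Prod.fst_add, Prod.snd_add, WL1.add_apply,
            WLinf.add_apply, Pi.add_apply]
          ring
      map_smul' := fun t a => funext fun p => by
        by_cases hy : p.2 = y₁
        · simp only [map_smul, hy, extendAt_self, Prod.smul_fst, Prod.smul_snd, WL1.smul_apply,
            WLinf.smul_apply, Pi.smul_apply, RingHom.id_apply, smul_eq_mul]
          ring
        · simp only [map_smul, extendAt_of_ne _ hy, Prod.smul_fst, Prod.smul_snd, WL1.smul_apply,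
            WLinf.smul_apply, Pi.smul_apply, RingHom.id_apply, smul_eq_mul]
          ring }
  refine WL1.exists_clm φ (2 * (M * (‖LA‖ + ‖LB‖) * (‖k.1‖ * ‖k.2‖) + M * ‖k.1‖ + M * ‖k.2‖))
    fun h => ?_
  have hh1 : ‖h.1‖ ≤ ‖h‖ := norm_fst_le h
  have hh2 : ‖h.2‖ ≤ ‖h‖ := norm_snd_le h
  have hbound := weighted_sum_le k h (z := φ h) (A := M * (‖LA‖ + ‖LB‖) * ‖h‖) (B := M) (C := M)
    (D := 0) fun p => by
      have hEp := hE p.2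
      have hE0 : 0 < E p.2 := zero_lt_one.trans_le hEp
      have hE4 : E p.2 ^ 2 ≤ E p.2 ^ 4 := pow_le_pow_right₀ hEp (by norm_num)
      have hE14 : E p.2 ≤ E p.2 ^ 4 := le_self_pow₀ hEp (by norm_num)
      have hρp := hρM p.1 p.2
      have hρ0' := hρ0 p.1 p.2
      have ha : |LA h p.1| ≤ ‖LA‖ * ‖h‖ := by
        have h1 := WLinf.abs_apply_le (LA h) p.1
        simp only [oneWeight, mul_one] at h1
        exact h1.trans (LA.le_opNorm h)
      have hb : |extendAt y₁ 0 (LB h) p.2| ≤ ‖LB‖ * ‖h‖ * E p.2 := by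
        by_cases hy : p.2 = y₁
        · have h0 : 0 ≤ ‖LB‖ * ‖h‖ * E p.2 := by positivity
          rw [hy] at h0 ⊢
          rwa [extendAt_self, abs_zero]
        · rw [extendAt_of_ne _ hy]
          exact (WLinf.abs_apply_le (LB h) ⟨p.2, hy⟩).trans
            (mul_le_mul_of_nonneg_right (LB.le_opNorm h) hE0.le)
      have hab : |LA h p.1 + extendAt y₁ 0 (LB h) p.2| ≤ (‖LA‖ + ‖LB‖) * ‖h‖ * E p.2 := by
        calc _ ≤ _ := abs_add_le _ _
          _ ≤ ‖LA‖ * ‖h‖ * E p.2 + ‖LB‖ * ‖h‖ * E p.2 :=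
            add_le_add (ha.trans (le_mul_of_one_le_right (by positivity) hEp)) hb
          _ = _ := by ring
      have t1 : |ρ p.1 p.2 * (k.1 p.1 * h.2 p.2 + h.1 p.1 * k.2 p.2)| ≤
          M * E p.2 ^ 4 * (|k.1 p.1| * |h.2 p.2| + |h.1 p.1| * |k.2 p.2|) := by
        rw [abs_mul, abs_of_pos hρ0', ← abs_mul, ← abs_mul]
        exact mul_le_mul (hρp.trans (mul_le_mul_of_nonneg_left hE14 hM)) (abs_add_le _ _)
          (abs_nonneg _) (by positivity)
      have t2 : |ρ p.1 p.2 * (k.1 p.1 * k.2 p.2) * (LA h p.1 + extendAt y₁ 0 (LB h) p.2)| ≤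
          M * E p.2 * (|k.1 p.1| * |k.2 p.2|) * ((‖LA‖ + ‖LB‖) * ‖h‖ * E p.2) := by
        rw [abs_mul, abs_mul, abs_of_pos hρ0', abs_mul]
        exact mul_le_mul (mul_le_mul_of_nonneg_right hρp (by positivity)) hab (abs_nonneg _)
          (by positivity)
      have t3 : M * E p.2 * (|k.1 p.1| * |k.2 p.2|) * ((‖LA‖ + ‖LB‖) * ‖h‖ * E p.2) ≤
          E p.2 ^ 4 * (M * (‖LA‖ + ‖LB‖) * ‖h‖ * (|k.1 p.1| * |k.2 p.2|)) := by
        calc _ = E p.2 ^ 2 * (M * (‖LA‖ + ‖LB‖) * ‖h‖ * (|k.1 p.1| * |k.2 p.2|)) := by ring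
          _ ≤ _ := mul_le_mul_of_nonneg_right hE4 (by positivity)
      calc _ ≤ _ := abs_add_le _ _
        _ ≤ _ := add_le_add t1 (t2.trans t3)
        _ = _ := by ring
  refine ⟨hbound.1, hbound.2.trans ?_⟩
  have h3 : ‖k.1‖ * ‖h.2‖ ≤ ‖k.1‖ * ‖h‖ := mul_le_mul_of_nonneg_left hh2 (norm_nonneg _)
  have h4 : ‖h.1‖ * ‖k.2‖ ≤ ‖h‖ * ‖k.2‖ := mul_le_mul_of_nonneg_right hh1 (norm_nonneg _)
  have h5 := mul_le_mul_of_nonneg_left h3 hM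
  have h6 := mul_le_mul_of_nonneg_left h4 hM
  linarith

end Product

/-! ### Scalings for a dominated cost -/

section Cost

variable {c : X → Y → ℝ} {cXm cXp : X → ℝ} {cYm cYp : Y → ℝ} {lam : ℝ}

/-- The Gibbs kernel of the cost reduced by its lower dominating functions. -/
noncomputable def reducedKernel (c : X → Y → ℝ) (lam : ℝ) (cXm : X → ℝ) (cYm : Y → ℝ) :
    X → Y → ℝ :=
  fun x y => Real.exp (-(c x y - cXm x - cYm y) / lam)

theorem kernelBounds_reducedKernel
    (hcY : ∀ y, cYm y ≤ cYp y)
    (hc : ∀ x y, cXm x + cYm y ≤ c x y ∧ c x y ≤ cXp x + cYp y) (hlam : 0 < lam) {B : ℝ}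
    (hB : ∀ x, cXp x - cXm x ≤ B) :
    KernelBounds (reducedKernel c lam cXm cYm) (expWeight lam cYm cYp) (Real.exp (-B / lam)) where
  kappa_pos := Real.exp_pos _
  one_le := one_le_expWeight hlam hcY
  lower x y := by
    simp only [expWeight, reducedKernel, ← Real.exp_sub, ← sub_div]
    refine Real.exp_le_exp.2 (div_le_div_of_nonneg_right ?_ hlam.le)
    linarith [(hc x y).2, hB x]
  upper x y := by
    refine Real.exp_le_one_iff.2 (div_nonpos_of_nonpos_of_nonneg ?_ hlam.le)
    linarith [(hc x y).1]

/-- Scalings normalized at `y₁`, with their a priori bounds. -/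
structure IsNormalizedScaling (k : X → Y → ℝ) (E : Y → ℝ) (κ S : ℝ) (y₁ : Y) (r : X → ℝ)
    (s : Y → ℝ) (f : X → ℝ) (g : Y → ℝ) : Prop extends IsScaling k r s f g where
  norm : g y₁ = 1
  le_left : ∀ x, κ / S ≤ f x
  left_le : ∀ x, f x ≤ S * E y₁ / κ ^ 2
  le_right : ∀ y, κ / E y₁ ≤ g y
  right_le : ∀ y, g y ≤ E y / κ

theorem KernelBounds.exists_isNormalizedScaling {k : X → Y → ℝ} {E : Y → ℝ} {κ S : ℝ}
    (h : KernelBounds k E κ) {r : X → ℝ} {s : Y → ℝ} (hr : IsProb r) (hs : IsProb s)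
    (hES : Summable fun y => E y * s y) (hS : ∑' y, E y * s y ≤ S) (y₁ : Y) :
    ∃ f g, IsNormalizedScaling k E κ S y₁ r s f g := by
  obtain ⟨f₀, g₀, h₀⟩ := h.exists_isScaling hr hs hES
  have hg := h₀.right_pos y₁
  have hsc : IsScaling k r s (fun x => f₀ x * g₀ y₁) (fun y => g₀ y / g₀ y₁) := by
    refine ⟨fun x => mul_pos (h₀.left_pos x) hg, fun y => div_pos (h₀.right_pos y) hg,
      fun x => (h₀.left x).congr_fun fun y => ?_, fun y => (h₀.right y).congr_fun fun x => ?_⟩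
    all_goals field_simp
  obtain ⟨F, hF0, b1, b2, b3, b4⟩ := hsc.exists_bounds h hr hs hES.hasSum
  have hκ := h.kappa_pos
  have hS1 := h.one_le_of_hasSum hs hES.hasSum
  set T := ∑' y, E y * s y
  have hT0 : 0 < T := zero_lt_one.trans_le hS1
  have hS0 : 0 < S := hT0.trans_le hS
  have hn : g₀ y₁ / g₀ y₁ = 1 := div_self hg.ne'
  have hF1 : 1 ≤ F := by
    have := b1 y₁
    rw [hn, div_le_one hF0] at this
    exact this
  have hF2 : F ≤ E y₁ / κ := by
    have := b2 y₁
    rw [hn, le_div_iff₀ (mul_pos hκ hF0), one_mul] at this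
    rw [le_div_iff₀ hκ]
    linarith
  refine ⟨_, _, hsc, hn, fun x => (b3 x).trans' ?_, fun x => (b4 x).trans ?_,
    fun y => (b1 y).trans' ?_, fun y => (b2 y).trans ?_⟩
  · calc κ / S ≤ κ / T := by gcongr
      _ ≤ κ * F / T := by gcongr; exact le_mul_of_one_le_right hκ.le hF1
  · calc T * F / κ ≤ S * (E y₁ / κ) / κ := by gcongr
      _ = S * E y₁ / κ ^ 2 := by field_simp
  · rw [div_le_div_iff₀ (h.E_pos y₁) hF0]
    rw [le_div_iff₀ hκ] at hF2
    linarith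
  · have := h.E_pos y
    gcongr
    exact le_mul_of_one_le_right hκ.le hF1

namespace IsNormalizedScaling

variable {k : X → Y → ℝ} {E : Y → ℝ} {κ S : ℝ} {y₁ : Y} {r r' : X → ℝ} {s s' : Y → ℝ}
  {f f' : X → ℝ} {g g' : Y → ℝ}

theorem isDensity (h : IsNormalizedScaling k E κ S y₁ r s f g) (hk : KernelBounds k E κ) :
    IsDensity (fun x y => f x * g y * k x y) r s :=
  ⟨fun x y => mul_pos (mul_pos (h.left_pos x) (h.right_pos y)) (hk.pos x y), h.left, h.right⟩

theorem density_le (h : IsNormalizedScaling k E κ S y₁ r s f g) (hk : KernelBounds k E κ)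
    (hS : 1 ≤ S) (x : X) (y : Y) :
    f x * g y * k x y ≤ (S ^ 2 * E y₁ / κ ^ 3 + E y₁ / κ ^ 2) * E y := by
  have hκ := hk.kappa_pos
  have hE := hk.E_pos y
  have hE1 := hk.E_pos y₁
  have hfg : f x * g y ≤ S * E y₁ / κ ^ 2 * (E y / κ) :=
    mul_le_mul (h.left_le x) (h.right_le y) (h.right_pos y).le (by positivity)
  calc f x * g y * k x y ≤ f x * g y :=
        mul_le_of_le_one_right (mul_pos (h.left_pos x) (h.right_pos y)).le (hk.upper x y)
    _ ≤ S * E y₁ / κ ^ 2 * (E y / κ) := hfg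
    _ = S * E y₁ / κ ^ 3 * E y := by field_simp
    _ ≤ (S ^ 2 * E y₁ / κ ^ 3 + E y₁ / κ ^ 2) * E y := by
      refine mul_le_mul_of_nonneg_right ?_ hE.le
      have h1 : S * E y₁ / κ ^ 3 ≤ S ^ 2 * E y₁ / κ ^ 3 := by
        gcongr
        exact le_self_pow₀ hS (by norm_num)
      have h2 : 0 ≤ E y₁ / κ ^ 2 := by positivity
      linarith

theorem le_density (h : IsNormalizedScaling k E κ S y₁ r s f g) (hk : KernelBounds k E κ)
    (hs : 0 ≤ s y₁) (hS : 1 ≤ S) (x : X) :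
    κ ^ 2 * s y₁ / (S * E y₁) ≤ f x * g y₁ * k x y₁ * s y₁ := by
  have hκ := hk.kappa_pos
  have hE1 := hk.E_pos y₁
  rw [h.norm, mul_one]
  calc κ ^ 2 * s y₁ / (S * E y₁) = κ / S * (κ / E y₁) * s y₁ := by field_simp
    _ ≤ f x * k x y₁ * s y₁ := by
      refine mul_le_mul_of_nonneg_right ?_ hs
      exact mul_le_mul (h.le_left x) (hk.lower x y₁) (by positivity) (h.left_pos x).le

/-- Two normalized scalings, for different marginals, are perturbations of each other. -/
theorem perturbation (h : IsNormalizedScaling k E κ S y₁ r s f g)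
    (h' : IsNormalizedScaling k E κ S y₁ r' s' f' g') (hk : KernelBounds k E κ) (hr : IsProb r)
    (hs : IsProb s) (hs1 : 0 < s y₁) (hS : 1 ≤ S) {η S₄ : ℝ} (hη : 0 ≤ η)
    (h4 : Summable fun y => E y ^ 4 * s y) (h4S : ∑' y, E y ^ 4 * s y ≤ S₄)
    (hdr : Summable fun x => |r' x - r x|) (hdrη : ∑' x, |r' x - r x| ≤ η)
    (hds : Summable fun y => E y ^ 4 * |s' y - s y|)
    (hdsη : ∑' y, E y ^ 4 * |s' y - s y| ≤ η) :
    Perturbation (fun x y => f x * g y * k x y) E y₁ (S ^ 2 * E y₁ / κ ^ 3 + E y₁ / κ ^ 2)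
      (κ ^ 2 * s y₁ / (S * E y₁)) S₄ r s r' s' (fun x => f' x / f x) (fun y => g' y / g y) η := by
  have hκ := hk.kappa_pos
  have hE1 := hk.E_pos y₁
  have hS0 : 0 < S := zero_lt_one.trans_le hS
  have hM2 : 0 ≤ E y₁ / κ ^ 2 := by positivity
  have hM1 : 0 ≤ S ^ 2 * E y₁ / κ ^ 3 := by positivity
  have hratio : ∀ {a b : X → ℝ}, (∀ x, κ / S ≤ a x) → (∀ x, b x ≤ S * E y₁ / κ ^ 2) →
      (∀ x, 0 < b x) → ∀ x, b x / a x ≤ S ^ 2 * E y₁ / κ ^ 3 + E y₁ / κ ^ 2 :=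
    fun {a b} ha hb hb0 x => by
      calc b x / a x ≤ (S * E y₁ / κ ^ 2) / (κ / S) := by
            have := ha x
            have := hb x
            have := (hb0 x).le
            gcongr
        _ = S ^ 2 * E y₁ / κ ^ 3 := by field_simp
        _ ≤ _ := by linarith
  exact
    { dens := h.isDensity hk
      prob_left := hr.1
      prob_right := hs.1
      dens' := by
        have := h'.isDensity hk
        convert this using 3 with x y
        have := (h.left_pos x).ne'
        have := (h.right_pos y).ne'
        field_simp
      one_le_E := hk.one_le
      rho_le := h.density_le hk hS
      delta_pos := by positivity
      delta_le := h.le_density hk hs1.le hS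
      u_pos := fun x => div_pos (h'.left_pos x) (h.left_pos x)
      u_le := hratio h.le_left h'.left_le h'.left_pos
      u_ge := fun x => by rw [inv_div]; exact hratio h'.le_left h.left_le h.left_pos x
      v_pos := fun y => div_pos (h'.right_pos y) (h.right_pos y)
      v_le := fun y => by
        have hE := hk.E_pos y
        calc g' y / g y ≤ (E y / κ) / (κ / E y₁) := by
              have := h.le_right y
              have := h'.right_le y
              have := (h'.right_pos y).le
              gcongr
          _ = E y₁ / κ ^ 2 * E y := by field_simp
          _ ≤ _ := mul_le_mul_of_nonneg_right (by linarith) hE.le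
      v_one := by rw [h.norm, h'.norm, div_one]
      M_nonneg := by positivity
      S_nonneg := (tsum_nonneg fun y => mul_nonneg (pow_pos (hk.E_pos y) 4).le (hs.1 y)).trans h4S
      eta_nonneg := hη
      sum_E := h4
      sum_E_le := h4S
      sum_dr := hdr
      sum_dr_le := hdrη
      sum_ds := hds
      sum_ds_le := hdsη }

end IsNormalizedScaling

theorem abs_log_le {t : ℝ} (ht : 0 < t) : |Real.log t| ≤ t + t⁻¹ := by
  have h1 := Real.log_le_sub_one_of_pos ht
  have h2 := Real.log_le_sub_one_of_pos (inv_pos.2 ht)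
  rw [Real.log_inv] at h2
  have := inv_pos.2 ht
  exact abs_le.2 ⟨by linarith, by linarith⟩

/-- The potentials of a normalized scaling, shifted so that the second one vanishes at `y₁`. -/
theorem exists_potentials_of_scaling {κ S : ℝ} {y₁ : Y} {r : X → ℝ} {s : Y → ℝ} {f : X → ℝ}
    {g : Y → ℝ} (hlam : 0 < lam)
    (hk : KernelBounds (reducedKernel c lam cXm cYm) (expWeight lam cYm cYp) κ)
    (h : IsNormalizedScaling (reducedKernel c lam cXm cYm) (expWeight lam cYm cYp) κ S y₁ r s f g)
    (hr : IsProb r) (hs : IsProb s) (hS : 1 ≤ S)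
    (hrC : Summable fun x => growthWeight cXm cXp x * |r x|)
    (hsK : Summable fun y => kWeight lam 4 cYm cYp y * |s y|) :
    ∃ (α : X → ℝ) (β : Y → ℝ),
      density c lam α β = (fun x y => f x * g y * reducedKernel c lam cXm cYm x y) ∧
      β y₁ = 0 ∧ (Summable fun x => |α x| * r x) ∧ Summable fun y => |β y| * s y := by
  set E := expWeight lam cYm cYp
  have hκ := hk.kappa_pos
  have hE1 := hk.E_pos y₁
  have hS0 : 0 < S := zero_lt_one.trans_le hS
  refine ⟨fun x => cXm x + lam * Real.log (f x) + cYm y₁,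
    fun y => cYm y + lam * Real.log (g y) - cYm y₁, ?_, ?_, ?_, ?_⟩
  · funext x y
    have hf := h.left_pos x
    have hg := h.right_pos y
    simp only [density, reducedKernel]
    have : (cXm x + lam * Real.log (f x) + cYm y₁ + (cYm y + lam * Real.log (g y) - cYm y₁) -
        c x y) / lam = Real.log (f x) + Real.log (g y) + -(c x y - cXm x - cYm y) / lam := by
      field_simp
      ring
    rw [this, Real.exp_add, Real.exp_add, Real.exp_log hf, Real.exp_log hg]
  · simp [h.norm]
  · set A := S * E y₁ / κ ^ 2 + (κ / S)⁻¹
    have hA : 0 ≤ A := by positivity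
    refine Summable.of_nonneg_of_le (fun x => mul_nonneg (abs_nonneg _) (hr.1 x)) (fun x => ?_)
      (hrC.mul_left (1 + lam * A + |cYm y₁|))
    rw [abs_of_nonneg (hr.1 x), ← mul_assoc]
    refine mul_le_mul_of_nonneg_right ?_ (hr.1 x)
    have h1 : |Real.log (f x)| ≤ A := (abs_log_le (h.left_pos x)).trans
      (add_le_add (h.left_le x) (inv_anti₀ (by positivity) (h.le_left x)))
    have h2 : |cXm x| ≤ growthWeight cXm cXp x := by
      unfold growthWeight; linarith [abs_nonneg (cXp x)]
    have h3 := one_le_growthWeight cXm cXp x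
    have h4 : 0 ≤ lam * A + |cYm y₁| := by positivity
    calc _ ≤ |cXm x| + lam * |Real.log (f x)| + |cYm y₁| := by
          refine (abs_add_le _ _).trans (add_le_add ((abs_add_le _ _).trans ?_) le_rfl)
          rw [abs_mul, abs_of_pos hlam]
      _ ≤ growthWeight cXm cXp x + lam * A + |cYm y₁| := by gcongr
      _ ≤ _ := by nlinarith
  · set A := κ⁻¹ + (κ / E y₁)⁻¹
    have hA : 0 ≤ A := by positivity
    refine Summable.of_nonneg_of_le (fun y => mul_nonneg (abs_nonneg _) (hs.1 y)) (fun y => ?_)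
      (hsK.mul_left (1 + lam * A + |cYm y₁|))
    rw [abs_of_nonneg (hs.1 y), ← mul_assoc]
    refine mul_le_mul_of_nonneg_right ?_ (hs.1 y)
    have hE := hk.one_le y
    have hE4 : 1 ≤ E y ^ 4 := one_le_pow₀ hE
    have hE14 : E y ≤ E y ^ 4 := le_self_pow₀ hE (by norm_num)
    have h1 : |Real.log (g y)| ≤ A * E y ^ 4 := by
      calc _ ≤ _ := abs_log_le (h.right_pos y)
        _ ≤ E y / κ + (κ / E y₁)⁻¹ :=
          add_le_add (h.right_le y) (inv_anti₀ (by positivity) (h.le_right y))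
        _ = κ⁻¹ * E y + (κ / E y₁)⁻¹ * 1 := by rw [div_eq_inv_mul, mul_one]
        _ ≤ κ⁻¹ * E y ^ 4 + (κ / E y₁)⁻¹ * E y ^ 4 := by gcongr
        _ = _ := by ring
    have h2 : |cYm y| ≤ growthWeight cYm cYp y := by
      unfold growthWeight; linarith [abs_nonneg (cYp y)]
    have h3 := one_le_growthWeight cYm cYp y
    have h4 : growthWeight cYm cYp y ≤ growthWeight cYm cYp y * E y ^ 4 :=
      le_mul_of_one_le_right (by linarith) hE4
    have h5 : E y ^ 4 ≤ growthWeight cYm cYp y * E y ^ 4 :=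
      le_mul_of_one_le_left (by linarith) h3
    change _ ≤ (1 + lam * A + |cYm y₁|) * (growthWeight cYm cYp y * E y ^ 4)
    calc _ ≤ |cYm y| + lam * |Real.log (g y)| + |cYm y₁| := by
          refine (abs_sub _ _).trans (add_le_add ((abs_add_le _ _).trans ?_) le_rfl)
          rw [abs_mul, abs_of_pos hlam]
      _ ≤ growthWeight cYm cYp y * E y ^ 4 + lam * (A * (growthWeight cYm cYp y * E y ^ 4)) +
          |cYm y₁| * (growthWeight cYm cYp y * E y ^ 4) := by
        gcongr
        · exact h2.trans h4
        · exact h1.trans (mul_le_mul_of_nonneg_left h5 hA)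
        · exact le_mul_of_one_le_right (abs_nonneg _) (by linarith)
      _ = _ := by ring

end Cost

/-! ### The plan map -/

section PlanMap

variable {c : X → Y → ℝ} {cXm cXp : X → ℝ} {cYm cYp : Y → ℝ} {lam : ℝ} {r : X → ℝ} {s : Y → ℝ}

theorem plan_eq_of_isPlan_iff {π₀ : X × Y → ℝ} (h : ∀ π, IsPlan c lam r s π ↔ π = π₀) :
    plan c lam r s = π₀ :=
  (h _).1 (Classical.epsilon_spec (p := IsPlan c lam r s) ⟨π₀, (h π₀).2 rfl⟩)

/-- Every coupling belongs to `ℓ¹` with the weight `f ⊕ g`. -/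
theorem summable_sumWeight_of_mem_couplings {f : X → ℝ} {g : Y → ℝ} [PosWeight f] [PosWeight g]
    {π : X × Y → ℝ} (hπ : π ∈ couplings r s) (hr : IsProb r) (hs : IsProb s)
    (hf : Summable fun x => f x * |r x|) (hg : Summable fun y => g y * |s y|) :
    Summable fun p => sumWeight f g p * |π p| := by
  have h1 := hasSum_of_mem_couplings_left hπ (w := f) (hf.congr fun x => by
    rw [abs_of_pos (PosWeight.pos (f := f) x), abs_of_nonneg (hr.1 x)])
  have h2 := hasSum_of_mem_couplings_right hπ (w := g) (hg.congr fun y => by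
    rw [abs_of_pos (PosWeight.pos (f := g) y), abs_of_nonneg (hs.1 y)])
  refine (h1.add h2).summable.congr fun p => ?_
  rw [abs_of_nonneg (hπ.1 p)]
  simp only [sumWeight]
  ring

theorem summable_growthWeight_of_kWeight (hlam : 0 < lam) (hcY : ∀ y, cYm y ≤ cYp y)
    (hsK : Summable fun y => kWeight lam 4 cYm cYp y * |s y|) :
    Summable fun y => growthWeight cYm cYp y * |s y| := by
  refine Summable.of_nonneg_of_le (fun y => mul_nonneg (PosWeight.pos y).le (abs_nonneg _))
    (fun y => mul_le_mul_of_nonneg_right ?_ (abs_nonneg _)) hsK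
  exact le_mul_of_one_le_right (PosWeight.pos y).le
    (one_le_pow₀ (one_le_expWeight hlam hcY y))

theorem summable_cost_of_mem_couplings
    (hc : ∀ x y, cXm x + cYm y ≤ c x y ∧ c x y ≤ cXp x + cYp y) {π : X × Y → ℝ}
    (hw : Summable fun p => sumWeight (growthWeight cXm cXp) (growthWeight cYm cYp) p * |π p|) :
    Summable fun p : X × Y => c p.1 p.2 * π p := by
  refine Summable.of_norm_bounded hw fun p => ?_
  rw [norm_mul, Real.norm_eq_abs, Real.norm_eq_abs]
  refine mul_le_mul_of_nonneg_right ?_ (abs_nonneg _)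
  have h1 := hc p.1 p.2
  simp only [sumWeight, growthWeight]
  exact abs_le.2
    ⟨by linarith [neg_abs_le (cXm p.1), neg_abs_le (cYm p.2), abs_nonneg (cXp p.1),
        abs_nonneg (cYp p.2)],
      by linarith [le_abs_self (cXp p.1), le_abs_self (cYp p.2), abs_nonneg (cXm p.1),
        abs_nonneg (cYm p.2)]⟩

end PlanMap

end EROT

/-! ### The plan map and the linearized system -/

namespace EROT

variable {X Y : Type*}

section Setting

variable {c : X → Y → ℝ} {cXm cXp : X → ℝ} {cYm cYp : Y → ℝ} {lam : ℝ}

/-- For marginals of finite weighted norm a normalized scaling yields the unique plan. -/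
theorem isPlan_iff_of_scaling
    (hc : ∀ x y, cXm x + cYm y ≤ c x y ∧ c x y ≤ cXp x + cYp y) (hlam : 0 < lam)
    (hcY : ∀ y, cYm y ≤ cYp y) {κ S : ℝ} {y₁ : Y} {r : X → ℝ} {s : Y → ℝ} {f : X → ℝ} {g : Y → ℝ}
    (hk : KernelBounds (reducedKernel c lam cXm cYm) (expWeight lam cYm cYp) κ)
    (h : IsNormalizedScaling (reducedKernel c lam cXm cYm) (expWeight lam cYm cYp) κ S y₁ r s f g)
    (hr : IsProb r) (hs : IsProb s) (hS : 1 ≤ S)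
    (hrC : Summable fun x => growthWeight cXm cXp x * |r x|)
    (hsK : Summable fun y => kWeight lam 4 cYm cYp y * |s y|) (π : X × Y → ℝ) :
    IsPlan c lam r s π ↔
      π = withDensity (fun x y => f x * g y * reducedKernel c lam cXm cYm x y) r s := by
  obtain ⟨α, β, hd, -, hα, hβ⟩ := exists_potentials_of_scaling hlam hk h hr hs hS hrC hsK
  have hρ := h.isDensity hk
  rw [← hd] at hρ ⊢
  refine isPlan_iff hr hs hlam hρ hα hβ (fun π' hπ' => ?_) π
  exact summable_cost_of_mem_couplings hc (summable_sumWeight_of_mem_couplings hπ' hr hs hrC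
    (summable_growthWeight_of_kWeight hlam hcY hsK))

/-- The values of the plan map at a pair of marginals with a normalized scaling. -/
theorem planMap_eq_of_scaling
    (hc : ∀ x y, cXm x + cYm y ≤ c x y ∧ c x y ≤ cXp x + cYp y) (hlam : 0 < lam)
    (hcY : ∀ y, cYm y ≤ cYp y) {κ S : ℝ} {y₁ : Y} {f : X → ℝ} {g : Y → ℝ}
    (hk : KernelBounds (reducedKernel c lam cXm cYm) (expWeight lam cYm cYp) κ)
    {k : WL1 (growthWeight cXm cXp) × WL1 (kWeight lam 4 cYm cYp)}
    (hprob : k ∈ probPairs (growthWeight cXm cXp) (kWeight lam 4 cYm cYp))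
    (h : IsNormalizedScaling (reducedKernel c lam cXm cYm) (expWeight lam cYm cYp) κ S y₁ k.1 k.2
      f g) (hS : 1 ≤ S) :
    (planMap c lam (growthWeight cXm cXp) (kWeight lam 4 cYm cYp)
        (sumWeight (growthWeight cXm cXp) (growthWeight cYm cYp)) k : X × Y → ℝ) =
      withDensity (fun x y => f x * g y * reducedKernel c lam cXm cYm x y) k.1 k.2 := by
  have hiff := isPlan_iff_of_scaling hc hlam hcY hk h hprob.1 hprob.2 hS k.1.summable k.2.summable
  have hmem : withDensity (fun x y => f x * g y * reducedKernel c lam cXm cYm x y) k.1 k.2 ∈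
      couplings k.1 k.2 := (h.isDensity hk).mem_couplings hprob.1 hprob.2
  rw [planMap, plan_eq_of_isPlan_iff hiff]
  exact WL1.ofFun_coe (summable_sumWeight_of_mem_couplings hmem hprob.1 hprob.2 k.1.summable
    (summable_growthWeight_of_kWeight hlam hcY k.2.summable))

theorem summable_expWeight_mul (hlam : 0 < lam) (hcY : ∀ y, cYm y ≤ cYp y)
    (a : WL1 (kWeight lam 4 cYm cYp)) {m : ℕ} (hm : m ≤ 4) :
    (Summable fun y => expWeight lam cYm cYp y ^ m * |a y|) ∧
      ∑' y, expWeight lam cYm cYp y ^ m * |a y| ≤ ‖a‖ := by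
  have := WL1.tsum_mul_abs_le a (w := fun y => expWeight lam cYm cYp y ^ m) (M := 1)
    (fun y => (pow_pos (PosWeight.pos y) m).le) (fun y => by
      rw [one_mul]
      have h1 := one_le_expWeight hlam hcY y
      calc expWeight lam cYm cYp y ^ m ≤ expWeight lam cYm cYp y ^ 4 := pow_le_pow_right₀ h1 hm
        _ ≤ kWeight lam 4 cYm cYp y := le_mul_of_one_le_left (by positivity)
            (one_le_growthWeight _ _ y))
  rwa [one_mul] at this

theorem exists_scaling_of_mem_probPairs (hlam : 0 < lam) (hcY : ∀ y, cYm y ≤ cYp y) {κ S : ℝ}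
    (hk : KernelBounds (reducedKernel c lam cXm cYm) (expWeight lam cYm cYp) κ) (y₁ : Y)
    {k : WL1 (growthWeight cXm cXp) × WL1 (kWeight lam 4 cYm cYp)}
    (hprob : k ∈ probPairs (growthWeight cXm cXp) (kWeight lam 4 cYm cYp)) (hS : ‖k.2‖ ≤ S) :
    1 ≤ S ∧ ∃ f g, IsNormalizedScaling (reducedKernel c lam cXm cYm) (expWeight lam cYm cYp) κ S y₁
      k.1 k.2 f g := by
  obtain ⟨h1, h2⟩ := summable_expWeight_mul hlam hcY k.2 (show 1 ≤ 4 by norm_num)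
  have he : (fun y => expWeight lam cYm cYp y ^ 1 * |k.2 y|) =
      fun y => expWeight lam cYm cYp y * k.2 y := funext fun y => by
    rw [pow_one, abs_of_nonneg (hprob.2.1 y)]
  rw [he] at h1 h2
  exact ⟨(hk.one_le_of_hasSum hprob.2 h1.hasSum).trans (h2.trans hS),
    hk.exists_isNormalizedScaling hprob.1 hprob.2 h1 (h2.trans hS) y₁⟩

/-- Near a fully supported pair of marginals the plan map agrees with its linearization up to a
quadratic error, since all scalings of nearby marginals satisfy the same a priori bounds. -/
theorem exists_planMap_quadratic
    (hc : ∀ x y, cXm x + cYm y ≤ c x y ∧ c x y ≤ cXp x + cYp y) (hlam : 0 < lam)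
    (hcY : ∀ y, cYm y ≤ cYp y) {κ S : ℝ} {y₁ : Y} {f : X → ℝ} {g : Y → ℝ}
    (hk : KernelBounds (reducedKernel c lam cXm cYm) (expWeight lam cYm cYp) κ)
    {k : WL1 (growthWeight cXm cXp) × WL1 (kWeight lam 4 cYm cYp)}
    (hprob : k ∈ probPairs (growthWeight cXm cXp) (kWeight lam 4 cYm cYp))
    (h : IsNormalizedScaling (reducedKernel c lam cXm cYm) (expWeight lam cYm cYp) κ S y₁ k.1 k.2
      f g) (hS : ‖k.2‖ + 1 ≤ S) (hs1 : 0 < k.2 y₁)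
    {AX : WLinf (expWeightOff y₁ lam cYm cYp) →L[ℝ] WLinf (oneWeight X)}
    {AY : WLinf (oneWeight X) →L[ℝ] WLinf (expWeightOff y₁ lam cYm cYp)}
    {BX : WL1 (kWeight lam 4 cYm cYp) →L[ℝ] WLinf (oneWeight X)}
    {BY : WL1 (growthWeight cXm cXp) →L[ℝ] WLinf (expWeightOff y₁ lam cYm cYp)}
    (hops : IsMarginalOps (fun x y => f x * g y * reducedKernel c lam cXm cYm x y) k.1 k.2
      AX AY BX BY)
    {D : (WL1 (growthWeight cXm cXp) × WL1 (kWeight lam 4 cYm cYp)) →L[ℝ]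
        WL1 (sumWeight (growthWeight cXm cXp) (growthWeight cYm cYp))}
    (hD : ∀ h p, D h p = f p.1 * g p.2 * reducedKernel c lam cXm cYm p.1 p.2 *
          (k.1 p.1 * h.2 p.2 + h.1 p.1 * k.2 p.2) +
        f p.1 * g p.2 * reducedKernel c lam cXm cYm p.1 p.2 * (k.1 p.1 * k.2 p.2) *
          (derivU AX AY BX BY h p.1 + extendAt y₁ 0 (derivV AX AY BX BY h) p.2)) :
    ∃ C, ∀ k' ∈ probPairs (growthWeight cXm cXp) (kWeight lam 4 cYm cYp), ‖k' - k‖ ≤ 1 →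
      ‖planMap c lam (growthWeight cXm cXp) (kWeight lam 4 cYm cYp)
          (sumWeight (growthWeight cXm cXp) (growthWeight cYm cYp)) k' -
        planMap c lam (growthWeight cXm cXp) (kWeight lam 4 cYm cYp)
          (sumWeight (growthWeight cXm cXp) (growthWeight cYm cYp)) k - D (k' - k)‖ ≤
      C * ‖k' - k‖ ^ 2 := by
  set E := expWeight lam cYm cYp
  have hκ := hk.kappa_pos
  have hE1 := hk.E_pos y₁
  have hS1 : 1 ≤ S := by linarith [norm_nonneg k.2]
  have hS0 : 0 < S := zero_lt_one.trans_le hS1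
  obtain ⟨C, hC, hexp⟩ := Perturbation.exists_plan_expansion hops
    (S ^ 2 * E y₁ / κ ^ 3 + E y₁ / κ ^ 2) (κ ^ 2 * k.2 y₁ / (S * E y₁)) ‖k.2‖ (by positivity)
    (norm_nonneg _) (by positivity)
  refine ⟨2 * (C * (‖k.1‖ * ‖k.2‖) + C * ‖k.1‖ + C * ‖k.2‖ + C * 2), fun k' hk' hle => ?_⟩
  set d := k' - k with hd
  have hd1 : ‖d.1‖ ≤ ‖d‖ := norm_fst_le d
  have hd2 : ‖d.2‖ ≤ ‖d‖ := norm_snd_le d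
  have hS' : ‖k'.2‖ ≤ S := by
    have h1 : k'.2 = k.2 + d.2 := by simp [hd]
    rw [h1]
    linarith [norm_add_le k.2 d.2]
  obtain ⟨-, f', g', h'⟩ := exists_scaling_of_mem_probPairs hlam hcY hk y₁ hk' hS'
  have h4 := summable_expWeight_mul hlam hcY k.2 (le_refl 4)
  have he4 : (fun y => E y ^ 4 * |k.2 y|) = fun y => E y ^ 4 * k.2 y := funext fun y => by
    rw [abs_of_nonneg (hprob.2.1 y)]
  have hdr := WL1.tsum_mul_abs_le d.1 (w := fun _ => 1) (M := 1) (fun _ => zero_le_one)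
    (fun x => by rw [one_mul]; exact one_le_growthWeight cXm cXp x)
  simp only [one_mul] at hdr
  have hds := summable_expWeight_mul hlam hcY d.2 (le_refl 4)
  have hpert := h.perturbation h' hk hprob.1 hprob.2 hs1 hS1 (norm_nonneg d)
    (he4 ▸ h4.1) (he4 ▸ h4.2) hdr.1 (hdr.2.trans hd1) hds.1 (hds.2.trans hd2)
  have hpt := hexp k'.1 k'.2 _ _ _ d hpert (fun x => rfl) (fun y => rfl)
  set z := planMap c lam (growthWeight cXm cXp) (kWeight lam 4 cYm cYp)
          (sumWeight (growthWeight cXm cXp) (growthWeight cYm cYp)) k' -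
        planMap c lam (growthWeight cXm cXp) (kWeight lam 4 cYm cYp)
          (sumWeight (growthWeight cXm cXp) (growthWeight cYm cYp)) k - D d with hz
  have hzp : ∀ p, z p = f p.1 * g p.2 * reducedKernel c lam cXm cYm p.1 p.2 *
        (f' p.1 / f p.1 * (g' p.2 / g p.2)) * (k'.1 p.1 * k'.2 p.2) -
      f p.1 * g p.2 * reducedKernel c lam cXm cYm p.1 p.2 * (k.1 p.1 * k.2 p.2) - D d p :=
    fun p => by
      have hf := (h.left_pos p.1).ne'
      have hg := (h.right_pos p.2).ne'
      have e1 := congrFun (planMap_eq_of_scaling hc hlam hcY hk hk' h' hS1) p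
      have e2 := congrFun (planMap_eq_of_scaling hc hlam hcY hk hprob h hS1) p
      rw [hz, WL1.sub_apply, WL1.sub_apply, e1, e2]
      simp only [withDensity]
      congr 2
      field_simp
  have hb := weighted_sum_le k d (z := z) (A := C * ‖d‖ ^ 2) (B := C * ‖d‖) (C := C * ‖d‖)
    (D := C * (‖d‖ + 1)) fun p => by
      rw [hzp p, hD]
      exact hpt p.1 p.2
  rw [WL1.norm_def]
  refine hb.2.trans ?_
  have hn := norm_nonneg d
  have i1 : C * ‖d‖ * (‖k.1‖ * ‖d.2‖) ≤ C * ‖d‖ * (‖k.1‖ * ‖d‖) := by gcongr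
  have i2 : C * ‖d‖ * (‖d.1‖ * ‖k.2‖) ≤ C * ‖d‖ * (‖d‖ * ‖k.2‖) := by gcongr
  have i3 : C * (‖d‖ + 1) * (‖d.1‖ * ‖d.2‖) ≤ C * (1 + 1) * (‖d‖ * ‖d‖) := by gcongr
  calc _ ≤ 2 * (C * ‖d‖ ^ 2 * (‖k.1‖ * ‖k.2‖) + C * ‖d‖ * (‖k.1‖ * ‖d‖) +
        C * ‖d‖ * (‖d‖ * ‖k.2‖) + C * (1 + 1) * (‖d‖ * ‖d‖)) := by linarith
    _ = _ := by ring

end Setting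

/-! ### The linearized optimality system -/

section System

variable {c : X → Y → ℝ} {cXm cXp : X → ℝ} {cYm cYp : Y → ℝ} {lam : ℝ} {y₁ : Y} {ρ : X → Y → ℝ}
  {k : WL1 (growthWeight cXm cXp) × WL1 (kWeight lam 4 cYm cYp)}
  {AX : WLinf (expWeightOff y₁ lam cYm cYp) →L[ℝ] WLinf (oneWeight X)}
  {AY : WLinf (oneWeight X) →L[ℝ] WLinf (expWeightOff y₁ lam cYm cYp)}
  {BX : WL1 (kWeight lam 4 cYm cYp) →L[ℝ] WLinf (oneWeight X)}
  {BY : WL1 (growthWeight cXm cXp) →L[ℝ] WLinf (expWeightOff y₁ lam cYm cYp)}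

/-- The marginals of a solution of the first equation of the linearized system. -/
theorem linearized_marginals {r : X → ℝ} {s : Y → ℝ} (hρ : IsDensity ρ r s)
    (hops : IsMarginalOps ρ r s AX AY BX BY)
    (h : WL1 (growthWeight cXm cXp) × WL1 (kWeight lam 4 cYm cYp)) (a : WLinf (oneWeight X))
    (b : WLinf (expWeightOff y₁ lam cYm cYp)) {z : X × Y → ℝ}
    (hz : ∀ p, z p = ρ p.1 p.2 * (r p.1 * h.2 p.2 + h.1 p.1 * s p.2) +
      ρ p.1 p.2 * (r p.1 * s p.2) * (a p.1 + extendAt y₁ 0 b p.2)) :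
    (∀ x, ∑' y, z (x, y) = h.1 x + r x * (a x + AX b x + BX h.2 x)) ∧
      ∀ y : {y : Y // y ≠ y₁}, ∑' x, z (x, y.1) = h.2 y.1 + s y.1 * (AY a y + b y + BY h.1 y) := by
  constructor
  · intro x
    have h1 := ((hops.BX_apply h.2 x).mul_left (r x)).add ((hρ.left x).mul_left (h.1 x))
    have h2 := ((hρ.left x).mul_left (r x * a x)).add ((hops.AX_extendAt b x).mul_left (r x))
    rw [((h1.add h2).congr_fun fun y => by rw [hz]; ring).tsum_eq]
    ring
  · intro y
    have h1 := ((hops.BY_apply h.1 y).mul_left (s y.1)).add ((hρ.right y.1).mul_left (h.2 y.1))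
    have h2 := ((hops.AY_apply a y).mul_left (s y.1)).add ((hρ.right y.1).mul_left (s y.1 * b y))
    rw [((h1.add h2).congr_fun fun x => by rw [hz, extendAt_of_ne _ y.2]; ring).tsum_eq]
    ring

theorem starT_eq {α : X → ℝ} {β : Y → ℝ} (hβ : β y₁ = 0) (p : X × Y) :
    starT y₁ α (fun y => β y.1) p = α p.1 + β p.2 := by
  by_cases hy : p.2 = y₁
  · simp [starT, hy, hβ]
  · simp [starT, extendAt_of_ne _ hy]

theorem extendAt_neg_tsum {h : Y → ℝ} (hh : HasSum h 0) (y : Y) :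
    extendAt y₁ (-∑' y : {y : Y // y ≠ y₁}, h y.1) (fun y => h y.1) y = h y := by
  by_cases hy : y = y₁
  · subst hy
    rw [extendAt_self, (hasSum_subtype_ne hh y).tsum_eq]; ring
  · rw [extendAt_of_ne _ hy]

/-- The first equation of the linearized system determines `z` from `(a, b)`; the marginal equations
then become the system of `deriv_system_unique` for `(a, b) / lam`. -/
theorem linearized_system_iff {r : X → ℝ} {s : Y → ℝ} (hlam : 0 < lam) {α : X → ℝ} {β : Y → ℝ}
    (hβ : β y₁ = 0) (hρ : IsDensity (density c lam α β) r s) (hr0 : ∀ x, 0 < r x)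
    (hs0 : ∀ y, 0 < s y)
    (hops : IsMarginalOps (density c lam α β) r s AX AY BX BY)
    {D : (WL1 (growthWeight cXm cXp) × WL1 (kWeight lam 4 cYm cYp)) →L[ℝ]
        WL1 (sumWeight (growthWeight cXm cXp) (growthWeight cYm cYp))}
    (hD : ∀ h p, D h p = density c lam α β p.1 p.2 * (r p.1 * h.2 p.2 + h.1 p.1 * s p.2) +
        density c lam α β p.1 p.2 * (r p.1 * s p.2) *
          (derivU AX AY BX BY h p.1 + extendAt y₁ 0 (derivV AX AY BX BY h) p.2))
    {h : WL1 (growthWeight cXm cXp) × WL1 (kWeight lam 4 cYm cYp)} (hh : HasSum h.2 0)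
    (z : WL1 (sumWeight (growthWeight cXm cXp) (growthWeight cYm cYp)))
    (a : WLinf (oneWeight X)) (b : WLinf (expWeightOff y₁ lam cYm cYp)) :
    systemDerivSol c lam y₁ r s α (fun y => β y.1) z a b =
        -systemDerivMarg c lam y₁ r s α (fun y => β y.1) h.1 (fun y => h.2 y.1) ↔
      z = D h ∧ a = lam • derivU AX AY BX BY h ∧ b = lam • derivV AX AY BX BY h := by
  have hext : ∀ (t : ℝ) (b : WLinf (expWeightOff y₁ lam cYm cYp)) (y : Y),
      extendAt y₁ 0 (t • b : WLinf (expWeightOff y₁ lam cYm cYp)) y = t * extendAt y₁ 0 b y := fun t b y => by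
    by_cases hy : y = y₁
    · rw [hy, extendAt_self, extendAt_self, mul_zero]
    · rw [extendAt_of_ne _ hy, extendAt_of_ne _ hy, WLinf.smul_apply]
  -- the first equation in terms of `lam⁻¹ (a, b)`
  have hfirst : (∀ p, z p - lam⁻¹ * Real.exp ((starT y₁ α (fun y => β y.1) p - c p.1 p.2) / lam) *
        (r p.1 * s p.2) * starT y₁ a b p =
      -(-(Real.exp ((starT y₁ α (fun y => β y.1) p - c p.1 p.2) / lam) * (r p.1 *
        extendAt y₁ (-∑' y : {y : Y // y ≠ y₁}, h.2 y.1) (fun y => h.2 y.1) p.2 +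
          h.1 p.1 * s p.2)))) ↔
      ∀ p, z p = density c lam α β p.1 p.2 * (r p.1 * h.2 p.2 + h.1 p.1 * s p.2) +
        density c lam α β p.1 p.2 * (r p.1 * s p.2) *
          ((lam⁻¹ • a) p.1 + extendAt y₁ 0 (lam⁻¹ • b : WLinf (expWeightOff y₁ lam cYm cYp)) p.2) := by
    refine forall_congr' fun p => ?_
    rw [starT_eq hβ, extendAt_neg_tsum hh, hext, WLinf.smul_apply, ← sub_eq_zero,
      ← sub_eq_zero (a := z p)]
    refine Eq.congr_left ?_
    simp only [starT, density]
    ring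
  have hsol : systemDerivSol c lam y₁ r s α (fun y => β y.1) z a b =
        -systemDerivMarg c lam y₁ r s α (fun y => β y.1) h.1 (fun y => h.2 y.1) ↔
      (∀ p, z p = density c lam α β p.1 p.2 * (r p.1 * h.2 p.2 + h.1 p.1 * s p.2) +
        density c lam α β p.1 p.2 * (r p.1 * s p.2) *
          ((lam⁻¹ • a) p.1 + extendAt y₁ 0 (lam⁻¹ • b : WLinf (expWeightOff y₁ lam cYm cYp)) p.2)) ∧
      (∀ x, ∑' y, z (x, y) = h.1 x) ∧ ∀ y : {y : Y // y ≠ y₁}, ∑' x, z (x, y.1) = h.2 y.1 := by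
    rw [← hfirst]
    simp only [systemDerivSol, systemDerivMarg, Prod.ext_iff, funext_iff, Prod.neg_mk,
      Pi.neg_apply, neg_neg]
  rw [hsol]
  constructor
  · rintro ⟨hz, hx, hy⟩
    obtain ⟨m1, m2⟩ := linearized_marginals hρ hops h (lam⁻¹ • a) (lam⁻¹ • b) hz
    have e1 : lam⁻¹ • a + AX (lam⁻¹ • b) = -BX h.2 := WLinf.ext fun x => by
      have h1 := (m1 x).symm.trans (hx x)
      have h2 := (mul_eq_zero.1 (add_eq_left.1 h1)).resolve_left (hr0 x).ne'
      change (lam⁻¹ • a) x + AX (lam⁻¹ • b) x = -BX h.2 x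
      linarith
    have e2 : AY (lam⁻¹ • a) + lam⁻¹ • b = -BY h.1 := WLinf.ext fun y => by
      have h1 := (m2 y).symm.trans (hy y)
      have h2 := (mul_eq_zero.1 (add_eq_left.1 h1)).resolve_left (hs0 y.1).ne'
      change AY (lam⁻¹ • a) y + (lam⁻¹ • b) y = -BY h.1 y
      linarith
    obtain ⟨ha, hb⟩ := deriv_system_unique hops h e1 e2
    refine ⟨WL1.ext fun p => ?_, ?_, ?_⟩
    · rw [hz p, hD, ha, hb]
    · rw [← ha, smul_smul, mul_inv_cancel₀ hlam.ne', one_smul]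
    · rw [← hb, smul_smul, mul_inv_cancel₀ hlam.ne', one_smul]
  · rintro ⟨rfl, rfl, rfl⟩
    rw [smul_smul, smul_smul, inv_mul_cancel₀ hlam.ne', one_smul, one_smul]
    obtain ⟨m1, m2⟩ := linearized_marginals hρ hops h _ _ (hD h)
    obtain ⟨e1, e2⟩ := deriv_system hops h
    refine ⟨hD h, fun x => ?_, fun y => ?_⟩
    · have h1 : derivU AX AY BX BY h x + AX (derivV AX AY BX BY h) x = -BX h.2 x :=
        congrArg (fun t : WLinf (oneWeight X) => t x) e1
      rw [m1, h1]; ring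
    · have h1 : AY (derivU AX AY BX BY h) y + derivV AX AY BX BY h y = -BY h.1 y :=
        congrArg (fun t : WLinf (expWeightOff y₁ lam cYm cYp) => t y) e2
      rw [m2, h1]; ring

end System

end EROT

/-! ### Differentiability of the plan map -/

theorem mainTheorem3 {X Y : Type*} [Countable X] [Countable Y]
    (c : X → Y → ℝ) (cXm cXp : X → ℝ) (cYm cYp : Y → ℝ)
    (hcX : ∀ x, cXm x ≤ cXp x) (hcY : ∀ y, cYm y ≤ cYp y)
    (hc : ∀ x y, cXm x + cYm y ≤ c x y ∧ c x y ≤ cXp x + cYp y)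
    (hbdd : BddAbove (Set.range fun x => |cXp x - cXm x|))
    (lam : ℝ) (hlam : 0 < lam)
    (r : X → ℝ) (s : Y → ℝ) (hr : IsProb r) (hs : IsProb s)
    (hr_supp : ∀ x, 0 < r x) (hs_supp : ∀ y, 0 < s y)
    (hrC : Summable fun x => growthWeight cXm cXp x * |r x|)
    (hsK : Summable fun y => kWeight lam 4 cYm cYp y * |s y|)
    (y₁ : Y) :
    -- the plan map is well defined on the pairs of probability vectors
    (∀ k ∈ probPairs (growthWeight cXm cXp) (kWeight lam 4 cYm cYp), ∀ π : X × Y → ℝ,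
      IsPlan c lam k.1 k.2 π ↔
        π = planMap c lam (growthWeight cXm cXp) (kWeight lam 4 cYm cYp)
          (sumWeight (growthWeight cXm cXp) (growthWeight cYm cYp)) k) ∧
    -- the contingent cone
    contingentCone (probPairs (growthWeight cXm cXp) (kWeight lam 4 cYm cYp))
        (WL1.mk r hrC, WL1.mk s hsK) =
      massZeroPairs (growthWeight cXm cXp) (kWeight lam 4 cYm cYp) ∧
    (∃ hsC : Summable fun y => growthWeight cYm cYp y * |s y|,
      contingentCone (probPairs (growthWeight cXm cXp) (growthWeight cYm cYp))
          (WL1.mk r hrC, WL1.mk s hsC) =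
        massZeroPairs (growthWeight cXm cXp) (growthWeight cYm cYp)) ∧
    -- the operators and the derivative
    ∃ (AX : WLinf (expWeightOff y₁ lam cYm cYp) →L[ℝ] WLinf (oneWeight X))
      (AY : WLinf (oneWeight X) →L[ℝ] WLinf (expWeightOff y₁ lam cYm cYp))
      (BX : WL1 (kWeight lam 4 cYm cYp) →L[ℝ] WLinf (oneWeight X))
      (BY : WL1 (growthWeight cXm cXp) →L[ℝ] WLinf (expWeightOff y₁ lam cYm cYp))
      (D : (WL1 (growthWeight cXm cXp) × WL1 (kWeight lam 4 cYm cYp)) →L[ℝ]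
        WL1 (sumWeight (growthWeight cXm cXp) (growthWeight cYm cYp))),
      (∀ b x, HasSum (fun y : {y : Y // y ≠ y₁} => plan c lam r s (x, y.1) / r x * b y)
        (AX b x)) ∧
      (∀ a y, HasSum (fun x : X => plan c lam r s (x, y.1) / s y.1 * a x) (AY a y)) ∧
      (∀ h x, HasSum (fun y : Y => plan c lam r s (x, y) / (r x * s y) * h y) (BX h x)) ∧
      (∀ h y, HasSum (fun x : X => plan c lam r s (x, y.1) / (r x * s y.1) * h x) (BY h y)) ∧
      IsUnit (1 - AX ∘L AY) ∧ IsUnit (1 - AY ∘L AX) ∧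
      HasSum (fun m : ℕ => (AX ∘L AY) ^ m) (Ring.inverse (1 - AX ∘L AY)) ∧
      HasSum (fun m : ℕ => (AY ∘L AX) ^ m) (Ring.inverse (1 - AY ∘L AX)) ∧
      -- the explicit formula for the derivative
      (∀ h : WL1 (growthWeight cXm cXp) × WL1 (kWeight lam 4 cYm cYp), ∀ p : X × Y,
        D h p =
          plan c lam r s p / (r p.1 * s p.2) * (r p.1 * h.2 p.2 + h.1 p.1 * s p.2) -
          plan c lam r s p *
            starT y₁
              (Ring.inverse (1 - AX ∘L AY) (BX h.2) - Ring.inverse (1 - AX ∘L AY) (AX (BY h.1)))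
              (-AY (Ring.inverse (1 - AX ∘L AY) (BX h.2)) + Ring.inverse (1 - AY ∘L AX) (BY h.1))
              p) ∧
      -- Hadamard differentiability
      HasHadamardDerivTangentially
        (planMap c lam (growthWeight cXm cXp) (kWeight lam 4 cYm cYp)
          (sumWeight (growthWeight cXm cXp) (growthWeight cYm cYp)))
        D (probPairs (growthWeight cXm cXp) (kWeight lam 4 cYm cYp))
        (WL1.mk r hrC, WL1.mk s hsK) ∧
      -- the derivative through the partial derivatives of the optimality system
      (∃! q : (X → ℝ) × (Y → ℝ), IsPotentials c lam r s q.1 q.2 ∧ q.2 y₁ = 0) ∧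
      ∀ (α : X → ℝ) (β : Y → ℝ), IsPotentials c lam r s α β → β y₁ = 0 →
        ∀ h ∈ contingentCone (probPairs (growthWeight cXm cXp) (kWeight lam 4 cYm cYp))
            (WL1.mk r hrC, WL1.mk s hsK),
          ∃ (a₀ : WLinf (oneWeight X)) (b₀ : WLinf (expWeightOff y₁ lam cYm cYp)),
            ∀ (z : WL1 (sumWeight (growthWeight cXm cXp) (growthWeight cYm cYp)))
              (a : WLinf (oneWeight X)) (b : WLinf (expWeightOff y₁ lam cYm cYp)),
              systemDerivSol c lam y₁ r s α (fun y => β y.1) z a b =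
                  -systemDerivMarg c lam y₁ r s α (fun y => β y.1) h.1 (fun y => h.2 y.1) ↔
                z = D h ∧ a = a₀ ∧ b = b₀ := by
  obtain ⟨B, hB⟩ := hbdd
  have hB' : ∀ x, cXp x - cXm x ≤ B := fun x => (le_abs_self _).trans (hB ⟨x, rfl⟩)
  have hk := kernelBounds_reducedKernel hcY hc hlam hB'
  set κ := Real.exp (-B / lam)
  have hE := one_le_expWeight hlam hcY
  have hgX := one_le_growthWeight cXm cXp
  have hgY := one_le_growthWeight cYm cYp
  have hgK : ∀ y, 1 ≤ kWeight lam 4 cYm cYp y := fun y =>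
    one_le_mul_of_one_le_of_one_le (hgY y) (one_le_pow₀ (hE y))
  have hsC := summable_growthWeight_of_kWeight hlam hcY hsK
  set k₀ : WL1 (growthWeight cXm cXp) × WL1 (kWeight lam 4 cYm cYp) :=
    (WL1.mk r hrC, WL1.mk s hsK)
  have hprob : k₀ ∈ probPairs (growthWeight cXm cXp) (kWeight lam 4 cYm cYp) := ⟨hr, hs⟩
  have hcone := contingentCone_probPairs hgX hgK hr hs hr_supp hs_supp hrC hsK
  refine ⟨fun k hkp π => ?_, hcone,
    ⟨hsC, contingentCone_probPairs hgX hgY hr hs hr_supp hs_supp hrC hsC⟩, ?_⟩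
  · obtain ⟨hS, f, g, hfg⟩ := exists_scaling_of_mem_probPairs hlam hcY hk y₁ hkp le_rfl
    rw [planMap_eq_of_scaling hc hlam hcY hk hkp hfg hS]
    exact isPlan_iff_of_scaling hc hlam hcY hk hfg hkp.1 hkp.2 hS k.1.summable k.2.summable π
  -- The bound `S` exceeds the norm of `s`, so that it serves for all nearby marginals as well.
  set S := ‖k₀.2‖ + 1
  obtain ⟨hS, f, g, hfg⟩ := exists_scaling_of_mem_probPairs (S := S) hlam hcY hk y₁ hprob
    (by linarith)
  change IsNormalizedScaling _ _ κ S y₁ r s f g at hfg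
  have hρ := hfg.isDensity hk
  have hκ := hk.kappa_pos
  have hE1 := hk.E_pos y₁
  have hs1 := hs_supp y₁
  have hS0 : 0 < S := zero_lt_one.trans_le hS
  have hM : 0 ≤ S ^ 2 * expWeight lam cYm cYp y₁ / κ ^ 3 + expWeight lam cYm cYp y₁ / κ ^ 2 := by
    positivity
  have h4 := (summable_expWeight_mul hlam hcY k₀.2 (le_refl 4)).1
  have h4' : Summable fun y => expWeight lam cYm cYp y ^ 4 * s y :=
    h4.congr fun y => by
      change _ * |s y| = _
      rw [abs_of_pos (hs_supp y)]
  obtain ⟨AX, AY, BX, BY, hops⟩ := exists_isMarginalOps cXm cXp hρ hr.1 hs.1 hE hM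
    (hfg.density_le hk hS) (by positivity) (hfg.le_density hk hs1.le hS) h4'
  obtain ⟨D, hD⟩ := exists_plan_deriv hM hρ.pos (hfg.density_le hk hS) hE k₀
    (derivU AX AY BX BY) (derivV AX AY BX BY)
  obtain ⟨C, hC⟩ := exists_planMap_quadratic hc hlam hcY hk hprob hfg le_rfl hs1 hops hD
  obtain ⟨u1, u2, n1, n2, -⟩ := neumann_of_norm_comp_lt_one AX AY hops.norm_lt
  have hplan : plan c lam r s = _ := plan_eq_of_isPlan_iff
    (isPlan_iff_of_scaling hc hlam hcY hk hfg hr hs hS hrC hsK)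
  obtain ⟨α₀, β₀, hdens, hβ₀, hα₀s, hβ₀s⟩ :=
    exists_potentials_of_scaling hlam hk hfg hr hs hS hrC hsK
  have hpot := isPotentials_iff hr hs hr_supp hs_supp hlam (hdens ▸ hρ) hα₀s hβ₀s y₁
  have hrne : ∀ x, r x ≠ 0 := fun x => (hr_supp x).ne'
  have hsne : ∀ y, s y ≠ 0 := fun y => (hs_supp y).ne'
  rw [hplan]
  refine ⟨AX, AY, BX, BY, D, fun b x => ?_, fun a y => ?_, fun h x => ?_, fun h y => ?_, u1, u2,
    n1, n2, fun h p => ?_, hasHadamardDerivTangentially_of_quadratic hC, ?_, ?_⟩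
  · refine (hops.AX_apply b x).congr_fun fun y => ?_
    change _ * (r x * s y.1) / r x * b y = _ * s y.1 * b y
    have := hrne x
    field_simp
  · refine (hops.AY_apply a y).congr_fun fun x => ?_
    change _ * (r x * s y.1) / s y.1 * a x = _ * r x * a x
    have := hsne y.1
    field_simp
  · refine (hops.BX_apply h x).congr_fun fun y => ?_
    simp only [withDensity]
    rw [mul_div_cancel_right₀ _ (mul_ne_zero (hrne x) (hsne y))]
  · refine (hops.BY_apply h y).congr_fun fun x => ?_
    simp only [withDensity]
    rw [mul_div_cancel_right₀ _ (mul_ne_zero (hrne x) (hsne y.1))]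
  -- `derivU`, `derivV` have the opposite sign to the block matrix of the formula.
  · obtain ⟨e1, e2⟩ := neg_deriv_eq_block hops h
    rw [e1, hD]
    change _ = _ - _ * starT y₁ _ (-AY (Ring.inverse (1 - AX ∘L AY) (BX h.2)) +
      Ring.inverse (1 - AY ∘L AX) (BY h.1) : WLinf (expWeightOff y₁ lam cYm cYp)) p
    rw [e2]
    have hneg : extendAt y₁ 0 (-derivV AX AY BX BY h : WLinf (expWeightOff y₁ lam cYm cYp)) p.2 =
        -extendAt y₁ 0 (derivV AX AY BX BY h) p.2 := by
      by_cases hy : p.2 = y₁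
      · rw [hy, extendAt_self, extendAt_self, neg_zero]
      · rw [extendAt_of_ne _ hy, extendAt_of_ne _ hy, WLinf.neg_apply]
    simp only [withDensity, starT]
    rw [hneg, WLinf.neg_apply,
      mul_div_cancel_right₀ _ (mul_ne_zero (hrne p.1) (hsne p.2))]
    change _ * (r p.1 * h.2 p.2 + h.1 p.1 * s p.2) + _ * (r p.1 * s p.2) * _ = _
    ring
  · refine ⟨(α₀, β₀), ⟨(hpot α₀ β₀ rfl).2 ⟨rfl, rfl⟩, hβ₀⟩, fun q hq => ?_⟩
    obtain ⟨e1, e2⟩ := (hpot q.1 q.2 (hq.2.trans hβ₀.symm)).1 hq.1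
    exact Prod.ext e1 e2
  · intro α β hαβ hβ h hh
    obtain ⟨rfl, rfl⟩ := (hpot α β (hβ.trans hβ₀.symm)).1 hαβ
    rw [hcone] at hh
    rw [← hdens] at hρ hops
    refine ⟨lam • derivU AX AY BX BY h, lam • derivV AX AY BX BY h,
      linearized_system_iff hlam hβ hρ hr_supp hs_supp hops (fun h p => ?_) hh.2⟩
    rw [hD, hdens]
    rfl
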